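/- Let $\mathcal L$ be the language $\varphi ::= p \mid \varphi_1\wedge\varphi_2 \mid \neg\varphi \mid \mathrm{EF}\,\varphi$, where $p$ ranges over a set $AP$ of atoms. Let $\mathcal K=(\Sigma,\to,\ell)$ be a Kripke structure over $AP$: $\Sigma$ is a finite nonempty set of states, $\to\ \subseteq\Sigma\times\Sigma$ is total (every state has a successor), and $\ell:\Sigma\to\wp(AP)$. Atoms are interpreted by $\ell$, $\wedge$ and $\neg$ by intersection and complement, and $\mathrm{EF}$ by $\mathbf{EF}(X)=\{s \mid \text{some finite path, possibly of length } 0, \text{ leads from } s \text{ to a state of } X\}$. Let $P_\ell$ be the partition of $\Sigma$ into classes of states with equal label, and $P_{\mathcal L}$ the partition into classes of states that satisfy the same formulae of $\mathcal L$. For partitions, $P\preceq Q$ means that every block of $P$ is contained in a block of $Q$, and $P\curlywedge Q$ is the set of nonempty intersections $B\cap C$ with $B\in P$, $C\in Q$. A partition $P$ is strongly preserving for $\mathcal L$ if $P\preceq P_{\mathcal L}$. A block refiner of $P$ is a block $B\in P$ with $P\curlywedge\{\mathbf{EF}(B),\Sigma\smallsetminus\mathbf{EF}(B)\}\prec P$.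 The nondeterministic algorithm $\mathrm{IGPT}$ repeats $P:=P\curlywedge\{\mathbf{EF}(B),\Sigma\smallsetminus\mathbf{EF}(B)\}$ for some block refiner $B$ of the current partition $P$, until no block refiner is left. Consider the following implementation, a program for a unit-cost machine with registers, arrays and doubly linked lists (appending an element, removing an element, and passing to the next element each take constant time). Its input consists of a numbering of $\Sigma$, for each state the list of its predecessors, and a list of the blocks of $P_\ell$, each given as the list of its states; all lists are without repetitions and in any order. 1. Compute by Tarjan's depth-first algorithm the set $P_{\mathrm{scc}}$ of strongly connected components of $(\Sigma,\to)$, and the directed acyclic graph $\to_{\mathrm{scc}}$ on $P_{\mathrm{scc}}$ induced by $\to$ between distinct components. 2. Scan the list $P$ of blocks from its beginning to its end (the list changes during the scan). For the current block $B$: (a) let $B_{\mathrm{scc}}$ be the list of all $C\in P_{\mathrm{scc}}$ with $B\cap C\ne\varnothing$; (b) compute, by searching backwards along $\to_{\mathrm{scc}}$ and marking the components reached, the list of all components from which a component of $B_{\mathrm{scc}}$ can be reached, and let $S$ be the list of all states in these components; (c) split $P$ by $S$: scan the states $s$ of $S$, moving each $s$ from its block $D$ to a block $D\cap S$, which is created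 and appended to $P$ at the first such move from $D$; if $D$ becomes empty, move the states of $D\cap S$ back to $D$ and remove $D\cap S$ from $P$. At the end, move every block $D$ that was properly split to the end of $P$, and reset the flags of all blocks. 3. Output $P$. Theorem. There is an absolute constant $c$ such that, for every finite nonempty Kripke structure $\mathcal K=(\Sigma,\to,\ell)$ and every input that presents it as above, the program terminates after at most $c\,|\Sigma|\,|{\to}|$ steps. Its output is a list without repetitions of the blocks of a partition of $\Sigma$ that is the result of a terminating run of $\mathrm{IGPT}$ started at $P_\ell$, and that is the coarsest partition strongly preserving for $\mathcal L$. -/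

import Mathlib

namespace ReachPart

/-! ## Kripke structures, the language with `∧`, `¬`, `EF`, and strong preservation -/

/-- A Kripke structure over the atoms `AP`; the transition relation is total. -/
structure Kripke (S : Type*) (AP : Type*) where
  Trans : S → S → Prop
  total : ∀ s, ∃ t, Trans s t
  label : S → Set AP

/-- The formulae `φ ::= p | φ₁ ∧ φ₂ | ¬ φ | EF φ`. -/
inductive Formula (AP : Type*) where
  | atom : AP → Formula AP
  | and : Formula AP → Formula AP → Formula AP
  | neg : Formula AP → Formula AP
  | ef : Formula AP → Formula AP

/-- `Refines P Q`: the partition `Q` is coarser than `P` (`P ⪯ Q`). -/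
def Refines {S : Type*} (P Q : Set (Set S)) : Prop :=
  ∀ B ∈ P, ∃ C ∈ Q, B ⊆ C

/-- `P ⋏ Q`: the nonempty intersections of a member of `P` with a member of `Q`. -/
def meet {S : Type*} (P Q : Set (Set S)) : Set (Set S) :=
  {X | ∃ B ∈ P, ∃ C ∈ Q, X = B ∩ C ∧ X.Nonempty}

namespace Kripke

variable {S : Type*} {AP : Type*} (K : Kripke S AP)

/-- The existential until operator on sets of states. -/
def EU (S₁ S₂ : Set S) : Set S :=
  S₂ ∪ {s | s ∈ S₁ ∧ ∃ (n : ℕ) (p : ℕ → S), p 0 = s ∧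
    (∀ i < n, p i ∈ S₁ ∧ K.Trans (p i) (p (i + 1))) ∧ p n ∈ S₂}

/-- The reachability operator on sets of states. -/
def EF (X : Set S) : Set S := K.EU Set.univ X

/-- The set of states satisfying a formula. -/
def sem : Formula AP → Set S
  | .atom p => {s | p ∈ K.label s}
  | .and φ ψ => sem φ ∩ sem ψ
  | .neg φ => (sem φ)ᶜ
  | .ef φ => K.EF (sem φ)

/-- The partition `P_ℓ` induced by the labelling. -/
def labelPartition : Set (Set S) := (Setoid.ker K.label).classes

/-- Logical equivalence of states. -/
def logicSetoid : Setoid S where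
  r s t := ∀ φ : Formula AP, s ∈ K.sem φ ↔ t ∈ K.sem φ
  iseqv :=
    ⟨fun _ _ => Iff.rfl, fun h φ => (h φ).symm, fun h k φ => (h φ).trans (k φ)⟩

/-- The partition induced by logical equivalence. -/
def logicPartition : Set (Set S) := K.logicSetoid.classes

/-- A partition is strongly preserving for the language when it refines the partition
induced by logical equivalence. -/
def StronglyPreserving (P : Set (Set S)) : Prop :=
  Setoid.IsPartition P ∧ Refines P K.logicPartition

/-- `P` is the coarsest strongly preserving partition. -/
def IsCoarsestStronglyPreserving (P : Set (Set S)) : Prop :=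
  K.StronglyPreserving P ∧ ∀ Q, K.StronglyPreserving Q → Refines Q P

/-- Splitting the partition `P` by `EF(B)`. -/
def refineEF (P : Set (Set S)) (B : Set S) : Set (Set S) :=
  meet P {K.EF B, (K.EF B)ᶜ}

/-- The block refiners of `P`: the blocks `B` for which splitting by `EF(B)` yields a
strictly finer partition. -/
def blockRefiners (P : Set (Set S)) : Set (Set S) :=
  {B | B ∈ P ∧ Refines (K.refineEF P B) P ∧ K.refineEF P B ≠ P}

/-- `IGPTRun P Q`: some run of the (nondeterministic) refinement algorithm
`while blockRefiners P ≠ ∅ do choose B ∈ blockRefiners P; P := P ⋏ {EF(B), ∁ EF(B)}`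
started at `P` stops at `Q`. -/
def IGPTRun (P Q : Set (Set S)) : Prop :=
  Relation.ReflTransGen (fun X Y => ∃ B ∈ K.blockRefiners X, Y = K.refineEF X B) P Q ∧
    K.blockRefiners Q = ∅

/-- `|→|`, the number of transitions. -/
noncomputable def numTrans : ℕ := Set.ncard {p : S × S | K.Trans p.1 p.2}

end Kripke

/-! ## The machine

A random access machine under the uniform cost criterion whose memory holds
natural-number registers, natural-number arrays and doubly linked lists of positive
numbers; `0` is the null pointer. -/

/-- The registers. -/
inductive Reg where
  | time | numScc | numBlk | stamp
  | root | v | w | u | c | d | s | p | B | D | N | t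
  deriving DecidableEq

/-- The arrays. `index`, `low`, `parent`, `iter` belong to the depth-first search; `scc` gives
the strongly connected component of a state (`0` if there is none yet); `edgeMark`, `inBscc`
and `mark` hold marks on components; `block` is the block of a state; `inter` and `split` are
the fields of a block `B` called `intersection` and `split` (`inter` being either `0`, for
false, or the address of the block `B ∩ S`). -/
inductive Arr where
  | index | low | parent | iter
  | scc | edgeMark | inBscc | mark
  | block | inter | split
  deriving DecidableEq

/-- The families of lists, each indexed by natural numbers (families that consist of a single
list use the index `0`). `states`: all states; `pre s`: the predecessors of the state `s`;
`blocks`: the blocks of the current partition; `members B`: the states in the block `B`;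
`stack`: the stack of the depth-first search; `sccs`: all strongly connected components;
`sccStates C`: the states in the component `C`; `sccPre C`: the predecessors of `C` in the
graph of components; `bscc`, `result`, `ef`: the lists `B_scc`, `result` and `S`. -/
inductive Lst where
  | states | pre | blocks | members
  | stack | sccs | sccStates | sccPre
  | bscc | result | ef
  deriving DecidableEq

structure Memory where
  reg : Reg → ℕ
  arr : Arr → ℕ → ℕ
  lst : Lst → ℕ → List ℕ

namespace Memory

def setReg (m : Memory) (r : Reg) (x : ℕ) : Memory :=
  { m with reg := Function.update m.reg r x }

def setArr (m : Memory) (a : Arr) (i x : ℕ) : Memory :=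
  { m with arr := Function.update m.arr a (Function.update (m.arr a) i x) }

def setLst (m : Memory) (L : Lst) (i : ℕ) (l : List ℕ) : Memory :=
  { m with lst := Function.update m.lst L (Function.update (m.lst L) i l) }

end Memory

/-- Expressions: literals, registers, array cells, sums, and the first and the last element of
a list (`0` if the list is empty). -/
inductive Exp where
  | num : ℕ → Exp
  | reg : Reg → Exp
  | arr : Arr → Exp → Exp
  | add : Exp → Exp → Exp
  | first : Lst → Exp → Exp
  | last : Lst → Exp → Exp

namespace Exp

def eval (m : Memory) : Exp → ℕ
  | num k => k
  | reg r => m.reg r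
  | arr a i => m.arr a (i.eval m)
  | add e f => e.eval m + f.eval m
  | first L i => (m.lst L (i.eval m)).headD 0
  | last L i => (m.lst L (i.eval m)).getLastD 0

/-- Evaluating an expression costs one step for each of its nodes. -/
def cost : Exp → ℕ
  | num _ => 1
  | reg _ => 1
  | arr _ i => 1 + i.cost
  | add e f => 1 + e.cost + f.cost
  | first _ i => 1 + i.cost
  | last _ i => 1 + i.cost

end Exp

inductive Test where
  | eq : Exp → Exp → Test
  | ne : Exp → Exp → Test
  | lt : Exp → Exp → Test

namespace Test

def holds (m : Memory) : Test → Prop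
  | eq e f => e.eval m = f.eval m
  | ne e f => e.eval m ≠ f.eval m
  | lt e f => e.eval m < f.eval m

def cost : Test → ℕ
  | eq e f => 1 + e.cost + f.cost
  | ne e f => 1 + e.cost + f.cost
  | lt e f => 1 + e.cost + f.cost

end Test

/-- Commands. The list commands are: `clear L i` (replace the list `L i` by an empty list),
`append L i x`, `remove L i x`, and `next r L i x` (put into the register `r` the element that
follows `x` in the list `L i`, or `0` if `x` is the last one). -/
inductive Cmd where
  | skip : Cmd
  | assign : Reg → Exp → Cmd
  | store : Arr → Exp → Exp → Cmd
  | clear : Lst → Exp → Cmd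
  | append : Lst → Exp → Exp → Cmd
  | remove : Lst → Exp → Exp → Cmd
  | next : Reg → Lst → Exp → Exp → Cmd
  | seq : Cmd → Cmd → Cmd
  | ite : Test → Cmd → Cmd → Cmd
  | while : Test → Cmd → Cmd

/-- The element following the first occurrence of `x` in a list, or `0`. -/
def nextIn (x : ℕ) : List ℕ → ℕ
  | [] => 0
  | a :: l => if a = x then l.headD 0 else nextIn x l

/-- `Exec c m m' k`: started in the memory `m`, the command `c` halts in the memory `m'` after
exactly `k` steps. A list never holds an element twice and never holds `0`: `append` is stuck
on an element that is `0` or already present, and `remove` and `next` are stuck on an absent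
element. So a list can be kept as a doubly linked list whose pointer fields are addressed by
its elements, and each list command is a constant number of pointer operations. -/
inductive Exec : Cmd → Memory → Memory → ℕ → Prop where
  | skip (m) : Exec .skip m m 1
  | assign (m r e) : Exec (.assign r e) m (m.setReg r (e.eval m)) (1 + e.cost)
  | store (m a i e) :
      Exec (.store a i e) m (m.setArr a (i.eval m) (e.eval m)) (1 + i.cost + e.cost)
  | clear (m L i) : Exec (.clear L i) m (m.setLst L (i.eval m) []) (1 + i.cost)
  | append (m L i x) (h0 : x.eval m ≠ 0) (hx : x.eval m ∉ m.lst L (i.eval m)) :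
      Exec (.append L i x) m
        (m.setLst L (i.eval m) (m.lst L (i.eval m) ++ [x.eval m])) (1 + i.cost + x.cost)
  | remove (m L i x) (hx : x.eval m ∈ m.lst L (i.eval m)) :
      Exec (.remove L i x) m
        (m.setLst L (i.eval m) ((m.lst L (i.eval m)).erase (x.eval m))) (1 + i.cost + x.cost)
  | next (m r L i x) (hx : x.eval m ∈ m.lst L (i.eval m)) :
      Exec (.next r L i x) m
        (m.setReg r (nextIn (x.eval m) (m.lst L (i.eval m)))) (1 + i.cost + x.cost)
  | seq {c₁ c₂ m m' m'' k₁ k₂} (h₁ : Exec c₁ m m' k₁) (h₂ : Exec c₂ m' m'' k₂) :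
      Exec (.seq c₁ c₂) m m'' (k₁ + k₂)
  | ite_true {b c₁ c₂ m m' k} (hb : b.holds m) (h : Exec c₁ m m' k) :
      Exec (.ite b c₁ c₂) m m' (1 + b.cost + k)
  | ite_false {b c₁ c₂ m m' k} (hb : ¬ b.holds m) (h : Exec c₂ m m' k) :
      Exec (.ite b c₁ c₂) m m' (1 + b.cost + k)
  | while_true {b c m m' m'' k₁ k₂} (hb : b.holds m) (h₁ : Exec c m m' k₁)
      (h₂ : Exec (.while b c) m' m'' k₂) :
      Exec (.while b c) m m'' (1 + b.cost + k₁ + k₂)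
  | while_false {b c m} (hb : ¬ b.holds m) : Exec (.while b c) m m (1 + b.cost)

/-- The machine is deterministic. -/
theorem Exec.deterministic {c : Cmd} {m m₁ : Memory} {k₁ : ℕ} (h : Exec c m m₁ k₁) :
    ∀ {m₂ : Memory} {k₂ : ℕ}, Exec c m m₂ k₂ → m₁ = m₂ ∧ k₁ = k₂ := by
  induction h with
  | skip | assign | store | clear | append | remove | next =>
    intro m₂ k₂ h'; cases h'; exact ⟨rfl, rfl⟩
  | seq _ _ ih₁ ih₂ =>
    intro m₂ k₂ h'
    cases h' with
    | seq g₁ g₂ =>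
      obtain ⟨rfl, rfl⟩ := ih₁ g₁
      obtain ⟨rfl, rfl⟩ := ih₂ g₂
      exact ⟨rfl, rfl⟩
  | ite_true hb _ ih =>
    intro m₂ k₂ h'
    cases h' with
    | ite_true _ g => obtain ⟨rfl, rfl⟩ := ih g; exact ⟨rfl, rfl⟩
    | ite_false hn _ => exact absurd hb hn
  | ite_false hb _ ih =>
    intro m₂ k₂ h'
    cases h' with
    | ite_true hp _ => exact absurd hp hb
    | ite_false _ g => obtain ⟨rfl, rfl⟩ := ih g; exact ⟨rfl, rfl⟩
  | while_true hb _ _ ih₁ ih₂ =>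
    intro m₂ k₂ h'
    cases h' with
    | while_true _ g₁ g₂ =>
      obtain ⟨rfl, rfl⟩ := ih₁ g₁
      obtain ⟨rfl, rfl⟩ := ih₂ g₂
      exact ⟨rfl, rfl⟩
    | while_false hn => exact absurd hb hn
  | while_false hb =>
    intro m₂ k₂ h'
    cases h' with
    | while_true hp _ _ => exact absurd hp hb
    | while_false => exact ⟨rfl, rfl⟩

/-! ## The program -/

namespace Cmd

/-- Sequential composition of a list of commands. -/
def block : List Cmd → Cmd
  | [] => skip
  | c :: cs => seq c (block cs)

/-- One-armed conditional. -/
def when (b : Test) (cs : List Cmd) : Cmd := ite b (block cs) skip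

/-- `scan x in L i { body }`; the successor of `x` is looked up after the body has been
executed. -/
def scan (x : Reg) (L : Lst) (i : Exp) (body : List Cmd) : Cmd :=
  block [
    assign x (.first L i),
    .while (.ne (.reg x) (.num 0)) (block [
      block body,
      next x L i (.reg x)])]

/-- Discovery of the state `x` from the state `p` in the depth-first search. -/
def visit (x : Reg) (p : Exp) : Cmd :=
  block [
    assign .time (.add (.reg .time) (.num 1)),
    store .index (.reg x) (.reg .time),
    store .low (.reg x) (.reg .time),
    store .parent (.reg x) p,
    store .iter (.reg x) (.first .pre (.reg x)),
    append .stack (.num 0) (.reg x)]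

/-- Pops the strongly connected component with root `v` from the stack. -/
def popScc : Cmd :=
  block [
    assign .numScc (.add (.reg .numScc) (.num 1)),
    append .sccs (.num 0) (.reg .numScc),
    assign .w (.num 0),
    .while (.ne (.reg .w) (.reg .v)) (block [
      assign .w (.last .stack (.num 0)),
      remove .stack (.num 0) (.reg .w),
      store .scc (.reg .w) (.reg .numScc),
      append .sccStates (.reg .numScc) (.reg .w)])]

/-- One step of the depth-first search at the state `v`: either the next edge at `v` is
explored, or `v` is finished and the search returns to its parent. -/
def dfsStep : Cmd :=
  block [
    assign .w (.arr .iter (.reg .v)),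
    ite (.ne (.reg .w) (.num 0))
      (block [
        next .u .pre (.reg .v) (.reg .w),
        store .iter (.reg .v) (.reg .u),
        ite (.eq (.arr .index (.reg .w)) (.num 0))
          (block [
            visit .w (.reg .v),
            assign .v (.reg .w)])
          (when (.eq (.arr .scc (.reg .w)) (.num 0)) [
            when (.lt (.arr .index (.reg .w)) (.arr .low (.reg .v))) [
              store .low (.reg .v) (.arr .index (.reg .w))]])])
      (block [
        when (.eq (.arr .low (.reg .v)) (.arr .index (.reg .v))) [popScc],
        assign .u (.arr .parent (.reg .v)),
        when (.ne (.reg .u) (.num 0)) [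
          when (.lt (.arr .low (.reg .v)) (.arr .low (.reg .u))) [
            store .low (.reg .u) (.arr .low (.reg .v))]],
        assign .v (.reg .u)])]

/-- Tarjan's algorithm, run on the lists of predecessors (a graph and its reverse have the same
strongly connected components), with the recursion stack kept in the array `parent`. -/
def tarjan : Cmd :=
  scan .root .states (.num 0) [
    when (.eq (.arr .index (.reg .root)) (.num 0)) [
      visit .root (.num 0),
      assign .v (.reg .root),
      .while (.ne (.reg .v) (.num 0)) dfsStep]]

/-- The lists of predecessors in the acyclic graph of strongly connected components. -/
def buildDag : Cmd :=
  scan .c .sccs (.num 0) [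
    scan .s .sccStates (.reg .c) [
      scan .p .pre (.reg .s) [
        assign .d (.arr .scc (.reg .p)),
        when (.ne (.reg .d) (.reg .c)) [
          when (.ne (.arr .edgeMark (.reg .d)) (.reg .c)) [
            store .edgeMark (.reg .d) (.reg .c),
            append .sccPre (.reg .c) (.reg .d)]]]]]

/-- `(P_scc, →_scc) := scc(Σ, →)`. -/
def computeScc : Cmd := block [tarjan, buildDag]

/-- `B_scc := {C ∈ P_scc | B ∩ C ≠ ∅}`. -/
def computeBscc : Cmd :=
  block [
    clear .bscc (.num 0),
    scan .s .members (.reg .B) [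
      assign .c (.arr .scc (.reg .s)),
      when (.ne (.arr .inBscc (.reg .c)) (.reg .stamp)) [
        store .inBscc (.reg .c) (.reg .stamp),
        append .bscc (.num 0) (.reg .c)]]]

/-- `result := computeEF(B_scc)` in the graph of components. A component is marked when its
mark equals the current value of `stamp`. -/
def computeEF : Cmd :=
  block [
    clear .result (.num 0),
    scan .c .bscc (.num 0) [
      append .result (.num 0) (.reg .c),
      store .mark (.reg .c) (.reg .stamp)],
    scan .c .result (.num 0) [
      scan .d .sccPre (.reg .c) [
        when (.ne (.arr .mark (.reg .d)) (.reg .stamp)) [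
          append .result (.num 0) (.reg .d),
          store .mark (.reg .d) (.reg .stamp)]]]]

/-- `S := ⋃ result`. -/
def unionEF : Cmd :=
  block [
    clear .ef (.num 0),
    scan .c .result (.num 0) [
      scan .s .sccStates (.reg .c) [
        append .ef (.num 0) (.reg .s)]]]

/-- `moveFromTo(x, from, to)`. -/
def moveFromTo (x src dst : Reg) : Cmd :=
  block [
    remove .members (.reg src) (.reg x),
    append .members (.reg dst) (.reg x),
    store .block (.reg x) (.reg dst)]

/-- `split(S, P)`. The register `D` holds the block of the current state and `N` the block
`D ∩ S`. The final scan, which moves the blocks that were split to the end of `P`, also resets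
the two flags of each block. -/
def splitBlocks : Cmd :=
  block [
    scan .s .ef (.num 0) [
      assign .D (.arr .block (.reg .s)),
      when (.eq (.arr .inter (.reg .D)) (.num 0)) [
        assign .numBlk (.add (.reg .numBlk) (.num 1)),
        store .inter (.reg .D) (.reg .numBlk),
        store .split (.reg .D) (.num 1),
        append .blocks (.num 0) (.reg .numBlk)],
      assign .N (.arr .inter (.reg .D)),
      moveFromTo .s .D .N,
      when (.eq (.first .members (.reg .D)) (.num 0)) [
        store .split (.reg .D) (.num 0),
        .while (.ne (.first .members (.reg .N)) (.num 0)) (block [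
          assign .t (.first .members (.reg .N)),
          moveFromTo .t .N .D]),
        remove .blocks (.num 0) (.reg .N)]],
    assign .D (.first .blocks (.num 0)),
    .while (.ne (.reg .D) (.num 0)) (block [
      next .t .blocks (.num 0) (.reg .D),
      store .inter (.reg .D) (.num 0),
      when (.eq (.arr .split (.reg .D)) (.num 1)) [
        store .split (.reg .D) (.num 0),
        remove .blocks (.num 0) (.reg .D),
        append .blocks (.num 0) (.reg .D)],
      assign .D (.reg .t)])]

/-- The whole algorithm. Increasing `stamp` removes all marks. -/
def igptEF : Cmd :=
  block [
    computeScc,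
    scan .B .blocks (.num 0) [
      assign .stamp (.add (.reg .stamp) (.num 1)),
      computeBscc,
      computeEF,
      unionEF,
      splitBlocks]]

end Cmd

/-! ## Input and output -/

/-- A presentation of a finite Kripke structure as an input: a numbering of the states, for each
state a list of its predecessors, and a list of the blocks of `P_ℓ`, each of them given as a
list of its states. All these lists are in an arbitrary order, without repetitions. -/
structure Input {S : Type*} [Fintype S] {AP : Type*} (K : Kripke S AP) where
  num : S ≃ Fin (Fintype.card S)
  pre : S → List S
  pre_nodup : ∀ s, (pre s).Nodup
  mem_pre : ∀ r s, r ∈ pre s ↔ K.Trans r s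
  blocks : List (List S)
  members_nodup : ∀ B ∈ blocks, B.Nodup
  blocks_nodup : (blocks.map fun B => {s | s ∈ B}).Nodup
  mem_blocks : {X | X ∈ blocks.map fun B => {s | s ∈ B}} = K.labelPartition

namespace Input

variable {S : Type*} [Fintype S] {AP : Type*} {K : Kripke S AP} (I : Input K)

/-- The states are numbered from `1`. -/
def code (s : S) : ℕ := (I.num s : ℕ) + 1

/-- The state with a given number, if there is one. -/
def decode : ℕ → Option S
  | 0 => none
  | x + 1 => if h : x < Fintype.card S then some (I.num.symm ⟨x, h⟩) else none

open Classical in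
/-- The memory in which the program is started: it holds the list of states, the lists of
predecessors, the list of blocks `1, …, k`, the list of states of each block, the block of each
state, and the number `k` of blocks; everything else is `0` or empty. -/
noncomputable def initial : Memory where
  reg
    | .numBlk => I.blocks.length
    | _ => 0
  arr
    | .block, x =>
      match I.decode x with
      | some s => I.blocks.findIdx (fun B => decide (s ∈ B)) + 1
      | none => 0
    | _, _ => 0
  lst
    | .states, 0 => List.range' 1 (Fintype.card S)
    | .pre, x =>
      match I.decode x with
      | some s => (I.pre s).map I.code
      | none => []
    | .blocks, 0 => List.range' 1 I.blocks.length
    | .members, i + 1 => (I.blocks.getD i []).map I.code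
    | _, _ => []

/-- The list of blocks that a memory holds. -/
def output (m : Memory) : List (Set S) :=
  (m.lst .blocks 0).map fun B => {s | I.code s ∈ m.lst .members B}

end Input

end ReachPart

/-! Semantics. Let a partition be coarser than logical equivalence, and let `B` be one of its
blocks. Splitting by EF(B) does not separate logically equivalent states. Indeed, on a finite set of
states a class of logical equivalence is either everything or is defined by a formula, namely a
finite conjunction of formulae that exclude the other states one by one; and `B` is a union of such
classes (`Kripke.mem_EF_of_logic`). So every partition met in a run started at `P_ℓ` lies between
the logical partition and `P_ℓ`. If no refiner is left, induction on formulae shows that the states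
of one block satisfy the same formulae. The run therefore ends in the logical partition itself, and
this one is coarsest by the definition of strong preservation
(`Kripke.IGPTRun.isCoarsestStronglyPreserving`).

Why a single scan is enough. A round with the current block `B` is a step of the algorithm, or
changes nothing if `B` is not a refiner (`Kripke.step_or_eq`). Since `B ⊆ EF(B)`, the block `B` is
not split by its own round, and this round makes it stable: states of one block agree on whether
they lead to `B`. A block that stays intact remains stable under later rounds, because its EF is the
same and the partition only gets finer. All blocks that are created or properly split are placed
behind the current one. Hence the blocks passed by the scan are always stable, and at the end no
refiner exists (`wp_igptEF`).

Why the time is `O(|Σ||→|)`. The length of the rest of the scan plus `2 (|Σ| - number of blocks)`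
drops by at least one in each round, so there are at most `2|Σ|` rounds. A round is linear in `|Σ| +
|→|`: the search meets each component once, marks are invalidated by a counter instead of being
erased, and the cost of restoring an emptied block is charged to the moves that emptied it
(`wp_splitStep`). Totality gives `|Σ| ≤ |→|`.

Method. `Wp` is a weakest precondition that also sees the number of steps; the loop rules `wp_while`
and `wp_scan` carry a budget, which gives termination and the time bound together. Tarjan's search
is verified through the abstract invariant `TarjanInv`, kept by five moves (`push`, `advance`,
`lower`, `drop`, `pop`) that do not mention the program. -/

namespace ReachPart

/-! ## Reading a memory after an update -/

namespace Memory

variable (m : Memory)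

@[simp] theorem setReg_reg (r : Reg) (x : ℕ) (r' : Reg) :
    (m.setReg r x).reg r' = if r' = r then x else m.reg r' := by
  simp [setReg, Function.update_apply]

@[simp] theorem setReg_arr (r : Reg) (x : ℕ) : (m.setReg r x).arr = m.arr := rfl

@[simp] theorem setReg_lst (r : Reg) (x : ℕ) : (m.setReg r x).lst = m.lst := rfl

@[simp] theorem setArr_reg (a : Arr) (i x : ℕ) : (m.setArr a i x).reg = m.reg := rfl

@[simp] theorem setArr_arr (a : Arr) (i x : ℕ) (a' : Arr) :
    (m.setArr a i x).arr a' = if a' = a then Function.update (m.arr a) i x else m.arr a' := by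
  simp [setArr, Function.update_apply]

@[simp] theorem setArr_lst (a : Arr) (i x : ℕ) : (m.setArr a i x).lst = m.lst := rfl

@[simp] theorem setLst_reg (L : Lst) (i : ℕ) (l : List ℕ) : (m.setLst L i l).reg = m.reg := rfl

@[simp] theorem setLst_arr (L : Lst) (i : ℕ) (l : List ℕ) : (m.setLst L i l).arr = m.arr := rfl

@[simp] theorem setLst_lst (L : Lst) (i : ℕ) (l : List ℕ) (L' : Lst) :
    (m.setLst L i l).lst L' = if L' = L then Function.update (m.lst L) i l else m.lst L' := by
  simp [setLst, Function.update_apply]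

/-- Every list is without repetitions and does not hold the null pointer. -/
def WF : Prop := ∀ L i, (m.lst L i).Nodup ∧ 0 ∉ m.lst L i

end Memory

/-! ## The parts of the memory that a command may modify -/

namespace Cmd

/-- Computed from the syntax, so that for a concrete command the statement that a register, an array
or a family of lists is untouched is proved by `rfl`. This is an over-approximation: a family counts
as modified as soon as a command addresses one of its members. -/
def modReg : Cmd → Reg → Bool
  | assign r _, r' => decide (r' = r)
  | next r _ _ _, r' => decide (r' = r)
  | seq c d, r' => modReg c r' || modReg d r'
  | ite _ c d, r' => modReg c r' || modReg d r'
  | .while _ c, r' => modReg c r'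
  | _, _ => false

def modArr : Cmd → Arr → Bool
  | store a _ _, a' => decide (a' = a)
  | seq c d, a' => modArr c a' || modArr d a'
  | ite _ c d, a' => modArr c a' || modArr d a'
  | .while _ c, a' => modArr c a'
  | _, _ => false

def modLst : Cmd → Lst → Bool
  | clear L _, L' => decide (L' = L)
  | append L _ _, L' => decide (L' = L)
  | remove L _ _, L' => decide (L' = L)
  | seq c d, L' => modLst c L' || modLst d L'
  | ite _ c d, L' => modLst c L' || modLst d L'
  | .while _ c, L' => modLst c L'
  | _, _ => false

end Cmd

/-- `m'` agrees with `m` on everything that `c` cannot modify. -/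
structure Frame (c : Cmd) (m m' : Memory) : Prop where
  reg : ∀ r, c.modReg r = false → m'.reg r = m.reg r
  arr : ∀ a, c.modArr a = false → m'.arr a = m.arr a
  lst : ∀ L, c.modLst L = false → m'.lst L = m.lst L
  wf : m.WF → m'.WF

theorem Frame.refl (c : Cmd) (m : Memory) : Frame c m m :=
  ⟨fun _ _ => rfl, fun _ _ => rfl, fun _ _ => rfl, id⟩

theorem Frame.trans {c : Cmd} {m m' m'' : Memory} (h : Frame c m m') (h' : Frame c m' m'') :
    Frame c m m'' :=
  ⟨fun r hr => (h'.reg r hr).trans (h.reg r hr), fun r hr => (h'.arr r hr).trans (h.arr r hr),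
    fun r hr => (h'.lst r hr).trans (h.lst r hr), fun w => h'.wf (h.wf w)⟩

theorem Frame.mono {c d : Cmd} {m m' : Memory} (h : Frame c m m')
    (hr : ∀ r, d.modReg r = false → c.modReg r = false)
    (ha : ∀ r, d.modArr r = false → c.modArr r = false)
    (hl : ∀ r, d.modLst r = false → c.modLst r = false) : Frame d m m' :=
  ⟨fun r k => h.reg r (hr r k), fun r k => h.arr r (ha r k), fun r k => h.lst r (hl r k), h.wf⟩

theorem Memory.WF.setLst {m : Memory} (h : m.WF) (L : Lst) (i : ℕ) {l : List ℕ} (hl : l.Nodup)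
    (h0 : 0 ∉ l) : (m.setLst L i l).WF := by
  intro L' j
  simp only [Memory.setLst_lst]
  split_ifs with e
  · subst e
    by_cases hj : j = i
    · subst hj; simpa using ⟨hl, h0⟩
    · simpa [Function.update_apply, hj] using h L' j
  · exact h L' j

/-- `append` is stuck on `0` and on repetitions, and `clear` and `remove` only shrink a list. So
every execution preserves well-formedness, which then need not be part of any loop invariant. -/
theorem Exec.frame {c : Cmd} {m m' : Memory} {k : ℕ} (h : Exec c m m' k) : Frame c m m' := by
  induction h with
  | skip m => exact Frame.refl _ _
  | assign m r e =>
    refine ⟨fun r' h => ?_, fun _ _ => rfl, fun _ _ => rfl, fun h => h⟩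
    simp only [Cmd.modReg, decide_eq_false_iff_not] at h
    simp [h]
  | store m a i e =>
    refine ⟨fun _ _ => rfl, fun a' h => ?_, fun _ _ => rfl, fun h => h⟩
    simp only [Cmd.modArr, decide_eq_false_iff_not] at h
    simp [h]
  | clear m L i =>
    refine ⟨fun _ _ => rfl, fun _ _ => rfl, fun a' h => ?_, fun h => h.setLst _ _ (by simp) (by simp)⟩
    simp only [Cmd.modLst, decide_eq_false_iff_not] at h
    simp [h]
  | append m L i x h0 hx =>
    refine ⟨fun _ _ => rfl, fun _ _ => rfl, fun a' h => ?_, fun h => h.setLst _ _ ?_ ?_⟩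
    · simp only [Cmd.modLst, decide_eq_false_iff_not] at h
      simp [h]
    · have := (h L (i.eval m)).1
      simp only [List.nodup_append, List.nodup_cons, List.not_mem_nil, not_false_eq_true,
        List.nodup_nil, and_true, this, List.mem_singleton, true_and]
      rintro a ha b rfl rfl
      exact hx ha
    · simpa using ⟨(h L (i.eval m)).2, Ne.symm h0⟩
  | remove m L i x hx =>
    refine ⟨fun _ _ => rfl, fun _ _ => rfl, fun a' h => ?_, fun h => h.setLst _ _ ?_ ?_⟩
    · simp only [Cmd.modLst, decide_eq_false_iff_not] at h
      simp [h]
    · exact (h L (i.eval m)).1.erase _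
    · exact fun h' => (h L (i.eval m)).2 (List.mem_of_mem_erase h')
  | next m r L i x hx =>
    refine ⟨fun r' h => ?_, fun _ _ => rfl, fun _ _ => rfl, fun h => h⟩
    simp only [Cmd.modReg, decide_eq_false_iff_not] at h
    simp [h]
  | seq _ _ ih₁ ih₂ =>
    exact (ih₁.mono (by simp +contextual [Cmd.modReg]) (by simp +contextual [Cmd.modArr])
      (by simp +contextual [Cmd.modLst])).trans (ih₂.mono (by simp +contextual [Cmd.modReg])
      (by simp +contextual [Cmd.modArr]) (by simp +contextual [Cmd.modLst]))
  | ite_true _ _ ih =>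
    exact ih.mono (by simp +contextual [Cmd.modReg]) (by simp +contextual [Cmd.modArr])
      (by simp +contextual [Cmd.modLst])
  | ite_false _ _ ih =>
    exact ih.mono (by simp +contextual [Cmd.modReg]) (by simp +contextual [Cmd.modArr])
      (by simp +contextual [Cmd.modLst])
  | while_true _ _ _ ih₁ ih₂ =>
    exact (ih₁.mono (by simp +contextual [Cmd.modReg]) (by simp +contextual [Cmd.modArr])
      (by simp +contextual [Cmd.modLst])).trans ih₂
  | while_false _ => exact Frame.refl _ _

/-! ## Weakest preconditions with running times -/

/-- The command `c`, started in `m`, halts in a memory and after a number of steps that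
satisfy `Q`. -/
def Wp (c : Cmd) (m : Memory) (Q : Memory → ℕ → Prop) : Prop :=
  ∃ m' k, Exec c m m' k ∧ Q m' k

section Wp

variable {m : Memory} {Q : Memory → ℕ → Prop}

/-- The continuation also receives the frame condition. A specification can thus be limited to what
a command changes, and everything else is recovered afterwards from `Frame`. -/
theorem Wp.mono {c : Cmd} {Q' : Memory → ℕ → Prop} (h : Wp c m Q)
    (H : ∀ m' k, Frame c m m' → Q m' k → Q' m' k) : Wp c m Q' := by
  obtain ⟨m', k, e, q⟩ := h
  exact ⟨m', k, e, H m' k e.frame q⟩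

theorem wp_skip : Wp .skip m Q ↔ Q m 1 :=
  ⟨fun ⟨_, _, e, q⟩ => by cases e; exact q, fun q => ⟨_, _, .skip m, q⟩⟩

theorem wp_assign {r : Reg} {e : Exp} :
    Wp (.assign r e) m Q ↔ Q (m.setReg r (e.eval m)) (1 + e.cost) :=
  ⟨fun ⟨_, _, e, q⟩ => by cases e; exact q, fun q => ⟨_, _, .assign .., q⟩⟩

theorem wp_store {a : Arr} {i e : Exp} :
    Wp (.store a i e) m Q ↔ Q (m.setArr a (i.eval m) (e.eval m)) (1 + i.cost + e.cost) :=
  ⟨fun ⟨_, _, e, q⟩ => by cases e; exact q, fun q => ⟨_, _, .store .., q⟩⟩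

theorem wp_clear {L : Lst} {i : Exp} :
    Wp (.clear L i) m Q ↔ Q (m.setLst L (i.eval m) []) (1 + i.cost) :=
  ⟨fun ⟨_, _, e, q⟩ => by cases e; exact q, fun q => ⟨_, _, .clear .., q⟩⟩

theorem wp_append {L : Lst} {i x : Exp} :
    Wp (.append L i x) m Q ↔ x.eval m ≠ 0 ∧ x.eval m ∉ m.lst L (i.eval m) ∧
      Q (m.setLst L (i.eval m) (m.lst L (i.eval m) ++ [x.eval m])) (1 + i.cost + x.cost) :=
  ⟨fun ⟨_, _, e, q⟩ => by cases e with | append _ _ _ _ h0 hx => exact ⟨h0, hx, q⟩,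
    fun ⟨h0, hx, q⟩ => ⟨_, _, .append _ _ _ _ h0 hx, q⟩⟩

theorem wp_remove {L : Lst} {i x : Exp} :
    Wp (.remove L i x) m Q ↔ x.eval m ∈ m.lst L (i.eval m) ∧
      Q (m.setLst L (i.eval m) ((m.lst L (i.eval m)).erase (x.eval m))) (1 + i.cost + x.cost) :=
  ⟨fun ⟨_, _, e, q⟩ => by cases e with | remove _ _ _ _ hx => exact ⟨hx, q⟩,
    fun ⟨hx, q⟩ => ⟨_, _, .remove _ _ _ _ hx, q⟩⟩

theorem wp_next {r : Reg} {L : Lst} {i x : Exp} :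
    Wp (.next r L i x) m Q ↔ x.eval m ∈ m.lst L (i.eval m) ∧
      Q (m.setReg r (nextIn (x.eval m) (m.lst L (i.eval m)))) (1 + i.cost + x.cost) :=
  ⟨fun ⟨_, _, e, q⟩ => by cases e with | next _ _ _ _ _ hx => exact ⟨hx, q⟩,
    fun ⟨hx, q⟩ => ⟨_, _, .next _ _ _ _ _ hx, q⟩⟩

theorem wp_seq {c d : Cmd} :
    Wp (.seq c d) m Q ↔ Wp c m fun m' k => Wp d m' fun m'' k' => Q m'' (k + k') := by
  constructor
  · rintro ⟨_, _, e, q⟩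
    cases e with
    | seq h₁ h₂ => exact ⟨_, _, h₁, _, _, h₂, q⟩
  · rintro ⟨_, _, h₁, _, _, h₂, q⟩
    exact ⟨_, _, .seq h₁ h₂, q⟩

theorem wp_ite {b : Test} {c d : Cmd} :
    Wp (.ite b c d) m Q ↔ (b.holds m → Wp c m fun m' k => Q m' (1 + b.cost + k)) ∧
      (¬ b.holds m → Wp d m fun m' k => Q m' (1 + b.cost + k)) := by
  constructor
  · rintro ⟨_, _, e, q⟩
    cases e with
    | ite_true hb h => exact ⟨fun _ => ⟨_, _, h, q⟩, fun h => absurd hb h⟩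
    | ite_false hb h => exact ⟨fun h => absurd h hb, fun _ => ⟨_, _, h, q⟩⟩
  · rintro ⟨h₁, h₂⟩
    by_cases hb : b.holds m
    · obtain ⟨m', k, h, q⟩ := h₁ hb
      exact ⟨_, _, .ite_true hb h, q⟩
    · obtain ⟨m', k, h, q⟩ := h₂ hb
      exact ⟨_, _, .ite_false hb h, q⟩

theorem wp_block_nil : Wp (Cmd.block []) m Q ↔ Q m 1 := wp_skip

theorem wp_block_cons {c : Cmd} {cs : List Cmd} :
    Wp (Cmd.block (c :: cs)) m Q ↔
      Wp c m fun m' k => Wp (Cmd.block cs) m' fun m'' k' => Q m'' (k + k') := wp_seq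

theorem wp_when {b : Test} {cs : List Cmd} :
    Wp (Cmd.when b cs) m Q ↔ (b.holds m → Wp (Cmd.block cs) m fun m' k => Q m' (1 + b.cost + k)) ∧
      (¬ b.holds m → Q m (1 + b.cost + 1)) := by
  rw [Cmd.when, wp_ite, wp_skip]

/-- The rule for loops. The invariant `I n` holds when `n` further steps have been budgeted. -/
theorem wp_while {b : Test} {c : Cmd} (I : ℕ → Memory → Prop) {n : ℕ} (h0 : I n m)
    (step : ∀ n m₁, Frame (.while b c) m m₁ → I n m₁ → b.holds m₁ →
      Wp c m₁ fun m₂ k => ∃ n', n' + k + (1 + b.cost) ≤ n ∧ I n' m₂)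
    (post : ∀ n' m' k, Frame (.while b c) m m' → k + n' ≤ n + (1 + b.cost) → I n' m' →
      ¬ b.holds m' → Q m' k) :
    Wp (.while b c) m Q := by
  -- A test costs at least one step, so each round lowers the budget strictly and strong induction
  -- on `n` proves termination. The extra `1 + b.cost` pays for the last test, which fails.
  suffices H : ∀ n m₁, Frame (.while b c) m m₁ → I n m₁ → Wp (.while b c) m₁ fun m' k =>
      ∃ n', k + n' ≤ n + (1 + b.cost) ∧ I n' m' ∧ ¬ b.holds m' from by
    obtain ⟨m', k, e, n', hk, hI, hb⟩ := H n m (Frame.refl _ _) h0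
    exact ⟨m', k, e, post n' m' k e.frame hk hI hb⟩
  intro n
  induction n using Nat.strong_induction_on with
  | _ n ih =>
    intro m₁ hf hI
    by_cases hb : b.holds m₁
    · obtain ⟨m₂, k₁, e₁, n', hn, hI'⟩ := step n m₁ hf hI hb
      have hf' : Frame (.while b c) m m₂ := hf.trans (e₁.frame.mono (by simp [Cmd.modReg])
        (by simp [Cmd.modArr]) (by simp [Cmd.modLst]))
      obtain ⟨m₃, k₂, e₂, n'', hn', hI'', hb'⟩ := ih n' (by omega) m₂ hf' hI'
      exact ⟨m₃, _, .while_true hb e₁ e₂, n'', by omega, hI'', hb'⟩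
    · exact ⟨m₁, _, .while_false hb, n, by omega, hI, hb⟩

theorem nextIn_append_cons {a : ℕ} {l r : List ℕ} (h : a ∉ l) :
    nextIn a (l ++ a :: r) = r.headD 0 := by
  induction l with
  | nil => simp [nextIn]
  | cons b l ih =>
    simp only [List.mem_cons, not_or] at h
    simp [nextIn, Ne.symm h.1, ih h.2]

theorem headD_ne_zero {l : List ℕ} (h : 0 ∉ l) : l.headD 0 ≠ 0 ↔ l ≠ [] := by
  cases l with
  | nil => simp
  | cons a l =>
    simp only [List.mem_cons, not_or] at h
    simpa using Ne.symm h.1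

/-- The rule for scans of a list that may change during the scan. The list is divided into
the part before the current element and the part that begins with it. -/
theorem wp_scan {x : Reg} {L : Lst} {i : Exp} {body : List Cmd}
    (J : ℕ → Memory → List ℕ → List ℕ → Prop) (j n : ℕ)
    (hw : m.WF)
    (hi : ∀ m', Frame (Cmd.scan x L i body) m m' → i.eval m' = j)
    (hx : (Cmd.block body).modReg x = false)
    (h0 : J n (m.setReg x ((m.lst L j).headD 0)) [] (m.lst L j))
    (step : ∀ n m₁ dn a rest, Frame (Cmd.scan x L i body) m m₁ → m₁.WF →
      m₁.lst L j = dn ++ a :: rest → m₁.reg x = a → J n m₁ dn (a :: rest) →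
      Wp (Cmd.block body) m₁ fun m₂ k => ∃ n' dn' rest', m₂.lst L j = dn' ++ a :: rest' ∧
        n' + k + (7 + i.cost) ≤ n ∧ J n' (m₂.setReg x (rest'.headD 0)) (dn' ++ [a]) rest')
    (post : ∀ n' m' k, Frame (Cmd.scan x L i body) m m' → m'.WF → k + n' ≤ n + (7 + i.cost) →
      J n' m' (m'.lst L j) [] → Q m' k) :
    Wp (Cmd.scan x L i body) m Q := by
  have hfr : ∀ {m'}, Frame (.while (.ne (.reg x) (.num 0)) (Cmd.block [
      Cmd.block body, Cmd.next x L i (.reg x)])) (m.setReg x ((m.lst L j).headD 0)) m' →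
      Frame (Cmd.scan x L i body) m m' := by
    intro m' h
    have h1 : Frame (Cmd.scan x L i body) m (m.setReg x ((m.lst L j).headD 0)) := by
      refine ⟨fun r hr => ?_, fun _ _ => rfl, fun _ _ => rfl, fun h => h⟩
      have : r ≠ x := by
        rintro rfl; simp [Cmd.scan, Cmd.block, Cmd.modReg] at hr
      simp [this]
    refine h1.trans (h.mono ?_ ?_ ?_)
    · simp +contextual [Cmd.scan, Cmd.block, Cmd.modReg]
    · simp +contextual [Cmd.scan, Cmd.block, Cmd.modArr]
    · simp +contextual [Cmd.scan, Cmd.block, Cmd.modLst]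
  have him : i.eval m = j := hi m (Frame.refl _ _)
  unfold Cmd.scan
  rw [wp_block_cons, wp_assign]
  simp only [wp_block_cons, wp_block_nil, Exp.eval, him]
  -- The constant `7 + i.cost` occurs twice. A round costs, besides the body, 4 for the test, `2 +
  -- i.cost` for `next` and 1 for the closing `skip`. The whole scan costs in addition `2 + i.cost`
  -- for the first assignment, 4 for the failing test and 1 for `skip`.
  refine wp_while (fun n m₁ => ∃ dn rest, m₁.lst L j = dn ++ rest ∧ m₁.reg x = rest.headD 0 ∧
    J n m₁ dn rest) (n := n) ⟨[], m.lst L j, rfl, by simp, h0⟩ ?_ ?_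
  · rintro n m₁ hf ⟨dn, rest, hl, hxr, hJ⟩ hb
    have hF := hfr hf
    have w₁ : m₁.WF := hF.wf hw
    have h0r : 0 ∉ rest := fun h => (w₁ L j).2 (by rw [hl]; simp [h])
    simp only [Test.holds, Exp.eval, hxr] at hb
    obtain ⟨a, rest, rfl⟩ := List.exists_cons_of_ne_nil ((headD_ne_zero h0r).1 hb)
    rw [wp_block_cons]
    refine (step n m₁ dn a rest hF w₁ hl (by simpa using hxr) hJ).mono ?_
    rintro m₂ k hf₂ ⟨n', dn', rest', hl', hn, hJ'⟩
    have hxa : m₂.reg x = a := by rw [hf₂.reg x hx, hxr]; rfl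
    have w₂ : m₂.WF := hf₂.wf w₁
    have hF₂ : Frame (Cmd.scan x L i body) m m₂ := hF.trans <| hf₂.mono
      (by simp +contextual [Cmd.scan, Cmd.block, Cmd.modReg])
      (by simp +contextual [Cmd.scan, Cmd.block, Cmd.modArr])
      (by simp +contextual [Cmd.scan, Cmd.block, Cmd.modLst])
    -- `nextIn` looks for the first occurrence of `a`, so the successor is the head of `rest'` only
    -- if `a` does not occur earlier.
    have hnd : a ∉ dn' := by
      have := (w₂ L j).1
      rw [hl', List.nodup_append] at this
      exact fun h => this.2.2 a h a (by simp) rfl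
    rw [wp_block_cons, wp_next, wp_block_nil]
    simp only [Exp.eval, hi m₂ hF₂, hxa, hl', nextIn_append_cons hnd, Exp.cost, Test.cost]
    exact ⟨by simp, n', by omega, dn' ++ [a], rest', by simp [hl'], by simp, hJ'⟩
  · rintro n' m' k hf hk ⟨dn, rest, hl, hxr, hJ⟩ hb
    have hF := hfr hf
    have w₁ : m'.WF := hF.wf hw
    have h0r : 0 ∉ rest := fun h => (w₁ L j).2 (by rw [hl]; simp [h])
    simp only [Test.holds, Exp.eval, hxr, (headD_ne_zero h0r), not_not] at hb
    subst hb
    simp only [Test.cost, Exp.cost] at hk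
    refine post n' m' _ hF w₁ ?_ (by simpa [hl] using hJ)
    simp only [Exp.cost]
    omega

/-- The rule for scans of a list that does not change during the scan. -/
theorem wp_scan_static {x : Reg} {L : Lst} {i : Exp} {body : List Cmd}
    (J : Memory → List ℕ → Prop) (f : ℕ → ℕ) (j : ℕ)
    (hw : m.WF)
    (hi : ∀ m', Frame (Cmd.scan x L i body) m m' → i.eval m' = j)
    (hx : (Cmd.block body).modReg x = false)
    (hL : (Cmd.block body).modLst L = false)
    (hJ : ∀ m' y dn, J m' dn → J (m'.setReg x y) dn)
    (h0 : J m [])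
    (step : ∀ m₁ dn a rest, Frame (Cmd.scan x L i body) m m₁ → m₁.WF →
      m.lst L j = dn ++ a :: rest → m₁.reg x = a → J m₁ dn →
      Wp (Cmd.block body) m₁ fun m₂ k => k ≤ f a ∧ J m₂ (dn ++ [a]))
    (post : ∀ m' k, Frame (Cmd.scan x L i body) m m' → m'.WF →
      k ≤ 7 + i.cost + ((m.lst L j).map fun a => f a + (7 + i.cost)).sum →
      J m' (m.lst L j) → Q m' k) :
    Wp (Cmd.scan x L i body) m Q := by
  have hsc : (Cmd.scan x L i body).modLst L = false := by
    simpa [Cmd.scan, Cmd.block, Cmd.modLst] using hL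
  refine wp_scan (fun n m₁ dn rest => n = (rest.map fun a => f a + (7 + i.cost)).sum ∧ J m₁ dn) j
    _ hw hi hx ⟨rfl, hJ _ _ _ h0⟩ ?_ ?_
  · rintro n m₁ dn a rest hf w₁ hl hxa ⟨hn, hJ₁⟩
    have hl' := hf.lst L hsc
    refine (step m₁ dn a rest hf w₁ (by rw [← hl', hl]) hxa hJ₁).mono ?_
    rintro m₂ k hf₂ ⟨hk, hJ₂⟩
    refine ⟨_, dn, rest, by rw [hf₂.lst L hL, hl], ?_, rfl, hJ _ _ _ hJ₂⟩
    simp only [hn, List.map_cons, List.sum_cons]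
    omega
  · rintro n' m' k hf w' hk ⟨hn, hJ₁⟩
    have hl' := hf.lst L hsc
    rw [hl'] at hJ₁
    refine post m' k hf w' ?_ hJ₁
    omega

end Wp

end ReachPart

namespace ReachPart

/-! ## The depth-first search of Tarjan: invariant and abstract steps -/

/-- The part of a list before the element `i`. -/
def seen (l : List ℕ) (i : ℕ) : List ℕ := l.takeWhile (· ≠ i)

/-- An iterator with value `0` has run off the end of its list, so everything has been seen. -/
theorem seen_zero {l : List ℕ} (h : 0 ∉ l) : seen l 0 = l := by
  rw [seen, List.takeWhile_eq_self_iff]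
  intro x hx
  simp only [decide_eq_true_eq]
  rintro rfl
  exact h hx

theorem seen_headD (l : List ℕ) : seen l (l.headD 0) = [] := by
  cases l <;> simp [seen]

theorem seen_append_cons {l r : List ℕ} {a : ℕ} (h : a ∉ l) : seen (l ++ a :: r) a = l := by
  induction l with
  | nil => simp [seen]
  | cons b l ih =>
    simp only [List.mem_cons, not_or] at h
    have := ih h.2
    simp only [seen] at this ⊢
    rw [List.cons_append, List.takeWhile_cons_of_pos (by simpa using Ne.symm h.1), this]

/-- Moving the iterator past `w` adds exactly `w` to the part already seen. At the last element the
iterator becomes `0`, whence the restriction on membership. -/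
theorem nextIn_spec {l : List ℕ} {w : ℕ} (hl : l.Nodup) (h0 : 0 ∉ l) (hw : w ∈ l) :
    seen l (nextIn w l) = seen l w ++ [w] ∧ (nextIn w l ≠ 0 → nextIn w l ∈ l) := by
  obtain ⟨p, q, rfl⟩ := List.append_of_mem hw
  have hp : w ∉ p := fun h => (List.nodup_append.1 hl).2.2 w h w (by simp) rfl
  rw [nextIn_append_cons hp, seen_append_cons hp]
  cases q with
  | nil => exact ⟨by simpa using seen_zero h0, by simp⟩
  | cons b q =>
    have : p ++ w :: b :: q = (p ++ [w]) ++ b :: q := by simp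
    refine ⟨?_, by simp⟩
    rw [this] at hl ⊢
    exact seen_append_cons fun h => (List.nodup_append.1 hl).2.2 b h b (by simp) rfl

/-- Reachability along the adjacency lists `adj`. -/
abbrev Reach (adj : ℕ → List ℕ) : ℕ → ℕ → Prop := Relation.ReflTransGen fun a b => b ∈ adj a

/-- `gray` is the sequence of ancestors of `v`, beginning with `v`. -/
def ParentChain (par : ℕ → ℕ) : ℕ → List ℕ → Prop
  | v, [] => v = 0
  | v, g :: gs => v = g ∧ ParentChain par (par g) gs

theorem ParentChain.congr {par par' : ℕ → ℕ} :
    ∀ {v : ℕ} {gs : List ℕ}, (∀ g ∈ gs, par' g = par g) → ParentChain par v gs →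
      ParentChain par' v gs
  | _, [], _, h => h
  | _, g :: gs, H, h => ⟨h.1, by
      rw [H g (by simp)]
      exact ParentChain.congr (fun g hg => H g (by simp [hg])) h.2⟩

/-- The lists of neighbours of a finite graph on the positive numbers in the list `V`. -/
structure IsGraph (V : List ℕ) (adj : ℕ → List ℕ) : Prop where
  nodup : V.Nodup
  zero : 0 ∉ V
  adj_nodup : ∀ x, (adj x).Nodup
  adj_mem : ∀ x, ∀ y ∈ adj x, y ∈ V

theorem IsGraph.zero_notMem {V : List ℕ} {adj : ℕ → List ℕ} (h : IsGraph V adj) (x : ℕ) :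
    0 ∉ adj x := fun h' => h.zero (h.adj_mem x 0 h')

/-- The invariant of the depth-first search. The list `gray` holds the states that are being
explored, the current one first. -/
structure TarjanInv (V : List ℕ) (adj : ℕ → List ℕ) (idx low par itr scc : ℕ → ℕ)
    (stk : List ℕ) (v time nscc : ℕ) (gray : List ℕ) : Prop where
  chain : ParentChain par v gray
  idx_le : ∀ x, idx x ≤ time
  mem_V : ∀ x, idx x ≠ 0 → x ∈ V
  mem_stk : ∀ x, x ∈ stk ↔ idx x ≠ 0 ∧ scc x = 0
  stk_sorted : stk.Pairwise fun a b => idx a < idx b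
  gray_sorted : gray.Pairwise fun a b => idx b < idx a
  gray_stk : ∀ g ∈ gray, g ∈ stk
  -- Together with `stk_reach`: an ancestor reaches all that was put on the stack from it on, and
  -- every state on the stack leads to an ancestor that is not younger than itself.
  gray_reach : ∀ g ∈ gray, ∀ y ∈ stk, idx g ≤ idx y → Reach adj g y
  stk_reach : ∀ y ∈ stk, ∃ g ∈ gray, idx g ≤ idx y ∧ Reach adj y g
  black : ∀ x ∈ stk, x ∉ gray → itr x = 0
  itr_mem : ∀ x, itr x ≠ 0 → itr x ∈ adj x
  itr_idx : ∀ x, idx x = 0 → itr x = 0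
  seen_idx : ∀ x ∈ stk, ∀ y ∈ seen (adj x) (itr x), idx y ≠ 0
  low_le : ∀ g ∈ gray, low g ≤ idx g
  low_mem : ∀ g ∈ gray, ∃ y ∈ stk, idx y = low g ∧ Reach adj g y
  -- The maximality condition makes `g` the youngest ancestor not discovered after `z`, so `z` lies
  -- in the part of the stack charged to `g`. The edges explored at `z` are accounted for in `low
  -- g`, but not yet in `low` of older ancestors.
  low_edge : ∀ g ∈ gray, ∀ z ∈ stk, idx g ≤ idx z →
    (∀ g' ∈ gray, idx g' ≤ idx z → idx g' ≤ idx g) →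
    ∀ y ∈ seen (adj z) (itr z), y ∈ stk → low g ≤ idx y
  scc_idx : ∀ x, scc x ≠ 0 → idx x ≠ 0
  scc_closed : ∀ x, scc x ≠ 0 → ∀ y ∈ adj x, scc y ≠ 0
  scc_eq : ∀ x y, scc x ≠ 0 → (scc x = scc y ↔ Reach adj x y ∧ Reach adj y x)
  scc_le : ∀ x, scc x ≤ nscc

namespace TarjanInv

variable {V : List ℕ} {adj : ℕ → List ℕ} {idx low par itr scc : ℕ → ℕ}
  {stk : List ℕ} {v time nscc : ℕ} {gray : List ℕ}

theorem eq_of_idx (h : TarjanInv V adj idx low par itr scc stk v time nscc gray) {x y : ℕ}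
    (hx : x ∈ stk) (hy : y ∈ stk) (e : idx x = idx y) : x = y := by
  by_contra hne
  have := h.stk_sorted.imp (S := fun a b => idx a ≠ idx b) (fun h => h.ne)
  rw [← List.pairwise_map (f := idx) (R := (· ≠ ·))] at this
  exact hne (List.inj_on_of_nodup_map this hx hy e)

/-- Discovery of the state `x`. -/
theorem push (h : TarjanInv V adj idx low par itr scc stk v time nscc gray) {x : ℕ}
    (hV : x ∈ V) (h0 : idx x = 0) (hr : ∀ g ∈ gray, Reach adj g x) :
    TarjanInv V adj (Function.update idx x (time + 1)) (Function.update low x (time + 1))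
      (Function.update par x v) (Function.update itr x ((adj x).headD 0)) scc (stk ++ [x]) x
      (time + 1) nscc (x :: gray) := by
  have hxs : x ∉ stk := fun hx => ((h.mem_stk x).1 hx).1 h0
  have hxg : x ∉ gray := fun hx => hxs (h.gray_stk x hx)
  have hscc : scc x = 0 := by by_contra hs; exact h.scc_idx x hs h0
  have hne : ∀ y ∈ stk, y ≠ x := by rintro y hy rfl; exact hxs hy
  have hneg : ∀ y ∈ gray, y ≠ x := by rintro y hy rfl; exact hxg hy
  have hi : ∀ y ∈ stk, Function.update idx x (time + 1) y = idx y := fun y hy => by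
    simp [hne y hy]
  have hig : ∀ y ∈ gray, Function.update idx x (time + 1) y = idx y := fun y hy => by
    simp [hneg y hy]
  constructor
  · refine ⟨rfl, ?_⟩
    simp only [Function.update_self]
    exact h.chain.congr fun g hg => by simp [hneg g hg]
  · intro y
    have := h.idx_le y
    by_cases hy : y = x
    · subst hy; simp
    · simp [hy]; omega
  · intro y hy
    by_cases hyx : y = x
    · subst hyx; exact hV
    · exact h.mem_V y (by simpa [hyx] using hy)
  · intro y
    by_cases hyx : y = x
    · subst hyx; simp [hscc]
    · simp [hyx, h.mem_stk]
  · rw [List.pairwise_append]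
    refine ⟨h.stk_sorted.imp_of_mem fun {a b} ha hb hab => by rwa [hi a ha, hi b hb], by simp, ?_⟩
    intro a ha b hb
    obtain rfl : b = x := by simpa using hb
    rw [hi a ha]
    simpa using Nat.lt_succ_of_le (h.idx_le a)
  · rw [List.pairwise_cons]
    refine ⟨fun a ha => ?_, h.gray_sorted.imp_of_mem fun {a b} ha hb hab => by
      rwa [hig a ha, hig b hb]⟩
    rw [hig a ha]
    simpa using Nat.lt_succ_of_le (h.idx_le a)
  · intro g hg
    rcases List.mem_cons.1 hg with rfl | hg
    · simp
    · simp [h.gray_stk g hg]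
  · intro g hg y hy hle
    rcases List.mem_cons.1 hg with rfl | hg <;> rcases List.mem_append.1 hy with hy | hy
    · rw [hi y hy] at hle
      have := h.idx_le y
      simp at hle
      omega
    · simp at hy; subst hy; exact .refl
    · rw [hi y hy, hig g hg] at hle
      exact h.gray_reach g hg y hy hle
    · simp at hy; subst hy; exact hr g ‹_›
  · intro y hy
    rcases List.mem_append.1 hy with hy | hy
    · obtain ⟨g, hg, hle, hR⟩ := h.stk_reach y hy
      exact ⟨g, by simp [hg], by rwa [hi y hy, hig g hg], hR⟩
    · simp at hy; subst hy; exact ⟨y, by simp, le_rfl, .refl⟩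
  · intro y hy hyg
    simp only [List.mem_cons, not_or] at hyg
    have : y ∈ stk := by simpa [hyg.1] using hy
    simpa [hyg.1] using h.black y this hyg.2
  · intro y
    by_cases hyx : y = x
    · subst hyx
      simp only [Function.update_self]
      cases adj y <;> simp
    · simpa [hyx] using h.itr_mem y
  · intro y hy
    by_cases hyx : y = x
    · subst hyx; simp at hy
    · simp only [hyx, ne_eq, not_false_eq_true, Function.update_of_ne] at hy ⊢
      exact h.itr_idx y hy
  · intro z hz y hy
    by_cases hzx : z = x
    · subst hzx; rw [Function.update_self, seen_headD] at hy; simp at hy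
    · have : z ∈ stk := by simpa [hzx] using hz
      have := h.seen_idx z this y (by simpa [hzx] using hy)
      by_cases hyx : y = x
      · subst hyx; simp
      · simpa [hyx] using this
  · intro g hg
    rcases List.mem_cons.1 hg with rfl | hg
    · simp
    · simpa [hneg g hg] using h.low_le g hg
  · intro g hg
    rcases List.mem_cons.1 hg with rfl | hg
    · exact ⟨g, by simp, by simp, .refl⟩
    · obtain ⟨y, hy, e, hR⟩ := h.low_mem g hg
      exact ⟨y, by simp [hy], by simpa [hneg g hg, hne y hy] using e, hR⟩
  · intro g hg z hz hle hmax y hy hys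
    by_cases hzx : z = x
    · subst hzx; rw [Function.update_self, seen_headD] at hy; simp at hy
    have hzs : z ∈ stk := by simpa [hzx] using hz
    rw [Function.update_of_ne hzx] at hy
    -- Explored edges lead to discovered states, and `x` was not discovered before.
    have hyx : y ≠ x := by rintro rfl; exact h.seen_idx z hzs y hy h0
    have hys : y ∈ stk := by simpa [hyx] using hys
    rw [hi z hzs] at hle hmax
    rcases List.mem_cons.1 hg with rfl | hg
    · have := h.idx_le z
      simp at hle
      omega
    · rw [hig g hg] at hle hmax
      rw [Function.update_of_ne (hneg g hg), hi y hys]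
      refine h.low_edge g hg z hzs hle (fun g' hg' h' => ?_) y hy hys
      have := hmax g' (by simp [hg']) (by rwa [hig g' hg'])
      rwa [hig g' hg'] at this
  · intro y hy
    by_cases hyx : y = x
    · subst hyx; simp
    · simpa [hyx] using h.scc_idx y hy
  · exact h.scc_closed
  · exact h.scc_eq
  · exact h.scc_le

/-- The edge from `x` to `w` has been explored. -/
theorem advance (h : TarjanInv V adj idx low par itr scc stk v time nscc gray) (hG : IsGraph V adj)
    {x w : ℕ} (hx : x ∈ gray) (hw : itr x = w) (hw0 : w ≠ 0) (hi : idx w ≠ 0)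
    (hlow : w ∈ stk → low x ≤ idx w) :
    TarjanInv V adj idx low par (Function.update itr x (nextIn w (adj x))) scc stk v
      time nscc gray := by
  have hwa : w ∈ adj x := hw ▸ h.itr_mem x (hw ▸ hw0)
  obtain ⟨hs, hm⟩ := nextIn_spec (hG.adj_nodup x) (hG.zero_notMem x) hwa
  refine { h with black := ?_, itr_mem := ?_, itr_idx := ?_, seen_idx := ?_, low_edge := ?_ }
  · intro y hy hyg
    have : y ≠ x := by rintro rfl; exact hyg hx
    simpa [this] using h.black y hy hyg
  · intro y
    by_cases hyx : y = x
    · subst hyx; simpa using hm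
    · simpa [hyx] using h.itr_mem y
  · intro y hy
    have : y ≠ x := by rintro rfl; exact ((h.mem_stk _).1 (h.gray_stk _ hx)).1 hy
    simpa [this] using h.itr_idx y hy
  · intro z hz y hy
    by_cases hzx : z = x
    · subst hzx
      rw [Function.update_self, hs, List.mem_append, List.mem_singleton] at hy
      rcases hy with hy | rfl
      · exact h.seen_idx z hz y (by rwa [hw])
      · exact hi
    · exact h.seen_idx z hz y (by simpa [hzx] using hy)
  · intro g hg z hz hle hmax y hy hys
    by_cases hzx : z = x
    · subst hzx
      -- Here `z = x` is itself an ancestor, hence the youngest one not after `z`. So the newly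
      -- explored edge matters only for `low x`, where `hlow` applies.
      have hgz : g = z := h.eq_of_idx (h.gray_stk g hg) hz (le_antisymm hle (hmax z hx le_rfl))
      subst hgz
      rw [Function.update_self, hs, List.mem_append, List.mem_singleton] at hy
      rcases hy with hy | rfl
      · exact h.low_edge g hg g hz hle hmax y (by rwa [hw]) hys
      · exact hlow hys
    · exact h.low_edge g hg z hz hle hmax y (by simpa [hzx] using hy) hys

/-- The value of `low` may be decreased to the index of a reachable state on the stack. -/
theorem lower (h : TarjanInv V adj idx low par itr scc stk v time nscc gray)
    {x y : ℕ} (hx : x ∈ gray) (hy : y ∈ stk) (hlt : idx y < low x) (hr : Reach adj x y) :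
    TarjanInv V adj idx (Function.update low x (idx y)) par itr scc stk v time nscc gray := by
  refine { h with low_le := ?_, low_mem := ?_, low_edge := ?_ }
  · intro g hg
    have := h.low_le g hg
    by_cases hgx : g = x
    · subst hgx; simp; omega
    · simpa [hgx] using this
  · intro g hg
    by_cases hgx : g = x
    · subst hgx; exact ⟨y, hy, by simp, hr⟩
    · simpa [hgx] using h.low_mem g hg
  · intro g hg z hz hle hmax t ht hts
    have := h.low_edge g hg z hz hle hmax t ht hts
    by_cases hgx : g = x
    · subst hgx; simp; omega
    · simpa [hgx] using this

/-- The search returns from the state `v`, which is not the root of a component. -/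
theorem drop {gs : List ℕ}
    (h : TarjanInv V adj idx low par itr scc stk v time nscc (v :: gs))
    (hlt : low v < idx v) (hi : itr v = 0) (hlow : ∀ u ∈ gs.head?, low u ≤ low v) :
    TarjanInv V adj idx low par itr scc stk (par v) time nscc gs := by
  have hgs := List.pairwise_cons.1 h.gray_sorted
  have hvs := h.gray_stk v (by simp)
  -- As `low v < idx v`, the state behind `low v` is older than `v` and leads to an ancestor other
  -- than `v`. Whatever led to `v` now leads to that ancestor instead.
  obtain ⟨y₀, hy₀, e₀, hR₀⟩ := h.low_mem v (by simp)
  obtain ⟨g₀, hg₀, hle₀, hRg₀⟩ := h.stk_reach y₀ hy₀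
  have hg₀' : g₀ ∈ gs := by
    rcases List.mem_cons.1 hg₀ with rfl | h'
    · omega
    · exact h'
  refine { h with
    chain := h.chain.2
    gray_sorted := hgs.2
    gray_stk := fun g hg => h.gray_stk g (by simp [hg])
    gray_reach := fun g hg => h.gray_reach g (by simp [hg])
    stk_reach := ?_
    black := ?_
    low_le := fun g hg => h.low_le g (by simp [hg])
    low_mem := fun g hg => h.low_mem g (by simp [hg])
    low_edge := ?_ }
  · intro y hy
    obtain ⟨g, hg, hle, hR⟩ := h.stk_reach y hy
    rcases List.mem_cons.1 hg with rfl | hg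
    · exact ⟨g₀, hg₀', by omega, hR.trans (hR₀.trans hRg₀)⟩
    · exact ⟨g, hg, hle, hR⟩
  · intro x hx hxg
    by_cases hxv : x = v
    · rw [hxv, hi]
    · exact h.black x hx (by simp [hxv, hxg])
  · intro g hg z hz hle hmax y hy hys
    -- The states charged to `v` pass to the next ancestor `u`, and `low u ≤ low v` accounts for
    -- their edges. For the others the youngest ancestor is the same as before.
    by_cases hvz : idx v ≤ idx z
    · have h1 := h.low_edge v (by simp) z hz hvz (fun g' hg' _ => by
        rcases List.mem_cons.1 hg' with rfl | hg'
        · exact le_rfl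
        · exact (hgs.1 g' hg').le) y hy hys
      cases gs with
      | nil => simp at hg
      | cons u gs =>
        have hu := hlow u (by simp)
        have hug : idx u ≤ idx g := hmax u (by simp) ((hgs.1 u (by simp)).le.trans hvz)
        have : g = u := by
          rcases List.mem_cons.1 hg with rfl | hg'
          · rfl
          · have := (List.pairwise_cons.1 hgs.2).1 g hg'
            omega
        subst this
        omega
    · refine h.low_edge g (by simp [hg]) z hz hle (fun g' hg' h' => ?_) y hy hys
      rcases List.mem_cons.1 hg' with rfl | hg'
      · exact absurd h' hvz
      · exact hmax g' hg' h'

/-- The search returns from the root `v` of a component, which is popped from the stack. -/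
theorem pop {gs A C : List ℕ} (hG : IsGraph V adj)
    (h : TarjanInv V adj idx low par itr scc (A ++ v :: C) v time nscc (v :: gs))
    (hlow : low v = idx v) (hi : itr v = 0) :
    TarjanInv V adj idx low par itr (fun x => if x ∈ v :: C then nscc + 1 else scc x) A (par v)
      time (nscc + 1) gs := by
  have hgs := List.pairwise_cons.1 h.gray_sorted
  have hvs := h.gray_stk v (by simp)
  have hso := List.pairwise_append.1 h.stk_sorted
  have hso' := List.pairwise_cons.1 hso.2.1
  have hA : ∀ x ∈ A, idx x < idx v := fun x hx => hso.2.2 x hx v (by simp)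
  have hC : ∀ x ∈ v :: C, idx v ≤ idx x := fun x hx => by
    rcases List.mem_cons.1 hx with rfl | hx
    · exact le_rfl
    · exact (hso'.1 x hx).le
  have hAC : ∀ x ∈ A, x ∉ v :: C := fun x hx hx' => by
    have := hA x hx; have := hC x hx'; omega
  have hCs : ∀ x ∈ v :: C, x ∈ A ++ v :: C := fun x hx => List.mem_append.2 (.inr hx)
  have hgA : ∀ g ∈ gs, g ∈ A := fun g hg => by
    rcases List.mem_append.1 (h.gray_stk g (by simp [hg])) with h' | h'
    · exact h'
    · have := hgs.1 g hg; have := hC g h'; omega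
  have hvr : ∀ x ∈ v :: C, Reach adj v x := fun x hx =>
    h.gray_reach v (by simp) x (hCs x hx) (hC x hx)
  have hrv : ∀ x ∈ v :: C, Reach adj x v := fun x hx => by
    obtain ⟨g, hg, hle, hR⟩ := h.stk_reach x (hCs x hx)
    refine hR.trans (h.gray_reach g hg v hvs ?_)
    rcases List.mem_cons.1 hg with rfl | hg
    · exact le_rfl
    · exact (hgs.1 g hg).le
  -- The segment `v :: C` is finished: the other ancestors are all in `A`, non-ancestors on the
  -- stack have exhausted their lists, and `v` has done so by `hi`.
  have hseen : ∀ x ∈ v :: C, seen (adj x) (itr x) = adj x := fun x hx => by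
    have : itr x = 0 := by
      by_cases hxg : x ∈ v :: gs
      · rcases List.mem_cons.1 hxg with rfl | hxg
        · exact hi
        · exact absurd hx (hAC x (hgA x hxg))
      · exact h.black x (hCs x hx) hxg
    rw [this, seen_zero (hG.zero_notMem x)]
  -- No edge leaves the segment except into finished components: by `low_edge` an edge into the
  -- stack ends at an index at least `low v = idx v`, while the states of `A` have smaller indices.
  have hcl : ∀ x ∈ v :: C, ∀ y ∈ adj x, y ∈ v :: C ∨ scc y ≠ 0 := fun x hx y hy => by
    rw [← hseen x hx] at hy
    have hyi := h.seen_idx x (hCs x hx) y hy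
    by_cases hys : scc y = 0
    · left
      have hy' : y ∈ A ++ v :: C := (h.mem_stk y).2 ⟨hyi, hys⟩
      have := h.low_edge v (by simp) x (hCs x hx) (hC x hx) (fun g' hg' _ => by
        rcases List.mem_cons.1 hg' with rfl | hg'
        · exact le_rfl
        · exact (hgs.1 g' hg').le) y hy hy'
      rcases List.mem_append.1 hy' with h' | h'
      · have := hA y h'; omega
      · exact h'
    · exact .inr hys
  have hscl : ∀ x y, scc x ≠ 0 → Reach adj x y → scc y ≠ 0 := fun x y hx hr => by
    induction hr with
    | refl => exact hx
    | tail _ hbc ih => exact h.scc_closed _ ih _ hbc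
  have hCscc : ∀ x ∈ v :: C, scc x = 0 := fun x hx => ((h.mem_stk x).1 (hCs x hx)).2
  have hCreach : ∀ x y, x ∈ v :: C → Reach adj x y → y ∈ v :: C ∨ scc y ≠ 0 := fun x y hx hr => by
    induction hr with
    | refl => exact .inl hx
    | tail _ hbc ih =>
      rcases ih with ih | ih
      · exact hcl _ ih _ hbc
      · exact .inr (h.scc_closed _ ih _ hbc)
  refine { h with
    chain := h.chain.2
    mem_stk := ?_
    stk_sorted := hso.1
    gray_sorted := hgs.2
    gray_stk := hgA
    gray_reach := fun g hg y hy => h.gray_reach g (by simp [hg]) y (by simp [hy])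
    stk_reach := ?_
    black := ?_
    seen_idx := fun x hx => h.seen_idx x (by simp [hx])
    low_le := fun g hg => h.low_le g (by simp [hg])
    low_mem := ?_
    low_edge := ?_
    scc_idx := ?_
    scc_closed := ?_
    scc_eq := ?_
    scc_le := ?_ }
  · intro x
    have := h.mem_stk x
    rw [List.mem_append] at this
    constructor
    · intro hx
      simpa [hAC x hx] using this.1 (.inl hx)
    · rintro ⟨h1, h2⟩
      split_ifs at h2 with hx
      · rcases this.2 ⟨h1, h2⟩ with h' | h'
        · exact h'
        · exact absurd h' hx
  · intro y hy
    obtain ⟨g, hg, hle, hR⟩ := h.stk_reach y (by simp [hy])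
    rcases List.mem_cons.1 hg with rfl | hg
    · have := hA y hy; omega
    · exact ⟨g, hg, hle, hR⟩
  · intro x hx hxg
    refine h.black x (by simp [hx]) ?_
    have : x ≠ v := by rintro rfl; exact hAC x hx (by simp)
    simp [this, hxg]
  · intro g hg
    obtain ⟨y, hy, e, hR⟩ := h.low_mem g (by simp [hg])
    refine ⟨y, ?_, e, hR⟩
    rcases List.mem_append.1 hy with h' | h'
    · exact h'
    · have := h.low_le g (by simp [hg])
      have := hgs.1 g hg
      have := hC y h'
      omega
  · intro g hg z hz hle hmax y hy hys
    refine h.low_edge g (by simp [hg]) z (by simp [hz]) hle (fun g' hg' h' => ?_) y hy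
      (by simp [hys])
    rcases List.mem_cons.1 hg' with rfl | hg'
    · have := hA z hz; omega
    · exact hmax g' hg' h'
  · intro x hx
    split_ifs at hx with hxC
    · exact ((h.mem_stk x).1 (hCs x hxC)).1
    · exact h.scc_idx x hx
  · intro x hx y hy
    by_cases hyC : y ∈ v :: C
    · rw [if_pos hyC]; simp
    · rw [if_neg hyC]
      split_ifs at hx with hxC
      · exact (hcl x hxC y hy).resolve_left hyC
      · exact h.scc_closed x hx y hy
  -- The segment is strongly connected through `v`. Finished components are closed under edges, so
  -- none of them leads back into the segment; correspondingly the new number exceeds all old ones.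
  · intro x y hx
    have hle := h.scc_le x
    have hle' := h.scc_le y
    split_ifs at hx ⊢ with hxC hyC hyC
    · simpa using ⟨(hrv x hxC).trans (hvr y hyC), (hrv y hyC).trans (hvr x hxC)⟩
    · constructor
      · intro e; omega
      · rintro ⟨h1, h2⟩
        exact absurd (hCscc x hxC) (hscl y x ((hCreach x y hxC h1).resolve_left hyC) h2)
    · constructor
      · intro e; omega
      · rintro ⟨h1, -⟩
        exact absurd (hCscc y hyC) (hscl x y hx h1)
    · exact h.scc_eq x y hx
  · intro x
    have hle := h.scc_le x
    split_ifs <;> omega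

end TarjanInv

end ReachPart

namespace ReachPart

/-! ## The depth-first search as a program -/

/-- The number of elements of a list from the element `i` on. -/
def left (l : List ℕ) (i : ℕ) : ℕ := (l.dropWhile (· ≠ i)).length

theorem seen_length_add_left (l : List ℕ) (i : ℕ) : (seen l i).length + left l i = l.length := by
  rw [seen, left, ← List.length_append, List.takeWhile_append_dropWhile]

theorem left_headD (l : List ℕ) : left l (l.headD 0) = l.length := by
  have := seen_length_add_left l (l.headD 0)
  rw [seen_headD] at this
  simpa using this

theorem left_nextIn {l : List ℕ} {w : ℕ} (hl : l.Nodup) (h0 : 0 ∉ l) (hw : w ∈ l) :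
    left l (nextIn w l) + 1 = left l w := by
  have h1 := seen_length_add_left l (nextIn w l)
  have h2 := seen_length_add_left l w
  rw [(nextIn_spec hl h0 hw).1] at h1
  simp only [List.length_append, List.length_cons, List.length_nil] at h1
  omega

/-- The lists of strongly connected components agree with the array `scc`. -/
structure CompInv (m : Memory) : Prop where
  mem_states : ∀ c x, x ∈ m.lst .sccStates c ↔ c ≠ 0 ∧ m.arr .scc x = c
  mem_sccs : ∀ c, c ∈ m.lst .sccs 0 ↔ c ≠ 0 ∧ c ≤ m.reg .numScc
  exists_mem : ∀ c ∈ m.lst .sccs 0, ∃ x, m.arr .scc x = c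

/-- The invariant of the depth-first search on the memory. -/
structure DfsInv (V : List ℕ) (adj : ℕ → List ℕ) (m : Memory) (gray : List ℕ) : Prop where
  pre : m.lst .pre = adj
  inv : TarjanInv V adj (m.arr .index) (m.arr .low) (m.arr .parent) (m.arr .iter) (m.arr .scc)
    (m.lst .stack 0) (m.reg .v) (m.reg .time) (m.reg .numScc) gray
  comp : CompInv m

/-- The budget of a state in the depth-first search. -/
def stateBudget (adj : ℕ → List ℕ) (idx itr : ℕ → ℕ) (x : ℕ) : ℕ :=
  if idx x = 0 then 150 + 100 * (adj x).length else 100 * left (adj x) (itr x)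

/-- The budget for the rest of the depth-first search. -/
def dfsBudget (V : List ℕ) (adj : ℕ → List ℕ) (m : Memory) (gray : List ℕ) : ℕ :=
  ∑ x ∈ V.toFinset, stateBudget adj (m.arr .index) (m.arr .iter) x + 100 * gray.length +
    50 * (m.lst .stack 0).length

theorem sum_toFinset_update {V : List ℕ} {f g : ℕ → ℕ} {x : ℕ} (hx : x ∈ V)
    (h : ∀ y ≠ x, f y = g y) :
    ∑ y ∈ V.toFinset, f y + g x = ∑ y ∈ V.toFinset, g y + f x := by
  have hx' : x ∈ V.toFinset := by simpa using hx
  rw [← Finset.add_sum_erase _ f hx', ← Finset.add_sum_erase _ g hx',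
    Finset.sum_congr rfl fun y hy => h y (Finset.ne_of_mem_erase hy)]
  ring

theorem sum_stateBudget_advance {V : List ℕ} {adj : ℕ → List ℕ} {idx itr : ℕ → ℕ} {x : ℕ}
    (hG : IsGraph V adj) (hx : x ∈ V) (hi : idx x ≠ 0) (hw : itr x ∈ adj x) :
    ∑ y ∈ V.toFinset, stateBudget adj idx (Function.update itr x (nextIn (itr x) (adj x))) y
      + 100 = ∑ y ∈ V.toFinset, stateBudget adj idx itr y := by
  have h := sum_toFinset_update hx (f := stateBudget adj idx
    (Function.update itr x (nextIn (itr x) (adj x)))) (g := stateBudget adj idx itr)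
    (fun y hy => by simp [stateBudget, hy])
  have h' := left_nextIn (hG.adj_nodup x) (hG.zero_notMem x) hw
  simp only [stateBudget, hi, if_false, Function.update_self] at h ⊢
  omega

theorem sum_stateBudget_push {V : List ℕ} {adj : ℕ → List ℕ} {idx itr : ℕ → ℕ} {x t : ℕ}
    (hx : x ∈ V) (hi : idx x = 0) (ht : t ≠ 0) :
    ∑ y ∈ V.toFinset, stateBudget adj (Function.update idx x t)
      (Function.update itr x ((adj x).headD 0)) y + 150 =
      ∑ y ∈ V.toFinset, stateBudget adj idx itr y := by
  have h := sum_toFinset_update hx (f := stateBudget adj (Function.update idx x t)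
    (Function.update itr x ((adj x).headD 0))) (g := stateBudget adj idx itr)
    (fun y hy => by simp [stateBudget, hy])
  have h1 : stateBudget adj (Function.update idx x t)
      (Function.update itr x ((adj x).headD 0)) x = 100 * (adj x).length := by
    simp only [stateBudget, Function.update_self, ht, if_false, left_headD]
  have h2 : stateBudget adj idx itr x = 150 + 100 * (adj x).length := by
    simp [stateBudget, hi]
  omega

theorem erase_append_singleton {l : List ℕ} {a : ℕ} (h : a ∉ l) : (l ++ [a]).erase a = l := by
  rw [List.erase_append_right _ h]
  simp

/-- Popping a strongly connected component. -/
theorem wp_popScc {m : Memory} {A C : List ℕ} (hw : m.WF)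
    (hs : m.lst .stack 0 = A ++ m.reg .v :: C) (hc : CompInv m)
    (hz : ∀ x ∈ m.lst .stack 0, m.arr .scc x = 0) (hle : ∀ x, m.arr .scc x ≤ m.reg .numScc) :
    Wp Cmd.popScc m fun m' k => k ≤ 25 + 30 * (C.length + 1) ∧ m'.lst .stack 0 = A ∧
      m'.reg .numScc = m.reg .numScc + 1 ∧
      m'.arr .scc = (fun x => if x ∈ m.reg .v :: C then m.reg .numScc + 1 else m.arr .scc x) ∧
      CompInv m' := by
  have hv0 : m.reg .v ≠ 0 := fun h => (hw .stack 0).2 (by rw [hs, h]; simp)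
  have hnd : (A ++ m.reg .v :: C).Nodup := hs ▸ (hw .stack 0).1
  have hfresh : m.lst .sccStates (m.reg .numScc + 1) = [] := by
    rw [List.eq_nil_iff_forall_not_mem]
    intro x hx
    have := ((hc.mem_states _ _).1 hx).2
    have := hle x
    omega
  have hfresh' : m.reg .numScc + 1 ∉ m.lst .sccs 0 := fun h => by
    have := ((hc.mem_sccs _).1 h).2
    omega
  unfold Cmd.popScc
  simp only [wp_block_cons, wp_block_nil, wp_assign, wp_append, Exp.eval, Exp.cost,
    Memory.setReg_reg, Memory.setReg_lst, if_true]
  refine ⟨by omega, hfresh', ?_⟩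
  -- `B₁` is still on the stack and `B₂` has been popped, from the top, hence the reversal in
  -- `sccStates`. Since `v` is the bottom of the segment, `w = v` holds exactly when nothing is
  -- left; initially `w = 0` differs from `v`.
  refine wp_while (fun n m₁ => ∃ B₁ B₂, m.reg .v :: C = B₁ ++ B₂ ∧ n = 30 * B₁.length ∧
    m₁.lst .stack 0 = A ++ B₁ ∧ (m₁.reg .w = m.reg .v ↔ B₁ = []) ∧
    m₁.arr .scc = (fun x => if x ∈ B₂ then m.reg .numScc + 1 else m.arr .scc x) ∧
    (∀ c, m₁.lst .sccStates c = if c = m.reg .numScc + 1 then B₂.reverse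
      else m.lst .sccStates c))
    (n := 30 * (C.length + 1)) ?_ ?_ ?_
  · refine ⟨m.reg .v :: C, [], by simp, by simp, ?_, ?_, ?_, ?_⟩
    · simpa using hs
    · simp [hv0.symm]
    · simp
    · intro c
      simp only [Memory.setReg_lst, Memory.setLst_lst, reduceCtorEq, if_false]
      split_ifs with h
      · rw [h, hfresh]; rfl
      · rfl
  · rintro n m₁ hf ⟨B₁, B₂, hB, hn, hst, hwv, hscc, hsts⟩ hb
    have hv : m₁.reg .v = m.reg .v := by rw [hf.reg .v rfl]; simp
    have hN : m₁.reg .numScc = m.reg .numScc + 1 := by rw [hf.reg .numScc rfl]; simp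
    simp only [Test.holds, Exp.eval, hv, hwv, ne_eq] at hb
    obtain ⟨B, y, rfl⟩ : ∃ B y, B₁ = B ++ [y] := ⟨_, _, (List.dropLast_append_getLast hb).symm⟩
    have hAB : (A ++ B ++ y :: B₂).Nodup := by
      rw [hB] at hnd
      simpa using hnd
    have hy1 : y ∉ A ++ B := fun h => (List.nodup_append.1 hAB).2.2 y h y (by simp) rfl
    have hy2 : y ∉ B₂ := (List.nodup_cons.1 (List.nodup_append.1 hAB).2.1).1
    have hl : (A ++ (B ++ [y])).getLastD 0 = y := by simp
    have hy0 : y ≠ 0 := fun h => (hw .stack 0).2 (by rw [hs, hB, ← h]; simp)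
    simp only [wp_block_cons, wp_block_nil, wp_assign, wp_append, wp_remove, wp_store, Exp.eval,
      Exp.cost, Test.cost, Memory.setReg_reg, Memory.setReg_lst, Memory.setLst_reg,
      Memory.setArr_reg, Memory.setArr_lst, Memory.setLst_lst, if_true, reduceCtorEq, if_false,
      hl, hN, hst, hsts]
    refine ⟨by simp, hy0, by simpa using hy2, 30 * B.length, ?_, B, y :: B₂, ?_, rfl, ?_, ?_, ?_, ?_⟩
    · simp at hn; omega
    · simpa using hB
    · rw [Function.update_self, ← List.append_assoc, erase_append_singleton hy1]
    · cases B with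
      | nil => simpa using (List.cons.inj hB).1.symm
      | cons z B =>
        simp only [List.cons_append, List.cons.injEq] at hB
        simp only [reduceCtorEq, iff_false]
        rintro rfl
        apply hy1
        simp [hB.1]
    · simp only [Memory.setLst_arr, Memory.setArr_arr, Memory.setReg_arr, if_true, hscc]
      funext x
      by_cases hx : x = y
      · subst hx; simp
      · simp [hx]
    · intro c
      by_cases hc' : c = m.reg .numScc + 1
      · subst hc'; simp
      · simp [hc', hsts]
  · rintro n' m' k hf hk ⟨B₁, B₂, hB, hn, hst, hwv, hscc, hsts⟩ hb
    have hv : m'.reg .v = m.reg .v := by rw [hf.reg .v rfl]; simp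
    have hN : m'.reg .numScc = m.reg .numScc + 1 := by rw [hf.reg .numScc rfl]; simp
    have hsc : m'.lst .sccs 0 = m.lst .sccs 0 ++ [m.reg .numScc + 1] := by
      rw [hf.lst .sccs rfl]; simp
    simp only [Test.holds, Exp.eval, hv, hwv, ne_eq, not_not] at hb
    subst hb
    simp only [List.nil_append] at hB
    simp only [Test.cost, Exp.cost] at hk
    subst hB
    refine ⟨by omega, by simpa using hst, hN, hscc, ?_, ?_, ?_⟩
    · intro c x
      rw [hsts, hscc]
      have := hle x
      by_cases hc' : c = m.reg .numScc + 1
      · rw [if_pos hc', hc']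
        by_cases hx : x ∈ m.reg .v :: C
        · simp only [List.mem_reverse, hx, if_true]
          simp
        · simp only [List.mem_reverse, hx, if_false]; constructor
          · simp
          · intro h; omega
      · rw [if_neg hc', hc.mem_states]
        by_cases hx : x ∈ m.reg .v :: C
        · simp only [hx, if_true]
          constructor
          · rintro ⟨h1, h2⟩
            have := hz x (by rw [hs]; exact List.mem_append.2 (.inr hx))
            omega
          · rintro ⟨-, h⟩; omega
        · simp [hx]
    · intro c
      rw [hsc, hN, List.mem_append, hc.mem_sccs, List.mem_singleton]
      omega
    · intro c hc'
      rw [hsc, List.mem_append, List.mem_singleton] at hc'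
      rcases hc' with hc' | rfl
      · obtain ⟨x, hx⟩ := hc.exists_mem c hc'
        have := (hc.mem_sccs c).1 hc'
        refine ⟨x, ?_⟩
        rw [hscc]
        have hxC : x ∉ m.reg .v :: C := fun h => by
          have := hz x (by rw [hs]; exact List.mem_append.2 (.inr h))
          omega
        simp only [if_neg hxC, hx]
      · exact ⟨m.reg .v, by rw [hscc]; simp⟩

theorem CompInv.congr {m m' : Memory} (h : CompInv m) (h1 : m'.lst .sccStates = m.lst .sccStates)
    (h2 : m'.lst .sccs = m.lst .sccs) (h3 : m'.arr .scc = m.arr .scc)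
    (h4 : m'.reg .numScc = m.reg .numScc) : CompInv m' :=
  ⟨by simpa only [h1, h3] using h.mem_states, by simpa only [h2, h4] using h.mem_sccs,
    by simpa only [h2, h3] using h.exists_mem⟩

/-- Each step is paid by what it releases from `dfsBudget`. An explored edge gives 100. A discovery
gives 150, which is reinvested as 100 for the ancestor list and 50 for the stack. A return gives
back the 100 of the ancestor, and each popped state its 50, against 30 in `wp_popScc`. The 5 covers
the test of the surrounding loop, of cost 4. -/
theorem wp_dfsStep {V : List ℕ} {adj : ℕ → List ℕ} {m : Memory} {v : ℕ} {gs : List ℕ}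
    (hG : IsGraph V adj) (h : DfsInv V adj m (v :: gs)) (hw : m.WF) :
    Wp Cmd.dfsStep m fun m' k => ∃ gray, DfsInv V adj m' gray ∧
      (∀ x, m.arr .index x ≠ 0 → m'.arr .index x ≠ 0) ∧
      dfsBudget V adj m' gray + k + 5 ≤ dfsBudget V adj m (v :: gs) := by
  obtain ⟨rfl, hch⟩ := h.inv.chain
  have hvs := h.inv.gray_stk (m.reg .v) (by simp)
  have hv := (h.inv.mem_stk _).1 hvs
  have hvV := h.inv.mem_V _ hv.1
  have hgs := List.pairwise_cons.1 h.inv.gray_sorted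
  unfold Cmd.dfsStep
  rw [wp_block_cons, wp_assign, wp_block_cons, wp_ite]
  simp only [Exp.eval, Exp.cost, Test.cost, Test.holds, Memory.setReg_reg, if_true]
  refine ⟨fun hne => ?_, fun heq => ?_⟩
  · have hwa := h.inv.itr_mem _ hne
    have hwV := hG.adj_mem _ _ hwa
    have hbud := sum_stateBudget_advance hG hvV hv.1 hwa
    simp only [wp_block_cons, wp_block_nil, wp_next, wp_store, wp_ite, wp_when,
      Exp.eval, Exp.cost, Test.cost, Test.holds, Memory.setReg_reg, Memory.setReg_arr,
      Memory.setReg_lst, Memory.setArr_reg, Memory.setArr_arr, if_true,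
      if_false, reduceCtorEq, h.pre]
    refine ⟨hwa, fun hw0 => ?_, fun hw0 => ⟨fun hs => ⟨fun hlt => ?_, fun hge => ?_⟩, fun hs => ?_⟩⟩
    · have hbud' := sum_stateBudget_push (adj := adj) (t := m.reg .time + 1) (itr := Function.update (m.arr .iter) (m.reg .v)
        (nextIn (m.arr .iter (m.reg .v)) (adj (m.reg .v)))) hwV hw0 (by omega)
      have hvw : m.reg .v ≠ m.arr .iter (m.reg .v) := fun e => hv.1 (by rw [e]; exact hw0)
      have hws : m.arr .iter (m.reg .v) ∉ m.lst .stack 0 := fun h' =>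
        ((h.inv.mem_stk _).1 h').1 hw0
      have hinv := h.inv.push hwV hw0 (fun g hg => (h.inv.gray_reach g hg _ hvs (by
        rcases List.mem_cons.1 hg with rfl | hg
        · exact le_rfl
        · exact (hgs.1 g hg).le)).tail hwa)
      have hlv : m.arr .low (m.reg .v) ≤ m.reg .time :=
        (h.inv.low_le _ (by simp)).trans (h.inv.idx_le _)
      -- The program moves the iterator of `v` before it discovers `w`. The abstract moves come in
      -- the other order, since `advance` wants `w` discovered; the two updates of the iterators
      -- commute. The fresh index of `w` exceeds `low v`, so `low v` needs no change.
      have hinv' := hinv.advance hG (x := m.reg .v) (w := m.arr .iter (m.reg .v)) (by simp)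
        (by simp [hvw]) hne (by simp) (by simp [hvw]; omega)
      rw [Function.update_comm hvw.symm] at hinv'
      simp only [Cmd.visit, wp_block_cons, wp_block_nil, wp_assign, wp_store, wp_append,
        Exp.eval, Exp.cost, Memory.setReg_reg, Memory.setReg_arr,
        Memory.setReg_lst, Memory.setArr_reg, Memory.setArr_lst,
        Memory.setLst_reg, if_true, if_false, reduceCtorEq, h.pre]
      refine ⟨hne, hws, m.arr .iter (m.reg .v) :: m.reg .v :: gs, ⟨?_, ?_, ?_⟩, ?_, ?_⟩
      · simp [h.pre]
      · simpa using hinv'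
      · exact h.comp.congr (by simp) (by simp) (by simp) (by simp)
      · intro x hx
        by_cases hxw : x = m.arr .iter (m.reg .v)
        · simp [hxw]
        · simpa [hxw] using hx
      · simp [dfsBudget] at hbud hbud' ⊢
        omega
    · have hws : m.arr .iter (m.reg .v) ∈ m.lst .stack 0 := (h.inv.mem_stk _).2 ⟨hw0, hs⟩
      have hinv := (h.inv.lower (by simp) hws hlt (.single hwa)).advance hG (x := m.reg .v)
        (w := m.arr .iter (m.reg .v)) (by simp) rfl hne hw0 (by simp)
      refine ⟨m.reg .v :: gs, ⟨?_, ?_, ?_⟩, ?_, ?_⟩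
      · simp [h.pre]
      · simpa using hinv
      · exact h.comp.congr (by simp) (by simp) (by simp) (by simp)
      · simp
      · simp [dfsBudget] at hbud ⊢
        omega
    · have hinv := h.inv.advance hG (x := m.reg .v)
        (w := m.arr .iter (m.reg .v)) (by simp) rfl hne hw0 (fun _ => by omega)
      refine ⟨m.reg .v :: gs, ⟨?_, ?_, ?_⟩, ?_, ?_⟩
      · simp [h.pre]
      · simpa using hinv
      · exact h.comp.congr (by simp) (by simp) (by simp) (by simp)
      · simp
      · simp [dfsBudget] at hbud ⊢
        omega
    · have hinv := h.inv.advance hG (x := m.reg .v)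
        (w := m.arr .iter (m.reg .v)) (by simp) rfl hne hw0
        (fun h' => absurd ((h.inv.mem_stk _).1 h').2 hs)
      refine ⟨m.reg .v :: gs, ⟨?_, ?_, ?_⟩, ?_, ?_⟩
      · simp [h.pre]
      · simpa using hinv
      · exact h.comp.congr (by simp) (by simp) (by simp) (by simp)
      · simp
      · simp [dfsBudget] at hbud ⊢
        omega
  · rw [ne_eq, not_not] at heq
    rw [wp_block_cons, wp_when]
    refine ⟨fun hroot => ?_, fun hroot => ?_⟩
    · simp only [Exp.eval, Test.holds, Memory.setReg_reg, Memory.setReg_arr, if_false,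
        reduceCtorEq] at hroot
      obtain ⟨A, C, hAC⟩ := List.append_of_mem hvs
      have hinv := h.inv
      rw [hAC] at hinv
      have hinv' := hinv.pop hG hroot heq
      rw [wp_block_cons]
      refine (wp_popScc (m := m.setReg .w (m.arr .iter (m.reg .v))) (A := A) (C := C) hw
        (by simpa using hAC) (h.comp.congr rfl rfl rfl (by simp))
        (fun x hx => by simpa using ((h.inv.mem_stk x).1 hx).2)
        (by simpa using h.inv.scc_le)).mono ?_
      rintro m' k hf ⟨hk, hst, hns, hscc, hcomp⟩
      have e1 : m'.reg .v = m.reg .v := by rw [hf.reg .v rfl]; simp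
      have e2 : m'.arr .low = m.arr .low := by rw [hf.arr .low rfl]; simp
      have e3 : m'.arr .parent = m.arr .parent := by rw [hf.arr .parent rfl]; simp
      have e4 : m'.arr .index = m.arr .index := by rw [hf.arr .index rfl]; simp
      have e5 : m'.arr .iter = m.arr .iter := by rw [hf.arr .iter rfl]; simp
      have e6 : m'.reg .time = m.reg .time := by rw [hf.reg .time rfl]; simp
      have e7 : m'.lst .pre = adj := by rw [hf.lst .pre rfl, ← h.pre]; simp
      simp only [Memory.setReg_reg, Memory.setReg_arr, if_false, reduceCtorEq] at hns hscc
      have hD : ∀ x : ℕ, DfsInv V adj ((m'.setReg .u x).setReg .v (m.arr .parent (m.reg .v))) gs :=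
        fun x => by
          refine ⟨by simpa using e7, ?_, hcomp.congr rfl rfl rfl (by simp)⟩
          simpa [e2, e3, e4, e5, e6, hst, hns, hscc] using hinv'
      -- The index of a root exceeds the `low` of every older ancestor, so the program leaves `low`
      -- of the parent as it is.
      have hno : ∀ g ∈ gs, ¬ m.arr .low (m.reg .v) < m.arr .low g := fun g hg => by
        have := h.inv.low_le g (by simp [hg])
        have := hgs.1 g hg
        omega
      simp only [wp_block_cons, wp_block_nil, wp_assign, wp_when, wp_store, Exp.eval, Exp.cost,
        Test.cost, Test.holds, Memory.setReg_reg, Memory.setReg_arr, if_true, if_false,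
        reduceCtorEq, e1, e2, e3]
      have hb : ∀ c x : ℕ, c ≤ 80 → dfsBudget V adj ((m'.setReg .u x).setReg .v
          (m.arr .parent (m.reg .v))) gs + (k + c) + 5 ≤ dfsBudget V adj m (m.reg .v :: gs) := by
        intro c x hc
        simp only [dfsBudget, Memory.setReg_arr, Memory.setReg_lst, e4, e5, hst, hAC,
          List.length_append, List.length_cons]
        omega
      refine ⟨fun hu => ⟨fun hlt => ?_, fun hge => ?_⟩, fun hu => ?_⟩
      · cases gs with
        | nil => exact absurd hch hu
        | cons g gs =>
          rw [hch.1] at hlt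
          exact absurd hlt (hno g (by simp))
      · refine ⟨gs, hD _, by simp [e4], le_trans ?_ (hb 80 (m.arr .parent (m.reg .v)) le_rfl)⟩
        omega
      · refine ⟨gs, hD _, by simp [e4], le_trans ?_ (hb 80 (m.arr .parent (m.reg .v)) le_rfl)⟩
        omega
    · simp only [Exp.eval, Test.holds, Memory.setReg_reg, Memory.setReg_arr, if_false,
        reduceCtorEq] at hroot
      have hlt := lt_of_le_of_ne (h.inv.low_le _ (by simp)) hroot
      simp only [wp_block_cons, wp_block_nil, wp_assign, wp_when, wp_store, Exp.eval, Exp.cost,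
        Test.cost, Test.holds, Memory.setReg_reg, Memory.setReg_arr, Memory.setArr_reg, if_true,
        if_false, reduceCtorEq]
      refine ⟨fun hu => ⟨fun hlt' => ?_, fun hge => ?_⟩, fun hu => ?_⟩
      · cases gs with
        | nil => exact absurd hch hu
        | cons g gs =>
          rw [hch.1] at hlt' ⊢
          have hgv : m.reg .v ≠ g := by
            rintro e
            have := hgs.1 g (by simp)
            rw [e] at this
            exact lt_irrefl _ this
          obtain ⟨y, hy, hyl, hvy⟩ := h.inv.low_mem (m.reg .v) (by simp)
          -- The parent reaches `v`, and `v` reaches the state whose index is `low v`. So `lower`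
          -- may transfer this value to the parent before `drop` removes `v`.
          have hr := (h.inv.gray_reach g (by simp) _ hvs (hgs.1 g (by simp)).le).trans hvy
          have hinv := (h.inv.lower (x := g) (by simp) hy (by omega) hr).drop
            (by simpa [hgv] using hlt) heq (by simp [hgv, hyl])
          rw [hch.1, hyl] at hinv
          refine ⟨g :: gs, ⟨?_, ?_, ?_⟩, ?_, ?_⟩
          · simp [h.pre]
          · simpa using hinv
          · exact h.comp.congr (by simp) (by simp) (by simp) (by simp)
          · simp
          · simp [dfsBudget]
            omega
      · have hinv := h.inv.drop hlt heq (fun u hu' => by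
          cases gs with
          | nil => simp at hu'
          | cons g gs =>
            simp only [List.head?_cons, Option.mem_def, Option.some.injEq] at hu'
            rw [hch.1] at hge
            subst hu'
            omega)
        refine ⟨gs, ⟨?_, ?_, ?_⟩, ?_, ?_⟩
        · simp [h.pre]
        · simpa using hinv
        · exact h.comp.congr (by simp) (by simp) (by simp) (by simp)
        · simp
        · simp [dfsBudget]
          omega
      · have hinv := h.inv.drop hlt heq (fun u hu' => by
          cases gs with
          | nil => simp at hu'
          | cons g gs =>
            have hg := h.inv.gray_stk g (by simp)
            rw [← hch.1, not_not.1 hu] at hg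
            exact absurd hg (hw .stack 0).2)
        refine ⟨gs, ⟨?_, ?_, ?_⟩, ?_, ?_⟩
        · simp [h.pre]
        · simpa using hinv
        · exact h.comp.congr (by simp) (by simp) (by simp) (by simp)
        · simp
        · simp [dfsBudget]
          omega

/-- The components computed by the depth-first search are the strongly connected components. -/
structure SccInv (V : List ℕ) (adj : ℕ → List ℕ) (m : Memory) : Prop where
  scc_ne : ∀ x, m.arr .scc x ≠ 0 ↔ x ∈ V
  scc_eq : ∀ x ∈ V, ∀ y, m.arr .scc x = m.arr .scc y ↔ Reach adj x y ∧ Reach adj y x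
  scc_mem : ∀ x ∈ V, m.arr .scc x ∈ m.lst .sccs 0
  comp : CompInv m

/-- Between two roots there are no ancestors, and `stk_reach` then forces the stack to be empty; so
after the scan every state has a component. The initial `dfsBudget` contributes 150 per state and
100 per edge, and the scan of the roots another 150 per state. -/
theorem wp_tarjan {V : List ℕ} {adj : ℕ → List ℕ} {m : Memory}
    (hG : IsGraph V adj) (hw : m.WF) (hV : m.lst .states 0 = V) (hpre : m.lst .pre = adj)
    (hidx : ∀ x, m.arr .index x = 0) (hitr : ∀ x, m.arr .iter x = 0)
    (hscc : ∀ x, m.arr .scc x = 0) (hstk : m.lst .stack 0 = []) (hsccs : m.lst .sccs 0 = [])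
    (hsts : ∀ c, m.lst .sccStates c = []) (hns : m.reg .numScc = 0) (hv : m.reg .v = 0) :
    Wp Cmd.tarjan m fun m' k => k ≤ 300 * V.length + 100 * ∑ x ∈ V.toFinset, (adj x).length + 10 ∧
      SccInv V adj m' := by
  have h0 : DfsInv V adj m [] := by
    refine ⟨hpre, ?_, ⟨?_, ?_, ?_⟩⟩
    · constructor <;> simp [hidx, hitr, hscc, hstk, hns, ParentChain, hv]
    · intro c x
      simp [hsts, hscc]
      tauto
    · intro c; simp [hsccs, hns]
    · simp [hsccs]
  have hbud : dfsBudget V adj m [] = 150 * V.length + 100 * ∑ x ∈ V.toFinset, (adj x).length := by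
    simp [dfsBudget, hstk, stateBudget, hidx, Finset.sum_add_distrib, ← Finset.mul_sum,
      List.toFinset_card_of_nodup hG.nodup]
    ring
  unfold Cmd.tarjan
  refine wp_scan (fun n m₁ dn rest => DfsInv V adj m₁ [] ∧ (∀ x ∈ dn, m₁.arr .index x ≠ 0) ∧
    n = 150 * rest.length + dfsBudget V adj m₁ []) 0 _ hw (fun _ _ => rfl) rfl
    ⟨⟨h0.pre, by simpa using h0.inv, h0.comp.congr rfl rfl rfl (by simp)⟩, by simp, rfl⟩ ?_ ?_
  · rintro n m₁ dn a rest hf w₁ hl ha ⟨hI, hdn, hn⟩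
    have hst : m₁.lst .states 0 = V := by rw [hf.lst .states rfl, hV]
    have haV : a ∈ V := by rw [← hst, hl]; simp
    have hv0 : m₁.reg .v = 0 := hI.inv.chain
    have hnil : m₁.lst .stack 0 = [] := by
      rw [List.eq_nil_iff_forall_not_mem]
      intro y hy
      obtain ⟨g, hg, -⟩ := hI.inv.stk_reach y hy
      simp at hg
    simp only [wp_block_cons, wp_block_nil, wp_when]
    refine ⟨fun hi => ?_, fun hi => ?_⟩
    · simp only [Test.holds, Exp.eval, ha] at hi
      have hinv := hI.inv.push haV hi (by simp)
      have hb := sum_stateBudget_push (adj := adj) (itr := m₁.arr .iter) haV hi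
        (Nat.succ_ne_zero (m₁.reg .time))
      simp only [Cmd.visit, wp_block_cons, wp_block_nil, wp_assign, wp_store, wp_append,
        Exp.eval, Exp.cost, Memory.setReg_reg, Memory.setReg_lst, Memory.setArr_reg,
        Memory.setArr_lst, Memory.setLst_reg, if_true, if_false, reduceCtorEq, hI.pre, ha, hnil,
        Test.cost]
      refine ⟨fun h => hG.zero (h ▸ haV), by simp, ?_⟩
      have hws : (m₁.setLst .stack 0 [a]).WF := w₁.setLst .stack 0 (by simp)
        (by simpa using fun h : 0 = a => hG.zero (h ▸ haV))
      refine wp_while (fun n m₂ => ∃ gray, DfsInv V adj m₂ gray ∧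
        (∀ x ∈ dn ++ [a], m₂.arr .index x ≠ 0) ∧ n = dfsBudget V adj m₂ gray)
        ⟨[a], ⟨?_, ?_, ?_⟩, ?_, rfl⟩ ?_ ?_
      · simp [hI.pre]
      · rw [hnil, hv0] at hinv
        simpa using hinv
      · exact hI.comp.congr (by simp) (by simp) (by simp) (by simp)
      · intro x hx
        by_cases hxa : x = a
        · simp [hxa]
        · simpa [hxa] using hdn x (by simpa [hxa] using hx)
      · rintro n₂ m₂ hf₂ ⟨gray, hI₂, hdn₂, rfl⟩ hb₂
        simp only [Test.holds, Exp.eval] at hb₂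
        cases gray with
        | nil => exact absurd hI₂.inv.chain hb₂
        | cons v gs =>
          refine (wp_dfsStep hG hI₂ (hf₂.wf hws)).mono ?_
          rintro m₃ k hf₃ ⟨gray, hI₃, hmono, hk⟩
          refine ⟨_, ?_, gray, hI₃, fun x hx => hmono x (hdn₂ x hx), rfl⟩
          simp only [Test.cost, Exp.cost]
          omega
      · rintro n₂ m₂ k hf₂ hk ⟨gray, hI₂, hdn₂, rfl⟩ hb₂
        simp only [Test.holds, Exp.eval, ne_eq, not_not] at hb₂
        cases gray with
        | cons v gs =>
          have hg := hI₂.inv.gray_stk v (by simp)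
          rw [← hI₂.inv.chain.1, hb₂] at hg
          exact absurd hg (hf₂.wf hws .stack 0).2
        | nil =>
          refine ⟨_, dn, rest, ?_, ?_, ⟨⟨?_, ?_, ?_⟩, ?_, rfl⟩⟩
          · rw [hf₂.lst .states rfl, ← hl]; simp
          · simp only [Test.cost, Exp.cost] at hk ⊢
            simp [dfsBudget, hnil] at hb hk hn ⊢
            omega
          · simpa using hI₂.pre
          · simpa using hI₂.inv
          · exact hI₂.comp.congr (by simp) (by simp) (by simp) (by simp)
          · simpa using hdn₂
    · simp only [Test.holds, Exp.eval, ha] at hi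
      refine ⟨_, dn, rest, hl, ?_, ⟨⟨?_, ?_, ?_⟩, ?_, rfl⟩⟩
      · simp only [Test.cost, Exp.cost]
        simp [dfsBudget] at hn ⊢
        omega
      · simpa using hI.pre
      · simpa using hI.inv
      · exact hI.comp.congr (by simp) (by simp) (by simp) (by simp)
      · intro x hx
        rcases List.mem_append.1 hx with hx | hx
        · exact hdn x hx
        · simp at hx; rw [hx]; exact hi
  · rintro n' m' k hf w' hk ⟨hI, hdn, -⟩
    have hst : m'.lst .states 0 = V := by rw [hf.lst .states rfl, hV]
    rw [hst] at hdn
    have hscc' : ∀ x ∈ V, m'.arr .scc x ≠ 0 := fun x hx h' => by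
      obtain ⟨g, hg, -⟩ := hI.inv.stk_reach x ((hI.inv.mem_stk x).2 ⟨hdn x hx, h'⟩)
      simp at hg
    refine ⟨?_, ⟨fun x => ⟨fun h' => hI.inv.mem_V x (hI.inv.scc_idx x h'), hscc' x⟩,
      fun x hx y => hI.inv.scc_eq x y (hscc' x hx),
      fun x hx => (hI.comp.mem_sccs _).2 ⟨hscc' x hx, hI.inv.scc_le x⟩, hI.comp⟩⟩
    have e : ∀ x, dfsBudget V adj (m.setReg .root x) [] = dfsBudget V adj m [] := fun _ => rfl
    simp only [Exp.cost, e, hbud, hV] at hk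
    omega

end ReachPart

namespace ReachPart

/-! ## The graph of components -/

theorem SccInv.congr {V : List ℕ} {adj : ℕ → List ℕ} {m m' : Memory} (h : SccInv V adj m)
    (h1 : m'.lst .sccStates = m.lst .sccStates)
    (h2 : m'.lst .sccs = m.lst .sccs) (h3 : m'.arr .scc = m.arr .scc)
    (h4 : m'.reg .numScc = m.reg .numScc) : SccInv V adj m' :=
  ⟨by simpa only [h3] using h.scc_ne, by simpa only [h3] using h.scc_eq,
    by simpa only [h2, h3] using h.scc_mem, h.comp.congr h1 h2 h3 h4⟩

/-- The components partition `V`. This turns the cost of a scan over components, with a scan over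
their states inside, into one sum over states. -/
theorem SccInv.sum_sccStates {V : List ℕ} {adj : ℕ → List ℕ} {m : Memory} (h : SccInv V adj m)
    (hw : m.WF) (f : ℕ → ℕ) :
    ((m.lst .sccs 0).map fun c => ((m.lst .sccStates c).map f).sum).sum =
      ∑ x ∈ V.toFinset, f x := by
  rw [← List.sum_toFinset _ (hw .sccs 0).1]
  have : ∀ x ∈ V.toFinset, m.arr .scc x ∈ (m.lst .sccs 0).toFinset := fun x hx => by
    simpa using h.scc_mem x (by simpa using hx)
  rw [← Finset.sum_fiberwise_of_maps_to this]
  refine Finset.sum_congr rfl fun c hc => ?_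
  rw [← List.sum_toFinset _ (hw .sccStates c).1]
  refine Finset.sum_congr ?_ fun _ _ => rfl
  ext x
  have hc0 := ((h.comp.mem_sccs c).1 (by simpa using hc)).1
  simp only [List.mem_toFinset, h.comp.mem_states, Finset.mem_filter, ← h.scc_ne]
  constructor
  · rintro ⟨h1, h2⟩; exact ⟨h2 ▸ h1, h2⟩
  · rintro ⟨h1, h2⟩; exact ⟨hc0, h2⟩

theorem SccInv.length_sccs_le {V : List ℕ} {adj : ℕ → List ℕ} {m : Memory} (h : SccInv V adj m)
    (hw : m.WF) : (m.lst .sccs 0).length ≤ V.length := by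
  have h1 : m.lst .sccs 0 ⊆ V.map (m.arr .scc) := fun c hc => by
    obtain ⟨x, rfl⟩ := h.comp.exists_mem c hc
    exact List.mem_map_of_mem ((h.scc_ne x).1 ((h.comp.mem_sccs _).1 hc).1)
  simpa using ((hw .sccs 0).1.subperm h1).length_le

theorem sum_map_add_add (l : List ℕ) (a b : ℕ) (g : ℕ → ℕ) :
    (l.map fun x => a + g x + b).sum = (a + b) * l.length + (l.map g).sum := by
  induction l with
  | nil => simp
  | cons x l ih =>
    simp only [List.map_cons, List.sum_cons, ih, List.length_cons]
    ring

/-- The lists `sccPre` are the lists of predecessors in the graph of components. -/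
structure DagInv (V : List ℕ) (adj : ℕ → List ℕ) (m : Memory) : Prop extends SccInv V adj m where
  mem_sccPre : ∀ c ∈ m.lst .sccs 0, ∀ d, d ∈ m.lst .sccPre c ↔
    d ≠ c ∧ ∃ s ∈ m.lst .sccStates c, ∃ p ∈ adj s, m.arr .scc p = d

/-- Each entry comes from an entry of some `adj s` with `s` in the component, and there are no
repetitions. -/
theorem DagInv.length_sccPre_le {V : List ℕ} {adj : ℕ → List ℕ} {m : Memory}
    (h : DagInv V adj m) (hw : m.WF) {c : ℕ} (hc : c ∈ m.lst .sccs 0) :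
    (m.lst .sccPre c).length ≤ ((m.lst .sccStates c).map fun s => (adj s).length).sum := by
  have h1 : m.lst .sccPre c ⊆
      ((m.lst .sccStates c).flatMap fun s => adj s).map (m.arr .scc) := fun d hd => by
    obtain ⟨-, s, hs, p, hp, rfl⟩ := (h.mem_sccPre c hc d).1 hd
    exact List.mem_map_of_mem (List.mem_flatMap.2 ⟨s, hs, hp⟩)
  simpa [List.length_flatMap] using ((hw .sccPre c).1.subperm h1).length_le

/-- A part of the predecessors of the component `c` has been found. -/
structure DagPart (m₀ m : Memory) (c : ℕ) (X : ℕ → Prop) : Prop where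
  other : ∀ c' ≠ c, m.lst .sccPre c' = m₀.lst .sccPre c'
  mark : ∀ d, d ∈ m.lst .sccPre c ↔ m.arr .edgeMark d = c
  mem : ∀ d, d ∈ m.lst .sccPre c ↔ d ≠ c ∧ X d
  old : ∀ i, m.arr .edgeMark i = c ∨ m.arr .edgeMark i = m₀.arr .edgeMark i

theorem DagPart.setReg {m₀ m : Memory} {c : ℕ} {X : ℕ → Prop} (h : DagPart m₀ m c X) (r : Reg)
    (x : ℕ) : DagPart m₀ (m.setReg r x) c X := ⟨h.1, h.2, h.3, h.4⟩

theorem DagPart.congr {m₀ m : Memory} {c : ℕ} {X Y : ℕ → Prop} (h : DagPart m₀ m c X)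
    (hXY : ∀ d, X d ↔ Y d) : DagPart m₀ m c Y := ⟨h.1, h.2, by simpa only [← hXY] using h.3, h.4⟩

/-- The mark of `d` is the component for which `d` was recorded last. It never has to be erased:
before the round of `c`, every mark is `0` or an earlier component. In the counts, 9 is the overhead
8 of a scan plus the closing `skip`, and 40 covers 30 for the innermost body plus 8 for passing to
the next predecessor. -/
theorem wp_buildDag {V : List ℕ} {adj : ℕ → List ℕ} {m : Memory} (hG : IsGraph V adj)
    (h : SccInv V adj m) (hw : m.WF) (hpre : m.lst .pre = adj)
    (hsp : ∀ c, m.lst .sccPre c = []) (hem : ∀ i, m.arr .edgeMark i = 0) :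
    Wp Cmd.buildDag m fun m' k =>
      k ≤ 50 * V.length + 50 * ∑ x ∈ V.toFinset, (adj x).length + 10 ∧ DagInv V adj m' := by
  unfold Cmd.buildDag
  refine wp_scan_static (fun m₁ dn => (∀ c, c ∉ dn → m₁.lst .sccPre c = []) ∧
      (∀ c ∈ dn, ∀ d, d ∈ m₁.lst .sccPre c ↔
        d ≠ c ∧ ∃ s ∈ m.lst .sccStates c, ∃ p ∈ adj s, m.arr .scc p = d) ∧
      ∀ i, m₁.arr .edgeMark i = 0 ∨ m₁.arr .edgeMark i ∈ dn)
    (fun c => 9 + ((m.lst .sccStates c).map fun s => 9 + 40 * (adj s).length + 8).sum)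
    0 hw (fun _ _ => rfl) rfl rfl (fun m' y dn h => h) (by simp [hsp, hem]) ?_ ?_
  · rintro m₁ dn c rest hf w₁ hl hc ⟨h1, h2, h3⟩
    have hcs : c ∈ m.lst .sccs 0 := by rw [hl]; simp
    have hcdn : c ∉ dn := by
      have := (hw .sccs 0).1
      rw [hl, List.nodup_append] at this
      exact fun h => this.2.2 c h c (by simp) rfl
    have hc0 : c ≠ 0 := fun h => (hw .sccs 0).2 (h ▸ hcs)
    have hst₁ : m₁.lst .sccStates = m.lst .sccStates := hf.lst _ rfl
    have hsc₁ : m₁.arr .scc = m.arr .scc := hf.arr _ rfl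
    have hpre₁ : m₁.lst .pre = adj := (hf.lst _ rfl).trans hpre
    rw [wp_block_cons]
    refine wp_scan_static (fun m₂ dn₂ => DagPart m₁ m₂ c
        fun d => ∃ s ∈ dn₂, ∃ p ∈ adj s, m.arr .scc p = d)
      (fun s => 9 + 40 * (adj s).length) c w₁
      (fun m' hf' => (hf'.reg .c rfl).trans hc) rfl rfl (fun m' y dn h => h.setReg _ _) ?_ ?_ ?_
    · refine ⟨fun _ _ => rfl, fun d => ?_, fun d => ?_, fun i => .inr rfl⟩
      · rw [h1 c hcdn]
        rcases h3 d with h' | h'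
        · simp [h', hc0.symm]
        · simpa using fun e : m₁.arr .edgeMark d = c => hcdn (e ▸ h')
      · simp [h1 c hcdn]
    · rintro m₂ dn₂ s rest₂ hf₂ w₂ hl₂ hs hD₂
      have hsc₂ : m₂.arr .scc = m.arr .scc := (hf₂.arr _ rfl).trans hsc₁
      have hpre₂ : m₂.lst .pre = adj := (hf₂.lst _ rfl).trans hpre₁
      have hc₂ : m₂.reg .c = c := (hf₂.reg .c rfl).trans hc
      rw [wp_block_cons]
      refine wp_scan_static (fun m₃ dn₃ => DagPart m₁ m₃ c
          fun d => (∃ s ∈ dn₂, ∃ p ∈ adj s, m.arr .scc p = d) ∨ ∃ p ∈ dn₃, m.arr .scc p = d)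
        (fun _ => 30) s w₂
        (fun m' hf' => (hf'.reg .s rfl).trans hs) rfl rfl (fun m' y dn h => h.setReg _ _)
        (hD₂.congr (by simp)) ?_ ?_
      · rintro m₃ dn₃ p rest₃ hf₃ w₃ hl₃ hp hD₃
        have hsc₃ : m₃.arr .scc = m.arr .scc := (hf₃.arr _ rfl).trans hsc₂
        have hc₃ : m₃.reg .c = c := (hf₃.reg .c rfl).trans hc₂
        have hpV : p ∈ V := hG.adj_mem s p (by rw [← hpre₂, hl₃]; simp)
        have hp0 : m.arr .scc p ≠ 0 := (h.scc_ne p).2 hpV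
        simp only [wp_block_cons, wp_block_nil, wp_assign, wp_when, wp_store, wp_append, Exp.eval,
          Exp.cost, Test.cost, Test.holds, Memory.setReg_reg, Memory.setReg_arr, Memory.setReg_lst,
          Memory.setArr_reg, Memory.setArr_lst, if_true, if_false, reduceCtorEq, hp, hsc₃, hc₃]
        refine ⟨fun hd => ⟨fun hm => ⟨hp0, ?_, by omega, ?_⟩, fun hm => ⟨by omega, ?_⟩⟩,
          fun hd => ⟨by omega, ?_⟩⟩
        · rwa [hD₃.mark]
        · refine ⟨fun c' hc' => ?_, fun d => ?_, fun d => ?_, fun i => ?_⟩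
          · simpa [hc'] using hD₃.other c' hc'
          · by_cases hdp : d = m.arr .scc p
            · simp [hdp]
            · simpa [hdp] using hD₃.mark d
          · by_cases hdp : d = m.arr .scc p
            · subst hdp
              simp [hd]
            · simpa [hdp, or_and_right, exists_or, Ne.symm hdp] using hD₃.mem d
          · by_cases hdp : i = m.arr .scc p
            · simp [hdp]
            · simpa [hdp] using hD₃.old i
        · refine (hD₃.setReg _ _).congr fun d => ?_
          rw [not_not, ← hD₃.mark, hD₃.mem] at hm
          constructor
          · rintro (h' | ⟨p', h', e⟩)
            · exact .inl h'
            · exact .inr ⟨p', by simp [h'], e⟩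
          · rintro (h' | ⟨p', h', e⟩)
            · exact .inl h'
            · rcases List.mem_append.1 h' with h' | h'
              · exact .inr ⟨p', h', e⟩
              · simp at h'
                rw [← e, h']
                exact hm.2
        · refine ⟨hD₃.other, hD₃.mark, fun d => (hD₃.mem d).trans ?_, hD₃.old⟩
          rw [not_not] at hd
          simp only [List.mem_append, List.mem_singleton, or_and_right, exists_or, exists_eq_left,
            hd]
          constructor
          · rintro ⟨h', h''⟩
            exact ⟨h', h''.imp_right .inl⟩
          · rintro ⟨h', h''⟩
            exact ⟨h', h''.imp_right fun h => h.resolve_right (Ne.symm h')⟩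
      · rintro m₃ k hf₃ w₃ hk hD₃
        rw [wp_block_nil]
        simp only [hpre₂, Exp.cost, List.map_const', List.sum_replicate, smul_eq_mul] at hk hD₃
        refine ⟨by omega, hD₃.congr fun d => ?_⟩
        simp only [List.mem_append, List.mem_singleton, or_and_right, exists_or, exists_eq_left]
    · rintro m₂ k hf₂ w₂ hk hD₂
      rw [wp_block_nil]
      simp only [hst₁, Exp.cost] at hk hD₂
      refine ⟨?_, fun c' hc' => ?_, fun c' hc' => ?_, fun i => ?_⟩
      · rw [sum_map_add_add] at hk ⊢
        rw [Nat.add_mul] at hk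
        omega
      · simp only [List.mem_append, List.mem_singleton, not_or] at hc'
        rw [hD₂.other c' hc'.2, h1 c' hc'.1]
      · intro d
        by_cases e : c' = c
        · rw [e]; exact hD₂.mem d
        · rw [hD₂.other c' e, h2 c' (by simpa [e] using hc')]
      · rcases hD₂.old i with e | e
        · simp [e]
        · rw [e]; simp only [List.mem_append]
          have := h3 i
          tauto
  · rintro m' k hf w' hk ⟨h1, h2, h3⟩
    have hst' : m'.lst .sccStates = m.lst .sccStates := hf.lst _ rfl
    have hsc' : m'.arr .scc = m.arr .scc := hf.arr _ rfl
    have hss' : m'.lst .sccs = m.lst .sccs := hf.lst _ rfl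
    refine ⟨?_, h.congr hst' hss' hsc' (hf.reg _ rfl), ?_⟩
    · have h5 := h.sum_sccStates hw (fun s => 9 + 40 * (adj s).length + 8)
      have h6 := h.length_sccs_le hw
      have h7 : V.toFinset.card ≤ V.length := V.toFinset_card_le
      simp only [sum_map_add_add (g := fun c =>
        ((m.lst .sccStates c).map fun s => 9 + 40 * (adj s).length + 8).sum), h5, Exp.cost,
        Finset.sum_add_distrib, Finset.sum_const, smul_eq_mul, ← Finset.mul_sum] at hk
      omega
    · rw [hss', hst', hsc']; exact h2

end ReachPart

namespace ReachPart

/-! ## The computation of `EF` of a block -/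

theorem wp_computeScc {V : List ℕ} {adj : ℕ → List ℕ} {m : Memory}
    (hG : IsGraph V adj) (hw : m.WF) (hV : m.lst .states 0 = V) (hpre : m.lst .pre = adj)
    (hidx : ∀ x, m.arr .index x = 0) (hitr : ∀ x, m.arr .iter x = 0)
    (hscc : ∀ x, m.arr .scc x = 0) (hstk : m.lst .stack 0 = []) (hsccs : m.lst .sccs 0 = [])
    (hsts : ∀ c, m.lst .sccStates c = []) (hns : m.reg .numScc = 0) (hv : m.reg .v = 0)
    (hsp : ∀ c, m.lst .sccPre c = []) (hem : ∀ i, m.arr .edgeMark i = 0) :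
    Wp Cmd.computeScc m fun m' k =>
      k ≤ 350 * V.length + 150 * ∑ x ∈ V.toFinset, (adj x).length + 30 ∧ DagInv V adj m' := by
  unfold Cmd.computeScc
  rw [wp_block_cons]
  refine (wp_tarjan hG hw hV hpre hidx hitr hscc hstk hsccs hsts hns hv).mono ?_
  rintro m₁ k₁ hf₁ ⟨hk₁, h₁⟩
  rw [wp_block_cons]
  refine (wp_buildDag hG h₁ (hf₁.wf hw) ((hf₁.lst _ rfl).trans hpre)
    (by rw [hf₁.lst .sccPre rfl]; exact hsp) (by rw [hf₁.arr .edgeMark rfl]; exact hem)).mono ?_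
  rintro m₂ k₂ hf₂ ⟨hk₂, h₂⟩
  rw [wp_block_nil]
  exact ⟨by omega, h₂⟩

/-- Marks left by earlier rounds are smaller than `stamp`, so they count as absent. Afterwards they
are at most `stamp`, which becomes strict again when the next round increases it. -/
theorem wp_computeBscc {V : List ℕ} {adj : ℕ → List ℕ} {m : Memory} (h : SccInv V adj m)
    (hw : m.WF) (hM : ∀ x ∈ m.lst .members (m.reg .B), x ∈ V)
    (hs : ∀ i, m.arr .inBscc i < m.reg .stamp) :
    Wp Cmd.computeBscc m fun m' k => k ≤ 50 * (m.lst .members (m.reg .B)).length + 20 ∧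
      (∀ c, c ∈ m'.lst .bscc 0 ↔ ∃ s ∈ m.lst .members (m.reg .B), m.arr .scc s = c) ∧
      ∀ i, m'.arr .inBscc i ≤ m.reg .stamp := by
  unfold Cmd.computeBscc
  simp only [wp_block_cons, wp_clear, wp_block_nil, Exp.eval, Exp.cost]
  refine wp_scan_static (fun m₁ dn => (∀ c, c ∈ m₁.lst .bscc 0 ↔ ∃ s ∈ dn, m.arr .scc s = c) ∧
      (∀ c, m₁.arr .inBscc c = m.reg .stamp ↔ c ∈ m₁.lst .bscc 0) ∧
      ∀ i, m₁.arr .inBscc i ≤ m.reg .stamp)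
    (fun _ => 30) (m.reg .B) (hw.setLst _ _ (by simp) (by simp)) ?_ rfl rfl
    (fun m' y dn h => h) ?_ ?_ ?_
  · intro m' hf
    exact hf.reg .B rfl
  · refine ⟨by simp, ?_, fun i => (hs i).le⟩
    intro c
    simpa using (hs c).ne
  · rintro m₁ dn s rest hf w₁ hl hs₁ ⟨h1, h2, h3⟩
    have hsc : m₁.arr .scc = m.arr .scc := hf.arr _ rfl
    have hst : m₁.reg .stamp = m.reg .stamp := hf.reg _ rfl
    have hsV : s ∈ V := hM s (by simp at hl; rw [hl]; simp)
    have hs0 := (h.scc_ne s).2 hsV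
    simp only [wp_block_cons, wp_block_nil, wp_assign, wp_when, wp_store, wp_append, Exp.eval,
      Exp.cost, Test.cost, Test.holds, Memory.setReg_reg, Memory.setReg_arr, Memory.setReg_lst,
      Memory.setArr_reg, Memory.setArr_lst, if_true, if_false, reduceCtorEq, hs₁, hsc, hst]
    refine ⟨fun hne => ⟨hs0, ?_, by omega, ?_, ?_, ?_⟩, fun he => ⟨by omega, ?_, ?_, h3⟩⟩
    · rwa [← h2]
    · intro c
      simp [h1, or_and_right, exists_or, eq_comm]
    · intro c
      by_cases hc : c = m.arr .scc s
      · simp [hc]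
      · simpa [hc] using h2 c
    · intro i
      by_cases hc : i = m.arr .scc s
      · simp [hc]
      · simpa [hc] using h3 i
    · intro c
      rw [not_not, h2, h1] at he
      refine (h1 c).trans ⟨fun ⟨x, hx, e⟩ => ⟨x, by simp [hx], e⟩, ?_⟩
      rintro ⟨x, hx, rfl⟩
      rcases List.mem_append.1 hx with hx | hx
      · exact ⟨x, hx, rfl⟩
      · simp at hx; rw [hx]; exact he
    · exact h2
  · rintro m' k hf w' hk ⟨h1, h2, h3⟩
    simp [Exp.cost] at hk
    exact ⟨by omega, by simpa using h1, h3⟩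

/-- The invariant of the search in the graph of components. -/
structure SearchInv (adj : ℕ → List ℕ) (M sccs : List ℕ) (scc : ℕ → ℕ) (t : ℕ) (m : Memory) :
    Prop where
  sound : ∀ c ∈ m.lst .result 0, c ∈ sccs ∧ ∃ y ∈ M, ∃ x, scc x = c ∧ Reach adj y x
  mark : ∀ c, m.arr .mark c = t ↔ c ∈ m.lst .result 0
  mark_le : ∀ c, m.arr .mark c ≤ t

theorem SearchInv.setReg {adj : ℕ → List ℕ} {M sccs : List ℕ} {scc : ℕ → ℕ} {t : ℕ} {m : Memory}
    (h : SearchInv adj M sccs scc t m) (r : Reg) (x : ℕ) :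
    SearchInv adj M sccs scc t (m.setReg r x) := ⟨h.1, h.2, h.3⟩

theorem SearchInv.add {adj : ℕ → List ℕ} {M sccs : List ℕ} {scc : ℕ → ℕ} {t : ℕ}
    {m m' : Memory} {d : ℕ} (h : SearchInv adj M sccs scc t m)
    (hd : d ∈ sccs ∧ ∃ y ∈ M, ∃ x, scc x = d ∧ Reach adj y x)
    (hr : m'.lst .result 0 = m.lst .result 0 ++ [d])
    (hm : m'.arr .mark = Function.update (m.arr .mark) d t) :
    SearchInv adj M sccs scc t m' := by
  constructor
  · intro c hc
    rw [hr, List.mem_append, List.mem_singleton] at hc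
    rcases hc with hc | rfl
    · exact h.sound c hc
    · exact hd
  · intro c
    rw [hr, hm]
    by_cases hc : c = d
    · simp [hc]
    · simpa [hc] using h.mark c
  · intro c
    rw [hm]
    by_cases hc : c = d
    · simp [hc]
    · simpa [hc] using h.mark_le c

/-- The list `result` is also the queue of the search: it is scanned while new components are
appended behind the current one. It has no repetitions, so each component is scanned once and the
budget can be a sum over the components not yet scanned. At the end the list is closed under
predecessors, and completeness follows by induction along a path. -/
theorem wp_computeEF {V : List ℕ} {adj : ℕ → List ℕ} {m : Memory} {M : List ℕ}
    (hG : IsGraph V adj) (h : DagInv V adj m) (hw : m.WF) (hM : ∀ x ∈ M, x ∈ V)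
    (hb : ∀ c, c ∈ m.lst .bscc 0 ↔ ∃ s ∈ M, m.arr .scc s = c)
    (hs : ∀ i, m.arr .mark i < m.reg .stamp) :
    Wp Cmd.computeEF m fun m' k =>
      k ≤ 100 * V.length + 50 * ∑ x ∈ V.toFinset, (adj x).length + 30 ∧
      (∀ x ∈ V, m.arr .scc x ∈ m'.lst .result 0 ↔ ∃ y ∈ M, Reach adj y x) ∧
      (∀ c ∈ m'.lst .result 0, c ∈ m.lst .sccs 0) ∧ ∀ i, m'.arr .mark i ≤ m.reg .stamp := by
  have hbs : ∀ c ∈ m.lst .bscc 0, c ∈ m.lst .sccs 0 ∧ ∃ y ∈ M, ∃ x, m.arr .scc x = c ∧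
      Reach adj y x := fun c hc => by
    obtain ⟨s, hs, rfl⟩ := (hb c).1 hc
    exact ⟨h.scc_mem s (hM s hs), s, hs, s, rfl, .refl⟩
  unfold Cmd.computeEF
  simp only [wp_block_cons, wp_clear, wp_block_nil, Exp.eval, Exp.cost]
  refine wp_scan_static (fun m₁ dn => m₁.lst .result 0 = dn ∧
      SearchInv adj M (m.lst .sccs 0) (m.arr .scc) (m.reg .stamp) m₁)
    (fun _ => 20) 0 (hw.setLst _ _ (by simp) (by simp)) (fun _ _ => rfl) rfl rfl
    (fun m' y dn h => ⟨h.1, h.2.setReg _ _⟩) ?_ ?_ ?_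
  · refine ⟨by simp, by simp, ?_, fun i => (hs i).le⟩
    intro c
    simpa using (hs c).ne
  · rintro m₁ dn c rest hf w₁ hl hc₁ ⟨h1, h2⟩
    have hst : m₁.reg .stamp = m.reg .stamp := hf.reg _ rfl
    have hcb : c ∈ m.lst .bscc 0 := by simp at hl; rw [hl]; simp
    have hcd : c ∉ dn := by
      have := (hw .bscc 0).1
      simp at hl
      rw [hl, List.nodup_append] at this
      exact fun h => this.2.2 c h c (by simp) rfl
    simp only [wp_block_cons, wp_block_nil, wp_store, wp_append, Exp.eval,
      Exp.cost, Memory.setLst_reg, hc₁, h1, hst]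
    refine ⟨fun h => (hw .bscc 0).2 (h ▸ hcb), hcd, by omega, by simp, ?_⟩
    exact h2.add (hbs c hcb) (by simp [h1]) (by simp)
  · rintro m₁ k₁ hf₁ w₁ hk₁ ⟨hr₁, hS₁⟩
    simp only [Memory.setLst_lst, reduceCtorEq, if_false, List.map_const', List.sum_replicate,
      smul_eq_mul, Exp.cost] at hk₁ hr₁
    have hsc₁ : m₁.arr .scc = m.arr .scc := hf₁.arr _ rfl
    have hss₁ : m₁.lst .sccs = m.lst .sccs := hf₁.lst .sccs rfl
    have hsp₁ : m₁.lst .sccPre = m.lst .sccPre := hf₁.lst .sccPre rfl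
    have hst₁ : m₁.reg .stamp = m.reg .stamp := hf₁.reg _ rfl
    have hbl : (m.lst .bscc 0).length ≤ V.length :=
      ((hw .bscc 0).1.subperm fun c hc => (hbs c hc).1).length_le.trans
        (h.length_sccs_le hw)
    refine wp_scan (fun n m₂ dn rest =>
        SearchInv adj M (m.lst .sccs 0) (m.arr .scc) (m.reg .stamp) m₂ ∧
        (∀ c ∈ m.lst .bscc 0, c ∈ m₂.lst .result 0) ∧
        (∀ c ∈ dn, ∀ d ∈ m.lst .sccPre c, d ∈ m₂.lst .result 0) ∧
        n = ∑ c ∈ (m.lst .sccs 0).toFinset \ dn.toFinset, (20 + 40 * (m.lst .sccPre c).length))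
      0 _ w₁ (fun _ _ => rfl) rfl ⟨hS₁.setReg _ _, by simp [hr₁], by simp, rfl⟩ ?_ ?_
    · rintro n m₂ dn c rest hf₂ w₂ hl₂ hc₂ ⟨hS₂, hb₂, hd₂, hn⟩
      have hst₂ : m₂.reg .stamp = m.reg .stamp := (hf₂.reg _ rfl).trans hst₁
      have hsc₂ : m₂.arr .scc = m.arr .scc := (hf₂.arr _ rfl).trans hsc₁
      have hsp₂ : m₂.lst .sccPre = m.lst .sccPre := (hf₂.lst _ rfl).trans hsp₁
      have hcr : c ∈ m₂.lst .result 0 := by rw [hl₂]; simp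
      have hcs := hS₂.sound c hcr
      have hcd : c ∉ dn := by
        have := (w₂ .result 0).1
        rw [hl₂, List.nodup_append] at this
        exact fun h => this.2.2 c h c (by simp) rfl
      rw [wp_block_cons]
      refine wp_scan_static (fun m₃ dn₃ =>
          SearchInv adj M (m.lst .sccs 0) (m.arr .scc) (m.reg .stamp) m₃ ∧
          (∃ ext, m₃.lst .result 0 = m₂.lst .result 0 ++ ext) ∧
          ∀ d ∈ dn₃, d ∈ m₃.lst .result 0)
        (fun _ => 25) c w₂ (fun m' hf' => (hf'.reg .c rfl).trans hc₂) rfl rfl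
        (fun m' y dn h => ⟨h.1.setReg _ _, h.2⟩) ⟨hS₂, ⟨[], by simp⟩, by simp⟩ ?_ ?_
      · rintro m₃ dn₃ d rest₃ hf₃ w₃ hl₃ hd₃ ⟨hS₃, ⟨ext, he⟩, hr₃⟩
        have hst₃ : m₃.reg .stamp = m.reg .stamp := (hf₃.reg _ rfl).trans hst₂
        have hdp : d ∈ m.lst .sccPre c := by rw [← hsp₂, hl₃]; simp
        obtain ⟨-, s, hs, p, hp, hpd⟩ := (h.mem_sccPre c hcs.1 d).1 hdp
        obtain ⟨hc0, hsc⟩ := (h.comp.mem_states c s).1 hs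
        simp only [wp_block_cons, wp_block_nil, wp_when, wp_store, wp_append, Exp.eval,
          Exp.cost, Test.cost, Test.holds, Memory.setLst_reg, hd₃, hst₃]
        refine ⟨fun hne => ⟨?_, ?_, by omega, ?_, ⟨ext ++ [d], by simp [he]⟩, ?_⟩,
          fun hne => ⟨by omega, hS₃, ⟨ext, he⟩, ?_⟩⟩
        · exact fun h => (hw .sccPre c).2 (h ▸ hdp)
        · rwa [← hS₃.mark]
        · refine hS₃.add (d := d) ⟨?_, ?_⟩ (by simp) (by simp)
          · exact hpd ▸ h.scc_mem p (hG.adj_mem s p hp)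
          · obtain ⟨-, y, hy, x, hx, hR⟩ := hcs
            have hxV : x ∈ V := (h.scc_ne x).1 (hx ▸ hc0)
            -- From the witness `x` one goes to `s` inside the component, then along the edge to
            -- `p`.
            exact ⟨y, hy, p, hpd, (hR.trans ((h.scc_eq x hxV s).1 (hx.trans hsc.symm)).1).tail hp⟩
        · intro d' hd'
          rcases List.mem_append.1 hd' with hd' | hd'
          · simp [hr₃ d' hd']
          · simp at hd'
            simp [hd']
        · intro d' hd'
          rcases List.mem_append.1 hd' with hd' | hd'
          · exact hr₃ d' hd'
          · simp at hd'
            rw [hd', ← hS₃.mark]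
            exact not_not.1 hne
      · rintro m₃ k₃ hf₃ w₃ hk₃ ⟨hS₃, ⟨ext, he⟩, hr₃⟩
        rw [wp_block_nil]
        have hmono : ∀ x ∈ m₂.lst .result 0, x ∈ m₃.lst .result 0 := fun x hx => by
          rw [he]; simp [hx]
        refine ⟨_, dn, rest ++ ext, by rw [he, hl₂]; simp, ?_, hS₃.setReg _ _,
          fun c hc => hmono c (hb₂ c hc), fun c' hc' d hd => ?_, rfl⟩
        · have hcm : c ∈ (m.lst .sccs 0).toFinset \ dn.toFinset := by simp [hcs.1, hcd]
          have e : (m.lst .sccs 0).toFinset \ (dn ++ [c]).toFinset =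
              ((m.lst .sccs 0).toFinset \ dn.toFinset).erase c := by
            ext x
            simp
            tauto
          rw [← Finset.add_sum_erase _ _ hcm] at hn
          rw [e]
          simp only [hsp₂, List.map_const', List.sum_replicate, smul_eq_mul, Exp.cost] at hk₃ ⊢
          omega
        · rcases List.mem_append.1 hc' with hc' | hc'
          · exact hmono d (hd₂ c' hc' d hd)
          · simp at hc'
            subst hc'
            exact hr₃ d (by rwa [hsp₂])
    · rintro n' m' k hf' w' hk ⟨hS', hb', hd', -⟩
      refine ⟨?_, fun x hx => ⟨fun hr => ?_, ?_⟩, fun c hc => (hS'.sound c hc).1, hS'.mark_le⟩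
      · have h1 : ∑ c ∈ (m.lst .sccs 0).toFinset, (20 + 40 * (m.lst .sccPre c).length) ≤
            20 * V.length + 40 * ∑ x ∈ V.toFinset, (adj x).length := by
          rw [← h.sum_sccStates hw, ← List.sum_toFinset _ (hw .sccs 0).1,
            Finset.sum_add_distrib, ← Finset.mul_sum, Finset.sum_const, smul_eq_mul]
          have h2 := h.length_sccs_le hw
          have h3 := List.toFinset_card_le (m.lst .sccs 0)
          have h4 := Finset.sum_le_sum fun c (hc : c ∈ (m.lst .sccs 0).toFinset) =>
            h.length_sccPre_le hw (c := c) (by simpa using hc)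
          omega
        have h5 := Finset.sum_le_sum_of_subset (f := fun c => 20 + 40 * (m.lst .sccPre c).length)
          (Finset.sdiff_subset (s := (m.lst .sccs 0).toFinset) (t := ([] : List ℕ).toFinset))
        simp only [Exp.cost] at hk
        omega
      · obtain ⟨hs, y, hy, x', hx', hR⟩ := hS'.sound _ hr
        have hx'V : x' ∈ V := (h.scc_ne x').1 (hx' ▸ (h.scc_ne x).2 hx)
        exact ⟨y, hy, hR.trans ((h.scc_eq x' hx'V x).1 hx').1⟩
      · rintro ⟨y, hy, hR⟩
        clear hx
        induction hR with
        | refl => exact hb' _ ((hb _).2 ⟨y, hy, rfl⟩)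
        | @tail b c _ hbc ih =>
          have hs := (hS'.sound _ ih).1
          -- An edge either stays in its component or gives an edge of the graph of components.
          by_cases e : m.arr .scc c = m.arr .scc b
          · rwa [e]
          · refine hd' _ ih _ ((h.mem_sccPre _ hs _).2 ⟨e, b, ?_, c, hbc, rfl⟩)
            exact (h.comp.mem_states _ _).2 ⟨((h.comp.mem_sccs _).1 hs).1, rfl⟩

/-- Different components are disjoint, so no state is appended twice and `append` is never stuck. -/
theorem wp_unionEF {V : List ℕ} {adj : ℕ → List ℕ} {m : Memory}
    (h : SccInv V adj m) (hw : m.WF) (hr : ∀ c ∈ m.lst .result 0, c ∈ m.lst .sccs 0) :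
    Wp Cmd.unionEF m fun m' k => k ≤ 50 * V.length + 30 ∧
      ∀ x, x ∈ m'.lst .ef 0 ↔ x ∈ V ∧ m.arr .scc x ∈ m.lst .result 0 := by
  unfold Cmd.unionEF
  simp only [wp_block_cons, wp_clear, wp_block_nil, Exp.eval, Exp.cost]
  refine wp_scan_static (fun m₁ dn => ∀ x, x ∈ m₁.lst .ef 0 ↔ x ∈ V ∧ m.arr .scc x ∈ dn)
    (fun c => 9 + 15 * (m.lst .sccStates c).length)
    0 (hw.setLst _ _ (by simp) (by simp)) (fun _ _ => rfl) rfl rfl (fun m' y dn h => h)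
    (by simp) ?_ ?_
  · rintro m₁ dn c rest hf w₁ hl hc₁ h1
    have hl' : m.lst .result 0 = dn ++ c :: rest := by simpa using hl
    have hst : m₁.lst .sccStates = m.lst .sccStates := hf.lst .sccStates rfl
    have hcd : c ∉ dn := by
      have := (hw .result 0).1
      rw [hl', List.nodup_append] at this
      exact fun h => this.2.2 c h c (by simp) rfl
    rw [wp_block_cons]
    refine wp_scan_static (fun m₂ dn₂ => ∀ x, x ∈ m₂.lst .ef 0 ↔
        (x ∈ V ∧ m.arr .scc x ∈ dn) ∨ x ∈ dn₂)
      (fun _ => 7) c w₁ (fun m' hf' => (hf'.reg .c rfl).trans hc₁) rfl rfl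
      (fun m' y dn h => h) (by simpa using h1) ?_ ?_
    · rintro m₂ dn₂ s rest₂ hf₂ w₂ hl₂ hs₂ h2
      rw [hst] at hl₂
      have hs : s ∈ m.lst .sccStates c := by rw [hl₂]; simp
      have hsd : s ∉ dn₂ := by
        have := (hw .sccStates c).1
        rw [hl₂, List.nodup_append] at this
        exact fun h => this.2.2 s h s (by simp) rfl
      simp only [wp_block_cons, wp_block_nil, wp_append, Exp.eval, Exp.cost, hs₂]
      refine ⟨fun h => (hw .sccStates c).2 (h ▸ hs), ?_, by omega, ?_⟩
      · rw [h2]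
        rintro (⟨-, h'⟩ | h')
        · exact hcd (((h.comp.mem_states c s).1 hs).2 ▸ h')
        · exact hsd h'
      · intro x
        simp [h2, or_assoc]
    · rintro m₂ k₂ hf₂ w₂ hk₂ h2
      rw [wp_block_nil]
      simp only [hst, List.map_const', List.sum_replicate, smul_eq_mul, Exp.cost] at hk₂ h2
      refine ⟨by omega, fun x => ?_⟩
      have hcs := (h.comp.mem_sccs c).1 (hr c (by rw [hl']; simp))
      rw [h2, h.comp.mem_states, ← h.scc_ne]
      simp only [List.mem_append, List.mem_singleton]
      constructor
      · rintro (⟨h1, h2⟩ | ⟨h1, h2⟩)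
        · exact ⟨h1, .inl h2⟩
        · exact ⟨h2 ▸ h1, .inr h2⟩
      · rintro ⟨h1, h2 | h2⟩
        · exact .inl ⟨h1, h2⟩
        · exact .inr ⟨hcs.1, h2⟩
  · rintro m' k hf' w' hk h1
    refine ⟨?_, by simpa using h1⟩
    simp only [Memory.setLst_lst, reduceCtorEq, if_false, Exp.cost, sum_map_add_add] at hk
    have h2 : ((m.lst .result 0).map fun c => 15 * (m.lst .sccStates c).length).sum ≤
        ((m.lst .sccs 0).map fun c => 15 * (m.lst .sccStates c).length).sum := by
      rw [← List.sum_toFinset _ (hw .sccs 0).1, ← List.sum_toFinset _ (hw .result 0).1]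
      exact Finset.sum_le_sum_of_subset fun c hc => by
        simpa using hr c (by simpa using hc)
    have h3 := h.sum_sccStates hw fun _ => 15
    simp only [List.map_const', List.sum_replicate, smul_eq_mul, Finset.sum_const] at h3
    simp only [mul_comm _ 15] at h3
    have h4 := V.toFinset_card_le
    have h5 := ((hw .result 0).1.subperm hr).length_le.trans (h.length_sccs_le hw)
    omega

end ReachPart

namespace ReachPart

/-! ## Splitting the partition: the final scan -/

theorem erase_append_cons {l r : List ℕ} {a : ℕ} (h : a ∉ l) :
    (l ++ a :: r).erase a = l ++ r := by
  rw [List.erase_append_right _ h, List.erase_cons_head]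

/-- The final scan of `Cmd.splitBlocks`, which resets the flags of the blocks. -/
abbrev resetFlags : Cmd :=
  .while (.ne (.reg .D) (.num 0)) (Cmd.block [
    Cmd.next .t .blocks (.num 0) (.reg .D),
    Cmd.store .inter (.reg .D) (.num 0),
    Cmd.when (.eq (.arr .split (.reg .D)) (.num 1)) [
      Cmd.store .split (.reg .D) (.num 0),
      Cmd.remove .blocks (.num 0) (.reg .D),
      Cmd.append .blocks (.num 0) (.reg .D)],
    Cmd.assign .D (.reg .t)])

/-- A split block is met at most twice: where it stood, and again at the end with its flags reset.
Hence the number of split blocks is added to the length. -/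
theorem wp_resetFlags {m : Memory} (hw : m.WF) (hD : m.reg .D = (m.lst .blocks 0).headD 0)
    (hz : ∀ D ∉ m.lst .blocks 0, m.arr .inter D = 0 ∧ m.arr .split D = 0)
    (h01 : ∀ D, m.arr .split D = 0 ∨ m.arr .split D = 1) :
    Wp resetFlags m fun m' k =>
      k ≤ 4 + 40 * ((m.lst .blocks 0).length +
        ((m.lst .blocks 0).filter (m.arr .split · = 1)).length) ∧
      m'.lst .blocks 0 = (m.lst .blocks 0).filter (m.arr .split · ≠ 1) ++
        (m.lst .blocks 0).filter (m.arr .split · = 1) ∧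
      (∀ i, m'.arr .inter i = 0) ∧ ∀ i, m'.arr .split i = 0 := by
  -- `dn` has been passed, `q` has not been met yet, and `z` consists of blocks already moved to the
  -- end. The order in which everything will finally stand (`dn`, the unsplit part of `q`, `z`, the
  -- split part of `q`) is the same at every round.
  refine wp_while (fun n m₁ => ∃ dn q z, m₁.lst .blocks 0 = dn ++ (q ++ z) ∧
    m₁.reg .D = (q ++ z).headD 0 ∧ (∀ D ∉ q, m₁.arr .inter D = 0 ∧ m₁.arr .split D = 0) ∧
    (∀ D ∈ q, m₁.arr .split D = m.arr .split D) ∧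
    dn ++ q.filter (m.arr .split · ≠ 1) ++ z ++ q.filter (m.arr .split · = 1) =
      (m.lst .blocks 0).filter (m.arr .split · ≠ 1) ++
        (m.lst .blocks 0).filter (m.arr .split · = 1) ∧
    n = 40 * (q.length + (q.filter (m.arr .split · = 1)).length + z.length))
    ⟨[], m.lst .blocks 0, [], by simp, by simpa using hD, hz, by simp, by simp, rfl⟩ ?_ ?_
  · rintro n m₁ hf ⟨dn, q, z, hl, hr, hz₁, hq, hT, hn⟩ hb
    have w₁ := hf.wf hw
    have hnd := (w₁ .blocks 0).1
    rw [hl] at hnd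
    have h0 : 0 ∉ q ++ z := fun h => (w₁ .blocks 0).2 (by rw [hl]; exact List.mem_append.2 (.inr h))
    simp only [Test.holds, Exp.eval, hr] at hb
    obtain ⟨a, r, har⟩ := List.exists_cons_of_ne_nil ((headD_ne_zero h0).1 hb)
    rw [har] at hl hnd hr
    simp only [List.headD_cons] at hr
    have ha0 : a ≠ 0 := fun h => h0 (by rw [har, h]; simp)
    have had : a ∉ dn := fun h => (List.nodup_append.1 hnd).2.2 a h a (by simp) rfl
    have har' : a ∉ r := (List.nodup_cons.1 (List.nodup_append.1 hnd).2.1).1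
    have hlr : r.headD 0 = 0 → r = [] := fun h => by
      by_contra hne
      exact (headD_ne_zero (fun h' => h0 (by rw [har]; simp [h']))).2 hne h
    simp only [wp_block_cons, wp_block_nil, wp_assign, wp_next, wp_when, wp_store, wp_remove,
      wp_append, Exp.eval, Exp.cost, Test.cost, Test.holds, Memory.setReg_reg, Memory.setReg_arr,
      Memory.setReg_lst, Memory.setArr_reg, Memory.setArr_arr, Memory.setArr_lst,
      Memory.setLst_reg, Memory.setLst_lst, if_true, if_false, reduceCtorEq, hr, hl,
      nextIn_append_cons had, Function.update_self, erase_append_cons had]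
    refine ⟨by simp, fun hs => ⟨by simp, ha0, by simp [had, har'], ?_⟩, fun hs => ?_⟩
    · cases q with
      | nil => have := hz₁ a (by simp); omega
      | cons b q =>
        simp only [List.cons_append, List.cons.injEq] at har
        obtain ⟨rfl, rfl⟩ := har
        have hsa : m.arr .split b = 1 := by rw [← hq b (by simp)]; exact hs
        have hbq : b ∉ q := fun h => har' (by simp [h])
        simp only [List.filter_cons, hsa, ne_eq, not_true_eq_false, decide_false, decide_true,
          Bool.false_eq_true, if_false, if_true, List.length_cons] at hT hn
        have hzero : ∀ D ∉ q, (if D = b then 0 else m₁.arr .inter D) = 0 ∧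
            (if D = b then 0 else m₁.arr .split D) = 0 := by
          intro D hDq
          by_cases hDb : D = b
          · simp [hDb]
          · simpa [hDb] using hz₁ D (by simp [hDb, hDq])
        -- The successor of `b` was looked up before `b` was moved. If `b` was the last block, that
        -- successor is `0`, the loop ends, and `b` counts as passed.
        by_cases hqz : q ++ z = []
        · obtain ⟨rfl, rfl⟩ := List.append_eq_nil_iff.1 hqz
          refine ⟨0, by omega, dn ++ [b], [], [], by simp, by simp, ?_, by simp,
            by simpa using hT, by simp⟩
          simpa [Function.update_apply] using hzero
        · refine ⟨40 * (q.length + (q.filter (m.arr .split · = 1)).length + (z.length + 1)),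
            by omega, dn, q, z ++ [b], by simp, ?_, ?_, ?_, by simpa using hT, by simp⟩
          · cases q with
            | nil =>
              cases z with
              | nil => simp at hqz
              | cons => simp
            | cons => simp
          · simpa [Function.update_apply] using hzero
          · intro D hDq
            have : D ≠ b := fun e => hbq (e ▸ hDq)
            simpa [this] using hq D (by simp [hDq])
    · cases q with
      | nil =>
        simp only [List.nil_append] at har
        subst har
        simp only [List.filter_nil, List.append_nil, List.length_nil, List.length_cons] at hT hn
        refine ⟨40 * r.length, by omega, dn ++ [a], [], r, by simp, by simp, ?_, by simp,
          by simpa using hT, by simp⟩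
        intro D _
        have := hz₁ D (by simp)
        by_cases hDa : D = a
        · subst hDa; simpa using this.2
        · simpa [hDa] using this
      | cons b q =>
        simp only [List.cons_append, List.cons.injEq] at har
        obtain ⟨rfl, rfl⟩ := har
        have hsa : m.arr .split b = 0 := by
          have := h01 b
          rw [← hq b (by simp)] at this ⊢
          tauto
        have hbq : b ∉ q := fun h => har' (by simp [h])
        simp only [List.filter_cons, hsa, ne_eq, zero_ne_one, not_false_eq_true, decide_false,
          decide_true, Bool.false_eq_true, if_false, if_true, List.length_cons] at hT hn
        refine ⟨40 * (q.length + (q.filter (m.arr .split · = 1)).length + z.length),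
          by omega, dn ++ [b], q, z, by simp, by simp, ?_, ?_, by simpa using hT, by simp⟩
        · intro D hDq
          by_cases hDb : D = b
          · subst hDb
            have := hq D (by simp)
            simp
            omega
          · simpa [hDb] using hz₁ D (by simp [hDb, hDq])
        · intro D hDq
          simpa using hq D (by simp [hDq])
  · rintro n' m' k hf hk ⟨dn, q, z, hl, hr, hz₁, hq, hT, hn⟩ hb
    have w₁ := hf.wf hw
    have h0 : 0 ∉ q ++ z := fun h => (w₁ .blocks 0).2 (by rw [hl]; exact List.mem_append.2 (.inr h))
    simp only [Test.holds, Exp.eval, hr, headD_ne_zero h0, not_not] at hb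
    obtain ⟨rfl, rfl⟩ := List.append_eq_nil_iff.1 hb
    simp only [Test.cost, Exp.cost] at hk
    refine ⟨by omega, ?_, fun i => (hz₁ i (by simp)).1, fun i => (hz₁ i (by simp)).2⟩
    rw [hl, ← hT]
    simp

end ReachPart

namespace ReachPart

/-! ## Splitting the partition: the scan of the splitter -/

/-- The memory holds a partition of the states `V`, and all flags of blocks are reset. -/
structure PartInv (V : List ℕ) (m : Memory) : Prop where
  mem_members : ∀ B ∈ m.lst .blocks 0, ∀ x, x ∈ m.lst .members B ↔ x ∈ V ∧ m.arr .block x = B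
  block_mem : ∀ x ∈ V, m.arr .block x ∈ m.lst .blocks 0
  members_ne : ∀ B ∈ m.lst .blocks 0, m.lst .members B ≠ []
  block_le : ∀ B ∈ m.lst .blocks 0, B ≤ m.reg .numBlk
  fresh : ∀ B, m.reg .numBlk < B → m.lst .members B = []
  inter_eq : ∀ B, m.arr .inter B = 0
  split_eq : ∀ B, m.arr .split B = 0

theorem PartInv.length_blocks_le {V : List ℕ} {m : Memory} (h : PartInv V m) (hw : m.WF) :
    (m.lst .blocks 0).length ≤ V.length := by
  have h1 : m.lst .blocks 0 ⊆ V.map (m.arr .block) := fun B hB => by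
    obtain ⟨x, hx⟩ := List.exists_mem_of_ne_nil _ (h.members_ne B hB)
    obtain ⟨h1, rfl⟩ := (h.mem_members B hB x).1 hx
    exact List.mem_map_of_mem h1
  simpa using ((hw .blocks 0).1.subperm h1).length_le

/-- The states `dn` of the splitter have been processed; `m₀` is the memory before the split.
A block of `m₀` has not been touched, or is being split, or has been emptied and restored. -/
structure SplitPart (V : List ℕ) (m₀ : Memory) (dn : List ℕ) (m : Memory) : Prop where
  num_le : m₀.reg .numBlk ≤ m.reg .numBlk
  blocks : ∃ new, m.lst .blocks 0 = m₀.lst .blocks 0 ++ new ∧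
    ∀ N, N ∈ new ↔ ∃ D ∈ m₀.lst .blocks 0, m.arr .split D = 1 ∧ m.arr .inter D = N
  status : ∀ D ∈ m₀.lst .blocks 0,
    (m.arr .inter D = 0 ∧ m.arr .split D = 0 ∧
      (∀ x, x ∈ m.lst .members D ↔ x ∈ m₀.lst .members D) ∧ ∀ x ∈ m₀.lst .members D, x ∉ dn) ∨
    (m.arr .inter D ≠ 0 ∧ m.arr .split D = 1 ∧
      (∀ x, x ∈ m.lst .members D ↔ x ∈ m₀.lst .members D ∧ x ∉ dn) ∧
      ∀ x, x ∈ m.lst .members (m.arr .inter D) ↔ x ∈ m₀.lst .members D ∧ x ∈ dn) ∨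
    (m.arr .inter D ≠ 0 ∧ m.arr .split D = 0 ∧
      (∀ x, x ∈ m.lst .members D ↔ x ∈ m₀.lst .members D) ∧ ∀ x ∈ m₀.lst .members D, x ∈ dn)
  -- New addresses lie above all old ones, so a new block is never confused with an old one. A
  -- restored block keeps its value of `inter`, although the block at that address is no longer in
  -- the list.
  inter_range : ∀ D ∈ m₀.lst .blocks 0, m.arr .inter D ≠ 0 →
    m₀.reg .numBlk < m.arr .inter D ∧ m.arr .inter D ≤ m.reg .numBlk
  inter_inj : ∀ D ∈ m₀.lst .blocks 0, ∀ D' ∈ m₀.lst .blocks 0, m.arr .inter D ≠ 0 →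
    m.arr .inter D = m.arr .inter D' → D = D'
  other : ∀ D ∉ m₀.lst .blocks 0, m.arr .inter D = 0 ∧ m.arr .split D = 0
  fresh : ∀ N, m.reg .numBlk < N → m.lst .members N = []
  block : ∀ x ∈ V, m.arr .block x = if x ∈ dn ∧ m.arr .split (m₀.arr .block x) = 1
    then m.arr .inter (m₀.arr .block x) else m₀.arr .block x

namespace SplitPart

variable {V dn : List ℕ} {m₀ m m' : Memory}

theorem init (h : PartInv V m₀) : SplitPart V m₀ [] m₀ where
  num_le := le_rfl
  blocks := ⟨[], by simp, by simp [h.split_eq]⟩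
  status D hD := .inl ⟨h.inter_eq D, h.split_eq D, by simp, by simp⟩
  inter_range D hD hi := absurd (h.inter_eq D) hi
  inter_inj D hD D' hD' hi := absurd (h.inter_eq D) hi
  other D hD := ⟨h.inter_eq D, h.split_eq D⟩
  fresh := h.fresh
  block x hx := by simp

/-- The command reads and writes only these parts of the memory. -/
theorem congr (h : SplitPart V m₀ dn m) (e1 : m'.reg .numBlk = m.reg .numBlk)
    (e2 : m'.arr .inter = m.arr .inter) (e3 : m'.arr .split = m.arr .split)
    (e4 : m'.arr .block = m.arr .block) (e5 : m'.lst .blocks = m.lst .blocks)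
    (e6 : m'.lst .members = m.lst .members) : SplitPart V m₀ dn m' := by
  obtain ⟨h1, h2, h3, h4, h5, h6, h7, h8⟩ := h
  exact ⟨by rwa [e1], by rwa [e2, e3, e5], by rwa [e2, e3, e6], by rwa [e1, e2], by rwa [e2],
    by rwa [e2, e3], by rwa [e1, e6], by rwa [e2, e3, e4]⟩

/-- A new block is created for the states that are moved out of the block `D`. -/
theorem create (h : SplitPart V m₀ dn m) (h₀ : PartInv V m₀) {D : ℕ}
    (hD : D ∈ m₀.lst .blocks 0)
    (h0 : m.arr .inter D = 0) (e1 : m'.reg .numBlk = m.reg .numBlk + 1)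
    (e2 : m'.arr .inter = Function.update (m.arr .inter) D (m.reg .numBlk + 1))
    (e3 : m'.arr .split = Function.update (m.arr .split) D 1)
    (e4 : m'.arr .block = m.arr .block)
    (e5 : m'.lst .blocks 0 = m.lst .blocks 0 ++ [m.reg .numBlk + 1])
    (e6 : m'.lst .members = m.lst .members) : SplitPart V m₀ dn m' := by
  have hst : m.arr .split D = 0 ∧ (∀ x, x ∈ m.lst .members D ↔ x ∈ m₀.lst .members D) ∧
      ∀ x ∈ m₀.lst .members D, x ∉ dn := by
    rcases h.status D hD with h' | h' | h'
    · exact h'.2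
    · exact absurd h0 h'.1
    · exact absurd h0 h'.1
  have hr : ∀ D' ∈ m₀.lst .blocks 0, m.arr .inter D' ≠ m.reg .numBlk + 1 := fun D' hD' e => by
    have := (h.inter_range D' hD' (by omega)).2
    omega
  constructor
  · rw [e1]; exact h.num_le.trans (Nat.le_succ _)
  · obtain ⟨new, hn, hm⟩ := h.blocks
    refine ⟨new ++ [m.reg .numBlk + 1], by rw [e5, hn, List.append_assoc], fun N => ?_⟩
    rw [List.mem_append, hm, List.mem_singleton, e2, e3]
    constructor
    · rintro (⟨D', hD', hs, hi⟩ | rfl)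
      · have : D' ≠ D := by rintro rfl; omega
        exact ⟨D', hD', by simpa [this] using ⟨hs, hi⟩⟩
      · exact ⟨D, hD, by simp⟩
    · rintro ⟨D', hD', hs, hi⟩
      by_cases e : D' = D
      · subst e; simp at hi; exact .inr hi.symm
      · exact .inl ⟨D', hD', by simpa [e] using hs, by simpa [e] using hi⟩
  · intro D' hD'
    rw [e2, e3, e6]
    by_cases e : D' = D
    · subst e
      right; left
      simp only [Function.update_self]
      refine ⟨by omega, trivial, fun x => ?_, fun x => ?_⟩
      · rw [hst.2.1]
        exact ⟨fun h => ⟨h, hst.2.2 x h⟩, fun h => h.1⟩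
      · rw [h.fresh _ (Nat.lt_succ_self _)]
        simp only [List.not_mem_nil, false_iff, not_and]
        exact hst.2.2 x
    · simpa [e] using h.status D' hD'
  · intro D' hD' hi
    rw [e2] at hi ⊢
    rw [e1]
    by_cases e : D' = D
    · subst e
      simpa using h.num_le
    · simp only [ne_eq, e, not_false_eq_true, Function.update_of_ne] at hi ⊢
      have := h.inter_range D' hD' hi
      omega
  · intro D₁ h₁ D₂ h₂ hi he
    rw [e2] at hi he
    by_cases e₁ : D₁ = D <;> by_cases e₂ : D₂ = D
    · rw [e₁, e₂]
    · subst e₁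
      simp only [Function.update_self, ne_eq, e₂, not_false_eq_true, Function.update_of_ne] at he
      exact absurd he.symm (hr D₂ h₂)
    · subst e₂
      simp only [Function.update_self, ne_eq, e₁, not_false_eq_true, Function.update_of_ne] at he
      exact absurd he (hr D₁ h₁)
    · simp only [ne_eq, e₁, e₂, not_false_eq_true, Function.update_of_ne] at hi he
      exact h.inter_inj D₁ h₁ D₂ h₂ hi he
  · intro D' hD'
    have : D' ≠ D := by rintro rfl; exact hD' hD
    rw [e2, e3]
    simpa [this] using h.other D' hD'
  · intro N hN
    rw [e6]
    exact h.fresh N (by omega)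
  · intro x hx
    rw [e2, e3, e4, h.block x hx]
    by_cases e : m₀.arr .block x = D
    · have : x ∉ dn := hst.2.2 x ((h₀.mem_members D hD x).2 ⟨hx, e⟩)
      simp [this]
    · simp [e]

/-- The state `s` is moved from its block `D` to the new block. -/
theorem move (h : SplitPart V m₀ dn m) (h₀ : PartInv V m₀) (hw : m.WF) {D s : ℕ}
    (hD : D ∈ m₀.lst .blocks 0) (hs : s ∈ m₀.lst .members D) (hsd : s ∉ dn)
    (h1 : m.arr .split D = 1) (e1 : m'.reg .numBlk = m.reg .numBlk)
    (e2 : m'.arr .inter = m.arr .inter) (e3 : m'.arr .split = m.arr .split)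
    (e4 : m'.arr .block = Function.update (m.arr .block) s (m.arr .inter D))
    (e5 : m'.lst .blocks = m.lst .blocks)
    (e6 : ∀ B, m'.lst .members B = if B = m.arr .inter D then m.lst .members B ++ [s] else
      if B = D then (m.lst .members D).erase s else m.lst .members B) :
    SplitPart V m₀ (dn ++ [s]) m' := by
  obtain ⟨hi, hm, hm'⟩ : m.arr .inter D ≠ 0 ∧
      (∀ x, x ∈ m.lst .members D ↔ x ∈ m₀.lst .members D ∧ x ∉ dn) ∧
      ∀ x, x ∈ m.lst .members (m.arr .inter D) ↔ x ∈ m₀.lst .members D ∧ x ∈ dn := by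
    rcases h.status D hD with h' | h' | h'
    · omega
    · exact ⟨h'.1, h'.2.2⟩
    · omega
  have hr := h.inter_range D hD hi
  have hlt : ∀ D' ∈ m₀.lst .blocks 0, D' ≠ m.arr .inter D := fun D' hD' e => by
    have := h₀.block_le D' hD'
    omega
  have hsV := (h₀.mem_members D hD s).1 hs
  constructor
  · rw [e1]; exact h.num_le
  · rw [e2, e3, e5]; exact h.blocks
  · intro D' hD'
    rw [e2, e3]
    by_cases e : D' = D
    · subst e
      right; left
      refine ⟨hi, h1, fun x => ?_, fun x => ?_⟩
      · rw [e6, if_neg (hlt D' hD), if_pos rfl, (hw .members D').1.mem_erase_iff, hm]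
        simp only [List.mem_append, List.mem_singleton, not_or]
        tauto
      · rw [e6, if_pos rfl, List.mem_append, hm', List.mem_append, List.mem_singleton]
        constructor
        · rintro (⟨a, b⟩ | rfl)
          · exact ⟨a, .inl b⟩
          · exact ⟨hs, .inr rfl⟩
        · tauto
    · have hsD' : s ∉ m₀.lst .members D' := fun h' =>
        e (((h₀.mem_members D' hD' s).1 h').2.symm.trans hsV.2)
      have e7 : m'.lst .members D' = m.lst .members D' := by
        rw [e6, if_neg (hlt D' hD'), if_neg e]
      have hmem : ∀ x ∈ m₀.lst .members D', (x ∈ dn ++ [s] ↔ x ∈ dn) := fun x hx => by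
        have : x ≠ s := by rintro rfl; exact hsD' hx
        simp [this]
      rcases h.status D' hD' with h' | h' | h'
      · left
        refine ⟨h'.1, h'.2.1, by rw [e7]; exact h'.2.2.1, fun x hx => ?_⟩
        rw [hmem x hx]; exact h'.2.2.2 x hx
      · right; left
        have e8 : m'.lst .members (m.arr .inter D') = m.lst .members (m.arr .inter D') := by
          have h1 : m.arr .inter D' ≠ m.arr .inter D := fun h'' =>
            e (h.inter_inj D' hD' D hD h'.1 h'')
          have h2 : m.arr .inter D' ≠ D := fun h'' => by
            have := h₀.block_le D hD
            have := h.inter_range D' hD' h'.1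
            omega
          rw [e6, if_neg h1, if_neg h2]
        refine ⟨h'.1, h'.2.1, fun x => ?_, fun x => ?_⟩
        · rw [e7, h'.2.2.1]
          exact and_congr_right fun hx => not_congr (hmem x hx).symm
        · rw [e8, h'.2.2.2]
          exact and_congr_right fun hx => (hmem x hx).symm
      · right; right
        refine ⟨h'.1, h'.2.1, by rw [e7]; exact h'.2.2.1, fun x hx => ?_⟩
        rw [hmem x hx]; exact h'.2.2.2 x hx
  · rw [e1, e2]; exact h.inter_range
  · rw [e2]; exact h.inter_inj
  · rw [e2, e3]; exact h.other
  · intro N hN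
    rw [e1] at hN
    have h1 : N ≠ m.arr .inter D := by omega
    have h2 : N ≠ D := by have := h₀.block_le D hD; omega
    rw [e6, if_neg h1, if_neg h2]
    exact h.fresh N hN
  · intro x hx
    rw [e2, e3, e4]
    by_cases e : x = s
    · subst e
      rw [hsV.2]
      simp [h1]
    · rw [Function.update_of_ne e, h.block x hx]
      simp [e]

/-- The block `D` has been emptied, and its states are moved back to it. -/
theorem restore (h : SplitPart V m₀ dn m) (h₀ : PartInv V m₀) (hw : m.WF) {D : ℕ}
    (hD : D ∈ m₀.lst .blocks 0) (hfull : ∀ x ∈ m₀.lst .members D, x ∈ dn)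
    (h1 : m.arr .split D = 1) (e1 : m'.reg .numBlk = m.reg .numBlk)
    (e2 : m'.arr .inter = m.arr .inter) (e3 : m'.arr .split = Function.update (m.arr .split) D 0)
    (e4 : ∀ x ∈ V, m'.arr .block x =
      if x ∈ m₀.lst .members D then D else m.arr .block x)
    (e5 : m'.lst .blocks 0 = (m.lst .blocks 0).erase (m.arr .inter D))
    (e6 : ∀ x, x ∈ m'.lst .members D ↔ x ∈ m₀.lst .members D)
    (e7 : ∀ B, B ≠ D → B ≠ m.arr .inter D → m'.lst .members B = m.lst .members B) :
    SplitPart V m₀ dn m' := by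
  have hi : m.arr .inter D ≠ 0 := by
    rcases h.status D hD with h' | h' | h'
    · omega
    · exact h'.1
    · omega
  have hr := h.inter_range D hD hi
  have hlt : ∀ D' ∈ m₀.lst .blocks 0, D' ≠ m.arr .inter D := fun D' hD' e => by
    have := h₀.block_le D' hD'
    omega
  constructor
  · rw [e1]; exact h.num_le
  · obtain ⟨new, hn, hm⟩ := h.blocks
    have hnd : new.Nodup := by
      have := (hw .blocks 0).1
      rw [hn, List.nodup_append] at this
      exact this.2.1
    refine ⟨new.erase (m.arr .inter D), ?_, fun N => ?_⟩
    · rw [e5, hn, List.erase_append_right]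
      exact fun h => hlt _ h rfl
    · rw [hnd.mem_erase_iff, hm, e2, e3]
      constructor
      · rintro ⟨hne, D', hD', hs, rfl⟩
        have : D' ≠ D := by rintro rfl; exact hne rfl
        exact ⟨D', hD', by simpa [this] using hs, rfl⟩
      · rintro ⟨D', hD', hs, rfl⟩
        have hne : D' ≠ D := by rintro rfl; simp at hs
        refine ⟨fun e => hne (h.inter_inj D hD D' hD' hi e.symm).symm, D', hD', ?_, rfl⟩
        simpa [hne] using hs
  · intro D' hD'
    rw [e2, e3]
    by_cases e : D' = D
    · subst e
      exact .inr (.inr ⟨hi, by simp, e6, hfull⟩)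
    · rw [Function.update_of_ne e, e7 D' e (hlt D' hD')]
      rcases h.status D' hD' with h' | h' | h'
      · exact .inl h'
      · have h2 : m.arr .inter D' ≠ D := fun h'' => by
          have := h₀.block_le D hD
          have := h.inter_range D' hD' h'.1
          omega
        rw [e7 _ h2 fun h'' => e (h.inter_inj D' hD' D hD h'.1 h'')]
        exact .inr (.inl h')
      · exact .inr (.inr h')
  · rw [e1, e2]; exact h.inter_range
  · rw [e2]; exact h.inter_inj
  · intro D' hD'
    have : D' ≠ D := by rintro rfl; exact hD' hD
    rw [e2, e3, Function.update_of_ne this]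
    exact h.other D' hD'
  · intro N hN
    rw [e1] at hN
    have := h₀.block_le D hD
    rw [e7 N (by omega) (by omega)]
    exact h.fresh N hN
  · intro x hx
    rw [e2, e3, e4 x hx, h.block x hx]
    by_cases e : m₀.arr .block x = D
    · have : x ∈ m₀.lst .members D := (h₀.mem_members D hD x).2 ⟨hx, e⟩
      simp [this, e]
    · have : x ∉ m₀.lst .members D := fun h' => e ((h₀.mem_members D hD x).1 h').2
      simp [this, e]

end SplitPart

end ReachPart

namespace ReachPart

/-! ## Splitting the partition: the program -/

theorem wp_moveFromTo {x src dst : Reg} {m : Memory}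
    (hx : m.reg x ∈ m.lst .members (m.reg src)) (h0 : m.reg x ≠ 0)
    (hd : m.reg x ∉ m.lst .members (m.reg dst)) (hne : m.reg dst ≠ m.reg src) :
    Wp (Cmd.moveFromTo x src dst) m fun m' k => k ≤ 10 ∧
      m'.arr .block = Function.update (m.arr .block) (m.reg x) (m.reg dst) ∧
      ∀ B, m'.lst .members B = if B = m.reg dst then m.lst .members B ++ [m.reg x] else
        if B = m.reg src then (m.lst .members (m.reg src)).erase (m.reg x)
        else m.lst .members B := by
  simp only [Cmd.moveFromTo, wp_block_cons, wp_block_nil, wp_remove, wp_append, wp_store, Exp.eval,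
    Exp.cost, Memory.setLst_reg, Memory.setLst_lst, if_true, ne_eq, hne, not_false_eq_true,
    Function.update_of_ne]
  refine ⟨hx, h0, hd, by omega, by simp, fun B => ?_⟩
  by_cases h1 : B = m.reg dst
  · subst h1; simp
  · by_cases h2 : B = m.reg src
    · subst h2; simp [h1]
    · simp [h1, h2]

theorem wp_moveBack {m : Memory} {D N : ℕ} (hw : m.WF) (hD : m.reg .D = D) (hN : m.reg .N = N)
    (hne : D ≠ N) (hdisj : ∀ x ∈ m.lst .members N, x ∉ m.lst .members D) :
    Wp (.while (.ne (.first .members (.reg .N)) (.num 0)) (Cmd.block [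
        Cmd.assign .t (.first .members (.reg .N)), Cmd.moveFromTo .t .N .D])) m fun m' k =>
      k ≤ 10 + 40 * (m.lst .members N).length ∧
      (∀ x, x ∈ m'.lst .members D ↔ x ∈ m.lst .members D ∨ x ∈ m.lst .members N) ∧
      (∀ B, B ≠ D → B ≠ N → m'.lst .members B = m.lst .members B) ∧
      ∀ x, m'.arr .block x = if x ∈ m.lst .members N then D else m.arr .block x := by
  refine wp_while (fun n m₁ => ∃ p l, m.lst .members N = p ++ l ∧ m₁.lst .members N = l ∧
    m₁.lst .members D = m.lst .members D ++ p ∧ n = 40 * l.length ∧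
    (∀ B, B ≠ D → B ≠ N → m₁.lst .members B = m.lst .members B) ∧
    ∀ x, m₁.arr .block x = if x ∈ p then D else m.arr .block x)
    ⟨[], m.lst .members N, by simp, rfl, by simp, rfl, by simp, by simp⟩ ?_ ?_
  · rintro n m₁ hf ⟨p, l, hpl, hl, hDp, hn, hB, hb⟩ ht
    have hD₁ : m₁.reg .D = D := (hf.reg _ rfl).trans hD
    have hN₁ : m₁.reg .N = N := (hf.reg _ rfl).trans hN
    have h0 : 0 ∉ l := hl ▸ ((hf.wf hw) .members N).2
    simp only [Test.holds, Exp.eval, hN₁, hl] at ht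
    obtain ⟨a, r, rfl⟩ := List.exists_cons_of_ne_nil ((headD_ne_zero h0).1 ht)
    have hnd : (p ++ a :: r).Nodup := hpl ▸ (hw .members N).1
    have hap : a ∉ p := fun h => (List.nodup_append.1 hnd).2.2 a h a (by simp) rfl
    have hfst : Exp.eval m₁ (.first .members (.reg .N)) = a := by simp [Exp.eval, hN₁, hl]
    rw [wp_block_cons, wp_assign, wp_block_cons, hfst]
    refine (wp_moveFromTo ?_ ?_ ?_ ?_).mono ?_
    · simp [hN₁, hl]
    · simpa using ht
    · simpa [hD₁, hDp, hap] using hdisj a (by rw [hpl]; simp)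
    · simpa [hN₁, hD₁] using hne
    · rintro m₂ k hf₂ ⟨hk, hb₂, hm₂⟩
      rw [wp_block_nil]
      simp only [Memory.setReg_reg, Memory.setReg_lst, Memory.setReg_arr, if_true, if_false,
        reduceCtorEq, hN₁, hD₁, hl] at hb₂ hm₂
      refine ⟨40 * r.length, ?_, p ++ [a], r, by simpa using hpl, ?_, ?_, rfl, ?_, ?_⟩
      · simp only [Exp.cost, Test.cost]
        simp only [List.length_cons] at hn
        omega
      · rw [hm₂, if_neg hne.symm, if_pos rfl, List.erase_cons_head]
      · rw [hm₂, if_pos rfl, hDp, List.append_assoc]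
      · intro B h1 h2
        rw [hm₂, if_neg h1, if_neg h2, hB B h1 h2]
      · intro x
        rw [hb₂]
        by_cases hx : x = a
        · simp [hx]
        · simp [hx, hb]
  · rintro n' m' k hf hk ⟨p, l, hpl, hl, hDp, hn, hB, hb⟩ ht
    have hN₁ : m'.reg .N = N := (hf.reg _ rfl).trans hN
    have h0 : 0 ∉ l := hl ▸ ((hf.wf hw) .members N).2
    simp only [Test.holds, Exp.eval, hN₁, hl, headD_ne_zero h0, not_not] at ht
    subst ht
    rw [List.append_nil] at hpl
    simp only [Test.cost, Exp.cost] at hk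
    exact ⟨by omega, by simp [hDp, hpl], hB, by simpa [hpl] using hb⟩

/-- The number of states in blocks with an address greater than `b`. -/
def newCount (V : List ℕ) (b : ℕ) (f : ℕ → ℕ) : ℕ := (V.toFinset.filter (b < f ·)).card

theorem newCount_update_le (V : List ℕ) (b : ℕ) (f : ℕ → ℕ) (s N : ℕ) :
    newCount V b (Function.update f s N) ≤ newCount V b f + 1 := by
  refine (Finset.card_le_card (t := insert s (V.toFinset.filter (b < f ·))) fun x hx => ?_).trans
    (Finset.card_insert_le _ _)
  by_cases e : x = s
  · simp [e]
  · simpa [e] using hx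

/-- The states of `l` had addresses above `b` and now have `D ≤ b`, so each of them leaves the
count. This credit pays for moving them back. -/
theorem newCount_restore {V : List ℕ} {b D : ℕ} {f g : ℕ → ℕ} {l : List ℕ} (hl : l.Nodup)
    (hV : ∀ x ∈ l, x ∈ V) (hf : ∀ x ∈ l, b < f x) (hD : D ≤ b)
    (hg : ∀ x, g x = if x ∈ l then D else f x) : newCount V b g + l.length ≤ newCount V b f := by
  rw [← List.toFinset_card_of_nodup hl, newCount, newCount, ← Finset.card_union_of_disjoint]
  · refine Finset.card_le_card fun x hx => ?_
    simp only [Finset.mem_union, Finset.mem_filter, List.mem_toFinset, hg] at hx ⊢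
    by_cases hxl : x ∈ l
    · exact ⟨hV x hxl, hf x hxl⟩
    · simpa [hxl] using hx
  · rw [Finset.disjoint_left]
    intro x hx hxl
    simp only [Finset.mem_filter, List.mem_toFinset, hg] at hx hxl
    rw [if_pos hxl] at hx
    omega

/-- One step of the scan of the splitter. -/
abbrev splitStep : List Cmd := [
  Cmd.assign .D (.arr .block (.reg .s)),
  Cmd.when (.eq (.arr .inter (.reg .D)) (.num 0)) [
    Cmd.assign .numBlk (.add (.reg .numBlk) (.num 1)),
    Cmd.store .inter (.reg .D) (.reg .numBlk),
    Cmd.store .split (.reg .D) (.num 1),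
    Cmd.append .blocks (.num 0) (.reg .numBlk)],
  Cmd.assign .N (.arr .inter (.reg .D)),
  Cmd.moveFromTo .s .D .N,
  Cmd.when (.eq (.first .members (.reg .D)) (.num 0)) [
    Cmd.store .split (.reg .D) (.num 0),
    .while (.ne (.first .members (.reg .N)) (.num 0)) (Cmd.block [
      Cmd.assign .t (.first .members (.reg .N)),
      Cmd.moveFromTo .t .N .D]),
    Cmd.remove .blocks (.num 0) (.reg .N)]]

/-- Both parts of a block that is being split are nonempty. -/
def SplitNonempty (m₀ : Memory) (dn : List ℕ) (m : Memory) : Prop :=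
  ∀ D ∈ m₀.lst .blocks 0, m.arr .split D = 1 →
    (∃ x ∈ m₀.lst .members D, x ∈ dn) ∧ ∃ x ∈ m₀.lst .members D, x ∉ dn

/-- A step may have to restore a whole block, so only its amortised cost is constant. The potential
is `newCount`, weighted by the 40 steps per state in `wp_moveBack`: moving `s` raises it by at most
one, which leaves 100 of the 140 for the rest of the step. -/
theorem wp_splitStep {V dn : List ℕ} {m₀ m : Memory} {s : ℕ} (h : SplitPart V m₀ dn m)
    (h₀ : PartInv V m₀) (hne : SplitNonempty m₀ dn m) (hw : m.WF) (hs : m.reg .s = s) (hsV : s ∈ V)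
    (hs0 : s ≠ 0) (hsd : s ∉ dn) :
    Wp (Cmd.block splitStep) m fun m' k => SplitPart V m₀ (dn ++ [s]) m' ∧
      SplitNonempty m₀ (dn ++ [s]) m' ∧
      40 * newCount V (m₀.reg .numBlk) (m'.arr .block) + k ≤
        40 * newCount V (m₀.reg .numBlk) (m.arr .block) + 140 := by
  have hb : m.arr .block s = m₀.arr .block s := by rw [h.block s hsV]; simp [hsd]
  obtain ⟨D, hDb⟩ : ∃ D, D = m₀.arr .block s := ⟨_, rfl⟩
  have hD : D ∈ m₀.lst .blocks 0 := hDb ▸ h₀.block_mem s hsV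
  have hsD : s ∈ m₀.lst .members D := (h₀.mem_members D hD s).2 ⟨hsV, hDb.symm⟩
  rw [wp_block_cons, wp_assign, wp_block_cons]
  refine Wp.mono (Q := fun m₂ k => k ≤ 30 ∧ SplitPart V m₀ dn m₂ ∧ m₂.arr .split D = 1 ∧
    m₂.reg .D = D ∧ ∀ D' ≠ D, m₂.arr .split D' = m.arr .split D') ?_ ?_
  · rw [wp_when]
    simp only [Test.holds, Exp.eval, Memory.setReg_reg, Memory.setReg_arr, if_true, hs, hb, ← hDb]
    refine ⟨fun hi => ?_, fun hi => ?_⟩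
    · have hnb : m.reg .numBlk + 1 ∉ m.lst .blocks 0 := by
        obtain ⟨new, hn, hm⟩ := h.blocks
        rw [hn, List.mem_append, hm]
        rintro (h' | ⟨D', hD', -, h'⟩)
        · have := h₀.block_le _ h'
          have := h.num_le
          omega
        · have := h.inter_range D' hD' (by omega)
          omega
      simp only [wp_block_cons, wp_block_nil, wp_assign, wp_store, wp_append, Exp.eval, Exp.cost,
        Test.cost, Memory.setReg_reg, Memory.setReg_lst, Memory.setArr_reg, Memory.setArr_lst,
        if_true, if_false, reduceCtorEq]
      refine ⟨by omega, hnb, by omega, ?_, ?_, ?_, ?_⟩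
      · exact h.create h₀ hD hi (by simp) (by simp) (by simp) (by simp) (by simp) (by simp)
      · simp
      · simp
      · intro D' hD'
        simp [hD']
    · refine ⟨by simp [Test.cost, Exp.cost],
        h.congr (by simp) (by simp) (by simp) (by simp) (by simp) (by simp), ?_, by simp, by simp⟩
      rcases h.status D hD with h' | h' | h'
      · exact absurd h'.1 hi
      · exact h'.2.1
      -- A restored block has had all its states processed, so the unprocessed state `s` is not in
      -- it.
      · exact absurd (h'.2.2.2 s hsD) hsd
  · rintro m₂ k₂ hf₂ ⟨hk₂, h₂, hsp₂, hD₂, hoth⟩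
    have w₂ : m₂.WF := hf₂.wf hw
    have hs₂ : m₂.reg .s = s := by rw [hf₂.reg .s rfl]; simpa using hs
    have hb₂ : m₂.arr .block = m.arr .block := by rw [hf₂.arr .block rfl]; simp
    obtain ⟨N, hN⟩ : ∃ N, N = m₂.arr .inter D := ⟨_, rfl⟩
    obtain ⟨hi, hm, hm'⟩ : m₂.arr .inter D ≠ 0 ∧
        (∀ x, x ∈ m₂.lst .members D ↔ x ∈ m₀.lst .members D ∧ x ∉ dn) ∧
        ∀ x, x ∈ m₂.lst .members (m₂.arr .inter D) ↔ x ∈ m₀.lst .members D ∧ x ∈ dn := by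
      rcases h₂.status D hD with h' | h' | h'
      · omega
      · exact ⟨h'.1, h'.2.2⟩
      · omega
    rw [← hN] at hm'
    have hr := h₂.inter_range D hD hi
    rw [← hN] at hr
    have hDle := h₀.block_le D hD
    have hND : N ≠ D := by omega
    rw [wp_block_cons, wp_assign, wp_block_cons]
    refine (wp_moveFromTo ?_ ?_ ?_ ?_).mono ?_
    · simp only [Memory.setReg_reg, Memory.setReg_lst, if_false, reduceCtorEq, hs₂, hD₂, hm]
      exact ⟨hsD, hsd⟩
    · simpa [hs₂] using hs0
    · simp only [Memory.setReg_reg, Memory.setReg_lst, if_true, if_false, reduceCtorEq, hs₂,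
        Exp.eval, hD₂, ← hN, hm']
      exact fun h => hsd h.2
    · simpa [Exp.eval, hD₂, ← hN] using hND
    rintro m₃ k₃ hf₃ ⟨hk₃, hb₃, hmem₃⟩
    have w₃ : m₃.WF := hf₃.wf w₂
    simp only [Memory.setReg_reg, Memory.setReg_lst, Memory.setReg_arr, if_true, if_false,
      reduceCtorEq, hs₂, Exp.eval, hD₂, ← hN, hb₂] at hb₃ hmem₃
    have e1 : m₃.reg .numBlk = m₂.reg .numBlk := by rw [hf₃.reg .numBlk rfl]; simp
    have e2 : m₃.arr .inter = m₂.arr .inter := by rw [hf₃.arr .inter rfl]; simp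
    have e3 : m₃.arr .split = m₂.arr .split := by rw [hf₃.arr .split rfl]; simp
    have e5 : m₃.lst .blocks = m₂.lst .blocks := by rw [hf₃.lst .blocks rfl]; simp
    have hD₃ : m₃.reg .D = D := by rw [hf₃.reg .D rfl]; simpa using hD₂
    have hN₃ : m₃.reg .N = N := by
      rw [hf₃.reg .N rfl]
      simp [Exp.eval, hD₂, hN]
    have h₃ : SplitPart V m₀ (dn ++ [s]) m₃ :=
      h₂.move h₀ w₂ hD hsD hsd hsp₂ e1 e2 e3 (by rw [hb₃, hb₂, hN]) e5 (by rwa [← hN])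
    have hsp₃ : m₃.arr .split D = 1 := by rw [e3]; exact hsp₂
    have hmD₃ : ∀ x, x ∈ m₃.lst .members D ↔ x ∈ m₀.lst .members D ∧ x ∉ dn ++ [s] := by
      rcases h₃.status D hD with h' | h' | h'
      · omega
      · exact h'.2.2.1
      · omega
    have hmN₃ : ∀ x, x ∈ m₃.lst .members N ↔ x ∈ m₀.lst .members D ∧ x ∈ dn ++ [s] := by
      rw [hN, ← e2]
      rcases h₃.status D hD with h' | h' | h'
      · omega
      · exact h'.2.2.2
      · omega
    have hcnt : newCount V (m₀.reg .numBlk) (m₃.arr .block) ≤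
        newCount V (m₀.reg .numBlk) (m.arr .block) + 1 := by
      rw [hb₃]
      exact newCount_update_le _ _ _ _ _
    have hneD : ∀ D' ∈ m₀.lst .blocks 0, D' ≠ D → m₃.arr .split D' = 1 →
        (∃ x ∈ m₀.lst .members D', x ∈ dn ++ [s]) ∧ ∃ x ∈ m₀.lst .members D', x ∉ dn ++ [s] := by
      intro D' hD' hne' hsp'
      rw [e3, hoth D' hne'] at hsp'
      obtain ⟨⟨x, hx, hxd⟩, y, hy, hyd⟩ := hne D' hD' hsp'
      refine ⟨⟨x, hx, by simp [hxd]⟩, y, hy, ?_⟩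
      have : y ≠ s := by
        rintro rfl
        exact hne' (((h₀.mem_members D' hD' y).1 hy).2.symm.trans hDb.symm)
      simp [hyd, this]
    rw [wp_block_cons, wp_when, wp_block_nil]
    have hh : (Test.eq (.first .members (.reg .D)) (.num 0)).holds m₃ ↔
        m₃.lst .members D = [] := by
      have := headD_ne_zero (w₃ .members D).2
      simp only [Test.holds, Exp.eval, hD₃]
      tauto
    rw [hh]
    refine ⟨fun hnil => ?_, fun hnnil => ⟨h₃, ?_, ?_⟩⟩
    · have hfull : ∀ x ∈ m₀.lst .members D, x ∈ dn ++ [s] := by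
        intro x hx
        by_contra hxd
        have := (hmD₃ x).2 ⟨hx, hxd⟩
        rw [hnil] at this
        simp at this
      have hmN₃' : ∀ x, x ∈ m₃.lst .members N ↔ x ∈ m₀.lst .members D := fun x => by
        rw [hmN₃]
        exact ⟨fun h => h.1, fun h => ⟨h, hfull x h⟩⟩
      rw [wp_block_cons, wp_store, wp_block_cons]
      refine (wp_moveBack (m := m₃.setArr .split (Exp.eval m₃ (.reg .D)) (Exp.eval m₃ (.num 0)))
        (D := D) (N := N) w₃ (by simpa using hD₃) (by simpa using hN₃) hND.symm
        (by simp [hnil])).mono ?_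
      rintro m₄ k₄ hf₄ ⟨hk₄, hmD₄, hoth₄, hb₄⟩
      simp only [Memory.setArr_lst, Memory.setArr_arr, if_false, reduceCtorEq, hnil,
        List.not_mem_nil, false_or] at hk₄ hmD₄ hoth₄ hb₄
      have g1 : m₄.reg .numBlk = m₃.reg .numBlk := by rw [hf₄.reg .numBlk rfl]; simp
      have g2 : m₄.arr .inter = m₃.arr .inter := by rw [hf₄.arr .inter rfl]; simp
      have g3 : m₄.arr .split = Function.update (m₃.arr .split) D 0 := by
        rw [hf₄.arr .split rfl]; simp [hD₃, Exp.eval]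
      have g5 : m₄.lst .blocks = m₃.lst .blocks := by rw [hf₄.lst .blocks rfl]; simp
      have hN₄ : m₄.reg .N = N := by rw [hf₄.reg .N rfl]; simpa using hN₃
      simp only [wp_block_cons, wp_block_nil, wp_remove, Exp.eval, hN₄, g5]
      refine ⟨?_, ?_, ?_, ?_⟩
      · obtain ⟨new, hn, hm⟩ := h₃.blocks
        rw [hn, List.mem_append, hm]
        exact .inr ⟨D, hD, hsp₃, by rw [e2, hN]⟩
      · refine h₃.restore h₀ w₃ hD hfull hsp₃ (by simpa using g1) (by simpa using g2)
          (by simpa using g3) (fun x hx => ?_) ?_ (fun x => ?_) (fun B h1 h2 => ?_)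
        · simp only [Memory.setLst_arr, hb₄, hmN₃']
        · simp [e2, ← hN]
        · simp [hmD₄, hmN₃']
        · rw [e2, ← hN] at h2
          simpa using hoth₄ B h1 h2
      · intro D' hD' hsp'
        simp only [Memory.setLst_arr, g3] at hsp'
        by_cases e : D' = D
        · subst e; simp at hsp'
        · exact hneD D' hD' e (by simpa [e] using hsp')
      · have := newCount_restore (V := V) (b := m₀.reg .numBlk) (D := D) (w₃ .members N).1
          (fun x hx => ((h₀.mem_members D hD x).1 ((hmN₃' x).1 hx)).1) (fun x hx => ?_) hDle hb₄
        · simp only [Memory.setLst_arr, Exp.cost, Test.cost]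
          omega
        · have hxD := (hmN₃' x).1 hx
          have hxV := (h₀.mem_members D hD x).1 hxD
          rw [h₃.block x hxV.1, hxV.2, if_pos ⟨hfull x hxD, hsp₃⟩, e2, ← hN]
          omega
    · intro D' hD' hsp'
      by_cases e : D' = D
      · subst e
        refine ⟨⟨s, hsD, by simp⟩, ?_⟩
        obtain ⟨x, hx⟩ := List.exists_mem_of_ne_nil _ hnnil
        exact ⟨x, (hmD₃ x).1 hx⟩
      · exact hneD D' hD' e hsp'
    · simp only [Exp.cost, Test.cost]
      omega

end ReachPart

/-! ### The outcome of splitting the partition -/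

namespace ReachPart

/-- The outcome of splitting the partition in `m` by the splitter `S`: the blocks that satisfy
`sp` have been split properly and moved to the end. -/
structure SplitResult (V : List ℕ) (S : List ℕ) (m m' : Memory) (sp : ℕ → Bool)
    (new : List ℕ) : Prop where
  blocks : m'.lst .blocks 0 = (m.lst .blocks 0).filter (fun D => !sp D) ++ new ++
    (m.lst .blocks 0).filter sp
  length_new : new.length = ((m.lst .blocks 0).filter sp).length
  split : ∀ D ∈ m.lst .blocks 0, sp D = true → ∃ x ∈ m.lst .members D, x ∉ S
  unsplit : ∀ D ∈ m.lst .blocks 0, sp D = false →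
    ∀ x, x ∈ m'.lst .members D ↔ x ∈ m.lst .members D
  block_eq : ∀ x ∈ V, ∀ y ∈ V, m'.arr .block x = m'.arr .block y ↔
    m.arr .block x = m.arr .block y ∧ (x ∈ S ↔ y ∈ S)

/-- The block of a state after the split determines its block before the split. -/
theorem SplitPart.block_eq_iff {V S : List ℕ} {m₀ m : Memory} (h : SplitPart V m₀ S m)
    (h₀ : PartInv V m₀) {x y : ℕ} (hx : x ∈ V) (hy : y ∈ V) :
    m.arr .block x = m.arr .block y ↔
      m₀.arr .block x = m₀.arr .block y ∧ (x ∈ S ↔ y ∈ S) := by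
  have hbx := h₀.block_mem x hx
  have hby := h₀.block_mem y hy
  have hlx := h₀.block_le _ hbx
  have hly := h₀.block_le _ hby
  have hst : ∀ D ∈ m₀.lst .blocks 0, m.arr .split D = 1 → m.arr .inter D ≠ 0 := fun D hD hs => by
    rcases h.status D hD with h' | h' | h'
    · omega
    · exact h'.1
    · exact h'.1
  rw [h.block x hx, h.block y hy]
  by_cases e : m₀.arr .block x = m₀.arr .block y
  · rw [← e]
    by_cases hs : m.arr .split (m₀.arr .block x) = 1
    · have hr := h.inter_range _ hbx (hst _ hbx hs)
      by_cases hxS : x ∈ S <;> by_cases hyS : y ∈ S <;> simp [hs, hxS, hyS] <;> omega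
    · simp only [hs, and_false, if_false, true_and, true_iff]
      have hxm := (h₀.mem_members _ hbx x).2 ⟨hx, rfl⟩
      have hym := (h₀.mem_members _ hbx y).2 ⟨hy, e.symm⟩
      rcases h.status _ hbx with h' | h' | h'
      · simp [h'.2.2.2 x hxm, h'.2.2.2 y hym]
      · exact absurd h'.2.1 hs
      · simp [h'.2.2.2 x hxm, h'.2.2.2 y hym]
  · simp only [e, false_and, iff_false]
    intro he
    split_ifs at he with h1 h2 h2
    · exact e (h.inter_inj _ hbx _ hby (hst _ hbx h1.2) he)
    · have := h.inter_range _ hbx (hst _ hbx h1.2)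
      omega
    · have := h.inter_range _ hby (hst _ hby h2.2)
      omega
    · exact e he

/-- An old block is compared with the array according to its three possible states. A new block is
`inter D` for a unique block `D` under division, because `inter` is injective where it is nonzero
and its values exceed the old addresses. -/
theorem SplitPart.members_iff {V S : List ℕ} {m₀ m : Memory} (h : SplitPart V m₀ S m)
    (h₀ : PartInv V m₀) {B : ℕ} (hB : B ∈ m.lst .blocks 0) (x : ℕ) :
    x ∈ m.lst .members B ↔ x ∈ V ∧ m.arr .block x = B := by
  obtain ⟨new, hn, hm⟩ := h.blocks
  have key : ∀ x ∈ V, ∀ D ∈ m₀.lst .blocks 0, m.arr .block x = D ↔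
      m₀.arr .block x = D ∧ ¬ (x ∈ S ∧ m.arr .split D = 1) := by
    intro x hx D hD
    have hbx := h₀.block_mem x hx
    rw [h.block x hx]
    split_ifs with hs
    · have hi : m.arr .inter (m₀.arr .block x) ≠ 0 := by
        rcases h.status _ hbx with h' | h' | h'
        · omega
        · exact h'.1
        · exact h'.1
      have := h.inter_range _ hbx hi
      have := h₀.block_le D hD
      constructor
      · intro e; omega
      · rintro ⟨rfl, h'⟩; exact absurd hs h'
    · constructor
      · rintro rfl; exact ⟨rfl, hs⟩
      · exact fun h => h.1
  rw [hn, List.mem_append] at hB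
  by_cases hB' : B ∈ m₀.lst .blocks 0
  · have hmem := h₀.mem_members B hB' x
    rcases h.status B hB' with h' | h' | h'
    · rw [h'.2.2.1, hmem]
      refine and_congr_right fun hx => ?_
      rw [key x hx B hB', h'.2.1]
      simp
    · rw [h'.2.2.1, hmem, and_assoc]
      refine and_congr_right fun hx => ?_
      rw [key x hx B hB', h'.2.1]
      simp
    · rw [h'.2.2.1, hmem]
      refine and_congr_right fun hx => ?_
      rw [key x hx B hB', h'.2.1]
      simp
  · obtain ⟨D, hD, hs, rfl⟩ := (hm B).1 (hB.resolve_left hB')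
    rcases h.status D hD with h' | h' | h'
    · omega
    · rw [h'.2.2.2, h₀.mem_members D hD, and_assoc]
      refine and_congr_right fun hx => ?_
      have hbx := h₀.block_mem x hx
      rw [h.block x hx]
      constructor
      · rintro ⟨e, hxS⟩
        rw [e, if_pos ⟨hxS, hs⟩]
      · intro e
        split_ifs at e with hc
        · refine ⟨(h.inter_inj D hD _ hbx h'.1 e.symm).symm, hc.1⟩
        · exact absurd (e ▸ hbx) hB'
    · omega

/-- The potential `newCount` starts at `0`, since all old addresses are at most `numBlk`. The scan
of the splitter costs at most 150 per state, and the final scan 40 for each visit, of which there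
are at most three per old block: the block, its new part, and its second visit. -/
theorem wp_splitBlocks {V : List ℕ} {m : Memory} (hV0 : 0 ∉ V) (hw : m.WF) (h₀ : PartInv V m)
    (hS : ∀ x ∈ m.lst .ef 0, x ∈ V) :
    Wp Cmd.splitBlocks m fun m' k => k ≤ 300 * V.length + 30 ∧ PartInv V m' ∧
      ∃ sp new, SplitResult V (m.lst .ef 0) m m' sp new := by
  have hz : newCount V (m.reg .numBlk) (m.arr .block) = 0 := by
    rw [newCount, Finset.card_eq_zero, Finset.filter_eq_empty_iff]
    intro x hx
    have := h₀.block_le _ (h₀.block_mem x (by simpa using hx))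
    omega
  unfold Cmd.splitBlocks
  rw [wp_block_cons]
  refine wp_scan (fun n m₁ dn rest => SplitPart V m dn m₁ ∧ SplitNonempty m dn m₁ ∧
    n = 150 * rest.length + 40 * newCount V (m.reg .numBlk) (m₁.arr .block)) 0 _ hw
    (fun _ _ => rfl) rfl ⟨?_, ?_, rfl⟩ ?_ ?_
  · exact (SplitPart.init h₀).congr (by simp) (by simp) (by simp) (by simp) (by simp) (by simp)
  · intro D hD h1
    simp [h₀.split_eq] at h1
  · rintro n m₁ dn s rest hf w₁ hl hs ⟨h1, h2, h3⟩
    have hef : m₁.lst .ef = m.lst .ef := hf.lst _ rfl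
    have hsV : s ∈ V := hS s (by rw [← hef, hl]; simp)
    have hsd : s ∉ dn := by
      have := (w₁ .ef 0).1
      rw [hl, List.nodup_append] at this
      exact fun h => this.2.2 s h s (by simp) rfl
    refine (wp_splitStep h1 h₀ h2 w₁ hs hsV (fun h => hV0 (h ▸ hsV)) hsd).mono ?_
    rintro m₂ k hf₂ ⟨h1', h2', hk⟩
    refine ⟨_, dn, rest, by rw [hf₂.lst .ef rfl, hl], ?_, ?_, h2', rfl⟩
    · simp only [List.length_cons] at h3
      simp only [Exp.cost, Memory.setReg_arr]
      omega
    · exact h1'.congr (by simp) (by simp) (by simp) (by simp) (by simp) (by simp)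
  · rintro n m₁ k₁ hf₁ w₁ hk₁ ⟨h1, h2, -⟩
    have hef : m₁.lst .ef = m.lst .ef := hf₁.lst _ rfl
    rw [hef] at h1 h2
    obtain ⟨new, hn, hm⟩ := h1.blocks
    have h01 : ∀ D, m₁.arr .split D = 0 ∨ m₁.arr .split D = 1 := by
      intro D
      by_cases hD : D ∈ m.lst .blocks 0
      · rcases h1.status D hD with h' | h' | h'
        · exact .inl h'.2.1
        · exact .inr h'.2.1
        · exact .inl h'.2.1
      · exact .inl (h1.other D hD).2
    have hnd := (w₁ .blocks 0).1
    rw [hn] at hnd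
    have hnew : ∀ N ∈ new, N ∉ m.lst .blocks 0 := fun N hN hN' =>
      (List.nodup_append.1 hnd).2.2 N hN' N hN rfl
    have hsn : ∀ N ∈ new, m₁.arr .split N = 0 := fun N hN => (h1.other N (hnew N hN)).2
    -- `inter` maps the properly split blocks bijectively onto the new ones. Their equal number is
    -- what the potential of the main loop relies on.
    have hperm : new.Perm (((m.lst .blocks 0).filter (m₁.arr .split · = 1)).map
        (m₁.arr .inter)) := by
      refine (List.perm_ext_iff_of_nodup (List.nodup_append.1 hnd).2.1 ?_).2 fun N => ?_
      · refine List.Nodup.map_on ?_ ((hw .blocks 0).1.filter _)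
        intro D hD D' hD' e
        simp only [List.mem_filter, decide_eq_true_eq] at hD hD'
        refine h1.inter_inj D hD.1 D' hD'.1 ?_ e
        rcases h1.status D hD.1 with h' | h' | h'
        · omega
        · exact h'.1
        · exact h'.1
      · simp [hm, and_assoc]
    have hlen : new.length = ((m.lst .blocks 0).filter (m₁.arr .split · = 1)).length := by
      simpa using hperm.length_eq
    have hfil : (m₁.lst .blocks 0).filter (m₁.arr .split · = 1) =
        (m.lst .blocks 0).filter (m₁.arr .split · = 1) := by
      have : new.filter (m₁.arr .split · = 1) = [] :=
        List.filter_eq_nil_iff.2 (by simp +contextual [hsn])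
      rw [hn, List.filter_append, this, List.append_nil]
    have hfil' : (m₁.lst .blocks 0).filter (m₁.arr .split · ≠ 1) =
        (m.lst .blocks 0).filter (m₁.arr .split · ≠ 1) ++ new := by
      have : new.filter (m₁.arr .split · ≠ 1) = new :=
        List.filter_eq_self.2 (by simp +contextual [hsn])
      rw [hn, List.filter_append, this]
    rw [wp_block_cons, wp_assign, wp_block_cons]
    refine (wp_resetFlags (m := m₁.setReg .D ((m₁.lst .blocks 0).headD 0)) w₁ (by simp) ?_
      h01).mono ?_
    · intro D hD
      refine h1.other D fun h' => hD ?_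
      simp [hn, h']
    rintro m₂ k₂ hf₂ ⟨hk₂, hb₂, hi₂, hs₂⟩
    rw [wp_block_nil]
    replace hk₂ : k₂ ≤ 4 + 40 * ((m₁.lst .blocks 0).length +
      ((m₁.lst .blocks 0).filter (m₁.arr .split · = 1)).length) := hk₂
    replace hb₂ : m₂.lst .blocks 0 = (m₁.lst .blocks 0).filter (m₁.arr .split · ≠ 1) ++
      (m₁.lst .blocks 0).filter (m₁.arr .split · = 1) := hb₂
    rw [hfil] at hk₂
    have hmb : ∀ B, B ∈ m₂.lst .blocks 0 ↔ B ∈ m₁.lst .blocks 0 := by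
      intro B
      rw [hb₂]
      simp only [List.mem_append, List.mem_filter, decide_eq_true_eq, ne_eq]
      tauto
    rw [hfil, hfil'] at hb₂
    have hmem₂ : m₂.lst .members = m₁.lst .members := by rw [hf₂.lst .members rfl]; simp
    have hblk₂ : m₂.arr .block = m₁.arr .block := by rw [hf₂.arr .block rfl]; simp
    have hnum₂ : m₂.reg .numBlk = m₁.reg .numBlk := by rw [hf₂.reg .numBlk rfl]; simp
    refine ⟨?_, ⟨?_, ?_, ?_, ?_, ?_, hi₂, hs₂⟩, fun D => decide (m₁.arr .split D = 1), new,
      ⟨?_, hlen, ?_, ?_, ?_⟩⟩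
    · have hl1 := h₀.length_blocks_le hw
      have hl2 := List.length_filter_le (fun D => decide (m₁.arr .split D = 1)) (m.lst .blocks 0)
      have hl3 : (m.lst .ef 0).length ≤ V.length := ((hw .ef 0).1.subperm hS).length_le
      have hl4 : (m₁.lst .blocks 0).length = (m.lst .blocks 0).length + new.length := by simp [hn]
      simp only [Memory.setReg_arr, hz, Exp.cost] at hk₁ ⊢
      omega
    · intro B hB x
      rw [hmem₂, hblk₂]
      exact h1.members_iff h₀ ((hmb B).1 hB) x
    · intro x hx
      rw [hmb, hblk₂, hn, List.mem_append, hm, h1.block x hx]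
      have hbx := h₀.block_mem x hx
      split_ifs with hc
      · exact .inr ⟨_, hbx, hc.2, rfl⟩
      · exact .inl hbx
    · intro B hB
      rw [hmb, hn, List.mem_append] at hB
      rw [hmem₂]
      have hne : ∀ D ∈ m.lst .blocks 0, ∃ x, x ∈ m.lst .members D := fun D hD =>
        List.exists_mem_of_ne_nil _ (h₀.members_ne D hD)
      by_cases hB' : B ∈ m.lst .blocks 0
      · rcases h1.status B hB' with h' | h' | h'
        · obtain ⟨x, hx⟩ := hne B hB'
          exact List.ne_nil_of_mem ((h'.2.2.1 x).2 hx)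
        · obtain ⟨x, hx⟩ := (h2 B hB' h'.2.1).2
          exact List.ne_nil_of_mem ((h'.2.2.1 x).2 hx)
        · obtain ⟨x, hx⟩ := hne B hB'
          exact List.ne_nil_of_mem ((h'.2.2.1 x).2 hx)
      · obtain ⟨D, hD, hs, rfl⟩ := (hm B).1 (hB.resolve_left hB')
        rcases h1.status D hD with h' | h' | h'
        · omega
        · obtain ⟨x, hx⟩ := (h2 D hD hs).1
          exact List.ne_nil_of_mem ((h'.2.2.2 x).2 hx)
        · omega
    · intro B hB
      rw [hmb, hn, List.mem_append] at hB
      rw [hnum₂]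
      rcases hB with hB | hB
      · exact (h₀.block_le B hB).trans h1.num_le
      · obtain ⟨D, hD, hs, rfl⟩ := (hm B).1 hB
        refine (h1.inter_range D hD ?_).2
        rcases h1.status D hD with h' | h' | h'
        · omega
        · exact h'.1
        · omega
    · rw [hnum₂, hmem₂]; exact h1.fresh
    · rw [hb₂]
      simp
    · intro D hD hs
      exact (h2 D hD (by simpa using hs)).2
    · intro D hD hs x
      simp only [decide_eq_false_iff_not] at hs
      rw [hmem₂]
      rcases h1.status D hD with h' | h' | h'
      · exact h'.2.2.1 x
      · exact absurd h'.2.1 hs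
      · exact h'.2.2.1 x
    · intro x hx y hy
      rw [hblk₂]
      exact h1.block_eq_iff h₀ hx hy

end ReachPart

namespace ReachPart

/-! ## The main loop -/

theorem DagInv.congr {V : List ℕ} {adj : ℕ → List ℕ} {m m' : Memory} (h : DagInv V adj m)
    (h1 : m'.lst .sccStates = m.lst .sccStates)
    (h2 : m'.lst .sccs = m.lst .sccs) (h3 : m'.arr .scc = m.arr .scc)
    (h4 : m'.reg .numScc = m.reg .numScc) (h5 : m'.lst .sccPre = m.lst .sccPre) :
    DagInv V adj m' :=
  ⟨h.toSccInv.congr h1 h2 h3 h4, by simpa only [h1, h2, h3, h5] using h.mem_sccPre⟩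

theorem PartInv.congr {V : List ℕ} {m m' : Memory} (h : PartInv V m)
    (h1 : m'.lst .blocks = m.lst .blocks) (h2 : m'.lst .members = m.lst .members)
    (h3 : m'.arr .block = m.arr .block) (h4 : m'.reg .numBlk = m.reg .numBlk)
    (h5 : m'.arr .inter = m.arr .inter) (h6 : m'.arr .split = m.arr .split) : PartInv V m' := by
  obtain ⟨a, b, c, d, e, f, g⟩ := h
  exact ⟨by rwa [h1, h2, h3], by rwa [h1, h3], by rwa [h1, h2], by rwa [h1, h4], by rwa [h2, h4],
    by rwa [h5], by rwa [h6]⟩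

/-- The state `x` leads to a state of the list `M`, where `adj` gives the predecessors. -/
def LeadsTo (adj : ℕ → List ℕ) (M : List ℕ) (x : ℕ) : Prop := ∃ y ∈ M, Reach adj y x

/-- States in the same block agree on whether they lead to the block `B`. -/
def Stable (V : List ℕ) (adj : ℕ → List ℕ) (m : Memory) (B : ℕ) : Prop :=
  ∀ x ∈ V, ∀ y ∈ V, m.arr .block x = m.arr .block y →
    (LeadsTo adj (m.lst .members B) x ↔ LeadsTo adj (m.lst .members B) y)

theorem LeadsTo.mem {V : List ℕ} {adj : ℕ → List ℕ} (hG : IsGraph V adj) {M : List ℕ} {x : ℕ}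
    (hM : ∀ y ∈ M, y ∈ V) (h : LeadsTo adj M x) : x ∈ V := by
  obtain ⟨y, hy, hr⟩ := h
  cases hr with
  | refl => exact hM _ hy
  | tail _ h => exact hG.adj_mem _ _ h

theorem LeadsTo.congr {adj : ℕ → List ℕ} {M M' : List ℕ} (h : ∀ x, x ∈ M ↔ x ∈ M') (x : ℕ) :
    LeadsTo adj M x ↔ LeadsTo adj M' x := by
  simp only [LeadsTo, h]

/-- The body of the main loop. -/
abbrev refineStep : List Cmd := [
  Cmd.assign .stamp (.add (.reg .stamp) (.num 1)),
  Cmd.computeBscc,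
  Cmd.computeEF,
  Cmd.unionEF,
  Cmd.splitBlocks]

/-- Since `adj` lists predecessors, `Reach adj y x` is a path from `x` to `y`; the splitter is
therefore EF of the current block. Each of the four parts of the round is linear. -/
theorem wp_refineStep {V : List ℕ} {adj : ℕ → List ℕ} {m : Memory} {B : ℕ} (hG : IsGraph V adj)
    (hw : m.WF) (hd : DagInv V adj m) (hp : PartInv V m)
    (hst : ∀ i, m.arr .inBscc i ≤ m.reg .stamp ∧ m.arr .mark i ≤ m.reg .stamp)
    (hB : m.reg .B = B) (hBb : B ∈ m.lst .blocks 0) :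
    Wp (Cmd.block refineStep) m fun m' k =>
      k ≤ 500 * V.length + 50 * ∑ x ∈ V.toFinset, (adj x).length + 130 ∧
      DagInv V adj m' ∧ PartInv V m' ∧
      (∀ i, m'.arr .inBscc i ≤ m'.reg .stamp ∧ m'.arr .mark i ≤ m'.reg .stamp) ∧
      ∃ S sp new, (∀ x, x ∈ S ↔ LeadsTo adj (m.lst .members B) x) ∧
        SplitResult V S m m' sp new := by
  have hMV : ∀ x ∈ m.lst .members B, x ∈ V := fun x hx => ((hp.mem_members B hBb x).1 hx).1
  have hMl : (m.lst .members B).length ≤ V.length := ((hw .members B).1.subperm hMV).length_le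
  rw [wp_block_cons, wp_assign, wp_block_cons]
  refine (wp_computeBscc (m := m.setReg .stamp (m.reg .stamp + 1))
    (hd.toSccInv.congr rfl rfl rfl (by simp)) hw (by simpa [hB] using hMV) (fun i => ?_)).mono ?_
  · have := (hst i).1
    simp
    omega
  rintro m₁ k₁ hf₁ ⟨hk₁, hb₁, hi₁⟩
  simp only [Memory.setReg_reg, Memory.setReg_lst, Memory.setReg_arr, if_true, if_false,
    reduceCtorEq, hB] at hk₁ hb₁ hi₁
  have w₁ : m₁.WF := hf₁.wf hw
  have hd₁ : DagInv V adj m₁ := hd.congr (by rw [hf₁.lst _ rfl]; simp)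
    (by rw [hf₁.lst _ rfl]; simp) (by rw [hf₁.arr _ rfl]; simp) (by rw [hf₁.reg _ rfl]; simp)
    (by rw [hf₁.lst _ rfl]; simp)
  have hs₁ : m₁.reg .stamp = m.reg .stamp + 1 := by rw [hf₁.reg .stamp rfl]; simp
  have hsc₁ : m₁.arr .scc = m.arr .scc := by rw [hf₁.arr .scc rfl]; simp
  rw [wp_block_cons]
  refine (wp_computeEF (M := m.lst .members B) hG hd₁ w₁ hMV (by simpa [hsc₁] using hb₁)
    (fun i => ?_)).mono ?_
  · have := (hst i).2
    rw [hf₁.arr .mark rfl, hs₁]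
    simp
    omega
  rintro m₂ k₂ hf₂ ⟨hk₂, hr₂, hrs₂, hm₂⟩
  have w₂ : m₂.WF := hf₂.wf w₁
  have hd₂ : DagInv V adj m₂ := hd₁.congr (hf₂.lst _ rfl) (hf₂.lst _ rfl) (hf₂.arr _ rfl)
    (hf₂.reg _ rfl) (hf₂.lst _ rfl)
  rw [wp_block_cons]
  refine (wp_unionEF hd₂.toSccInv w₂ (by rw [hf₂.lst .sccs rfl]; exact hrs₂)).mono ?_
  rintro m₃ k₃ hf₃ ⟨hk₃, hef₃⟩
  have w₃ : m₃.WF := hf₃.wf w₂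
  have e1 : m₃.lst .blocks = m.lst .blocks := by
    rw [hf₃.lst _ rfl, hf₂.lst _ rfl, hf₁.lst _ rfl]; simp
  have e2 : m₃.lst .members = m.lst .members := by
    rw [hf₃.lst _ rfl, hf₂.lst _ rfl, hf₁.lst _ rfl]; simp
  have e3 : m₃.arr .block = m.arr .block := by
    rw [hf₃.arr _ rfl, hf₂.arr _ rfl, hf₁.arr _ rfl]; simp
  have hp₃ : PartInv V m₃ := hp.congr e1 e2 e3
    (by rw [hf₃.reg _ rfl, hf₂.reg _ rfl, hf₁.reg _ rfl]; simp)
    (by rw [hf₃.arr _ rfl, hf₂.arr _ rfl, hf₁.arr _ rfl]; simp)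
    (by rw [hf₃.arr _ rfl, hf₂.arr _ rfl, hf₁.arr _ rfl]; simp)
  have hS : ∀ x, x ∈ m₃.lst .ef 0 ↔ LeadsTo adj (m.lst .members B) x := by
    intro x
    rw [hef₃, hf₂.arr .scc rfl]
    constructor
    · rintro ⟨hx, hr⟩; exact (hr₂ x hx).1 hr
    · intro h
      have hx := h.mem hG hMV
      exact ⟨hx, (hr₂ x hx).2 h⟩
  rw [wp_block_cons]
  refine (wp_splitBlocks hG.zero w₃ hp₃ (fun x hx => ((hef₃ x).1 hx).1)).mono ?_
  rintro m₄ k₄ hf₄ ⟨hk₄, hp₄, sp, new, hres⟩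
  rw [wp_block_nil]
  have hd₄ : DagInv V adj m₄ := hd₂.congr (by rw [hf₄.lst _ rfl, hf₃.lst _ rfl])
    (by rw [hf₄.lst _ rfl, hf₃.lst _ rfl]) (by rw [hf₄.arr _ rfl, hf₃.arr _ rfl])
    (by rw [hf₄.reg _ rfl, hf₃.reg _ rfl]) (by rw [hf₄.lst _ rfl, hf₃.lst _ rfl])
  have hs₄ : m₄.reg .stamp = m.reg .stamp + 1 := by
    rw [hf₄.reg _ rfl, hf₃.reg _ rfl, hf₂.reg _ rfl, hs₁]
  refine ⟨?_, hd₄, hp₄, fun i => ⟨?_, ?_⟩, m₃.lst .ef 0, sp, new, hS, ?_⟩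
  · simp only [Exp.cost]
    omega
  · rw [hs₄, hf₄.arr _ rfl, hf₃.arr _ rfl, hf₂.arr _ rfl]
    exact hi₁ i
  · rw [hs₄, hf₄.arr _ rfl, hf₃.arr _ rfl, ← hs₁]
    exact hm₂ i
  · obtain ⟨a, b, c, d, e⟩ := hres
    exact ⟨by rwa [e1] at a, by rwa [e1] at b, by rwa [e1, e2] at c, by rwa [e1, e2] at d,
      by rwa [e3] at e⟩

/-- `G` stands for any property of the map from states to blocks that a round preserves; it is later
taken to be reachability by a run. In this way the analysis of the loop needs no Kripke structure.
-/
theorem wp_igptEF {V : List ℕ} {adj : ℕ → List ℕ} {m : Memory} (G : (ℕ → ℕ) → Prop)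
    (hG : IsGraph V adj) (hw : m.WF) (hV : m.lst .states 0 = V) (hpre : m.lst .pre = adj)
    (harr : ∀ a, a ≠ .block → ∀ x, m.arr a x = 0)
    (hlst : ∀ L, L ≠ .states → L ≠ .pre → L ≠ .blocks → L ≠ .members → ∀ i, m.lst L i = [])
    (hreg : ∀ r, r ≠ .numBlk → m.reg r = 0)
    (hp : PartInv V m) (h0 : G (m.arr .block))
    (hstep : ∀ (m m' : Memory) (B : ℕ), PartInv V m → B ∈ m.lst .blocks 0 →
      (∀ x ∈ V, ∀ y ∈ V, m'.arr .block x = m'.arr .block y ↔ m.arr .block x = m.arr .block y ∧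
        (LeadsTo adj (m.lst .members B) x ↔ LeadsTo adj (m.lst .members B) y)) →
      G (m.arr .block) → G (m'.arr .block)) :
    Wp Cmd.igptEF m fun m' k =>
      k ≤ (500 * V.length + 50 * ∑ x ∈ V.toFinset, (adj x).length + 140) * (2 * V.length) +
        (350 * V.length + 150 * ∑ x ∈ V.toFinset, (adj x).length + 50) ∧
      PartInv V m' ∧ G (m'.arr .block) ∧ ∀ B ∈ m'.lst .blocks 0, Stable V adj m' B := by
  unfold Cmd.igptEF
  rw [wp_block_cons]
  refine (wp_computeScc hG hw hV hpre (harr _ (by simp)) (harr _ (by simp)) (harr _ (by simp))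
    (hlst _ (by simp) (by simp) (by simp) (by simp) _)
    (hlst _ (by simp) (by simp) (by simp) (by simp) _)
    (hlst _ (by simp) (by simp) (by simp) (by simp)) (hreg _ (by simp)) (hreg _ (by simp))
    (hlst _ (by simp) (by simp) (by simp) (by simp)) (harr _ (by simp))).mono ?_
  rintro m₁ k₁ hf₁ ⟨hk₁, hd₁⟩
  have w₁ : m₁.WF := hf₁.wf hw
  have hp₁ : PartInv V m₁ := hp.congr (hf₁.lst _ rfl) (hf₁.lst _ rfl) (hf₁.arr _ rfl)
    (hf₁.reg _ rfl) (hf₁.arr _ rfl) (hf₁.arr _ rfl)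
  rw [wp_block_cons]
  set W := 500 * V.length + 50 * ∑ x ∈ V.toFinset, (adj x).length + 140 with hW
  -- `W` bounds the cost of a round, and its factor bounds the number of rounds left. A round that
  -- properly splits `j` blocks puts at most `2 j` further entries behind `B` and raises the number
  -- of blocks by `j`; passing `B` takes one away. The subtraction is never truncated, as there are
  -- at most `V.length` blocks.
  refine wp_scan (fun n m₂ dn rest => DagInv V adj m₂ ∧ PartInv V m₂ ∧
    (∀ i, m₂.arr .inBscc i ≤ m₂.reg .stamp ∧ m₂.arr .mark i ≤ m₂.reg .stamp) ∧
    (∀ B ∈ dn, Stable V adj m₂ B) ∧ G (m₂.arr .block) ∧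
    n = W * (rest.length + 2 * (V.length - (m₂.lst .blocks 0).length))) 0 _ w₁
    (fun _ _ => rfl) rfl ⟨?_, ?_, ?_, by simp, ?_, rfl⟩ ?_ ?_
  · exact hd₁.congr rfl rfl rfl (by simp) rfl
  · exact hp₁.congr rfl rfl rfl (by simp) rfl rfl
  · intro i
    simp only [Memory.setReg_arr]
    rw [hf₁.arr .inBscc rfl, hf₁.arr .mark rfl, harr _ (by simp), harr _ (by simp)]
    simp
  · simp only [Memory.setReg_arr]
    rw [hf₁.arr .block rfl]
    exact h0
  · rintro n m₂ dn B rest hf₂ w₂ hl hB ⟨hd₂, hp₂, hst₂, hdn, hG₂, hn⟩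
    have hBb : B ∈ m₂.lst .blocks 0 := by rw [hl]; simp
    refine (wp_refineStep hG w₂ hd₂ hp₂ hst₂ hB hBb).mono ?_
    rintro m₃ k hf₃ ⟨hk, hd₃, hp₃, hst₃, S, sp, new, hS, hres⟩
    have w₃ : m₃.WF := hf₃.wf w₂
    -- Paths of length `0` give `B ⊆ EF(B)`. So the current block is never split properly and the
    -- scan continues from its place.
    have hspB : sp B = false := by
      by_contra hsp
      obtain ⟨x, hx, hxS⟩ := hres.split B hBb (by simpa using hsp)
      exact hxS ((hS x).2 ⟨x, hx, .refl⟩)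
    have hblk : ∀ x ∈ V, ∀ y ∈ V, m₃.arr .block x = m₃.arr .block y ↔
        m₂.arr .block x = m₂.arr .block y ∧
        (LeadsTo adj (m₂.lst .members B) x ↔ LeadsTo adj (m₂.lst .members B) y) := by
      intro x hx y hy
      rw [hres.block_eq x hx y hy, hS, hS]
    have hb := hres.blocks
    have hbl := hp₃.length_blocks_le w₃
    rw [hl] at hb
    refine ⟨_, dn.filter (fun D => !sp D),
      rest.filter (fun D => !sp D) ++ new ++ (dn ++ B :: rest).filter sp, ?_, ?_,
      hd₃.congr rfl rfl rfl (by simp) rfl, hp₃.congr rfl rfl rfl (by simp) rfl rfl,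
      by simpa using hst₃, ?_, ?_, rfl⟩
    · rw [hb]
      simp [List.filter_append, hspB]
    · have h1 := List.length_filter_le (fun D => !sp D) rest
      have h2 := hres.length_new
      rw [hl] at h2
      have h3 : (m₃.lst .blocks 0).length = (m₂.lst .blocks 0).length + new.length := by
        rw [hres.blocks, List.length_append, List.length_append, ← hres.length_new]
        have := List.length_eq_length_filter_add (l := m₂.lst .blocks 0) sp
        have h2 := hres.length_new
        omega
      have h4 : (rest.filter (fun D => !sp D) ++ new ++ (dn ++ B :: rest).filter sp).length +
          2 * (V.length - (m₃.lst .blocks 0).length) + 1 ≤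
          (B :: rest).length + 2 * (V.length - (m₂.lst .blocks 0).length) := by
        simp only [List.length_append, List.length_cons, ← h2]
        omega
      have h5 := Nat.mul_le_mul_left W h4
      rw [Nat.mul_add, Nat.mul_one, ← hn] at h5
      simp only [Exp.cost, Memory.setReg_lst]
      omega
    -- What stands up to `B` after the round was not split: same members, hence same EF, and a finer
    -- partition keeps it stable. `B` itself is stable because the round split by EF(B).
    · intro D hD x hx y hy hxy
      simp only [Memory.setReg_arr, Memory.setReg_lst] at hxy ⊢
      rw [hblk x hx y hy] at hxy
      have hD' : D ∈ m₂.lst .blocks 0 ∧ sp D = false ∧ (D ∈ dn ∨ D = B) := by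
        rcases List.mem_append.1 hD with hD | hD
        · have := List.mem_filter.1 hD
          exact ⟨by rw [hl]; simp [this.1], by simpa using this.2, .inl this.1⟩
        · simp at hD
          rw [hD]
          exact ⟨hBb, hspB, .inr rfl⟩
      rw [LeadsTo.congr (hres.unsplit D hD'.1 hD'.2.1), LeadsTo.congr (hres.unsplit D hD'.1 hD'.2.1)]
      rcases hD'.2.2 with h | rfl
      · exact hdn D h x hx y hy hxy.1
      · exact hxy.2
    · exact hstep m₂ m₃ B hp₂ hBb hblk hG₂
  · rintro n m₂ k hf₂ w₂ hk ⟨-, hp₂, -, hdn, hG₂, -⟩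
    rw [wp_block_nil]
    refine ⟨?_, hp₂, hG₂, hdn⟩
    have hl := hp₁.length_blocks_le w₁
    have h1 : (m₁.lst .blocks 0).length + 2 * (V.length - (m₁.lst .blocks 0).length) ≤
        2 * V.length := by omega
    have h2 := Nat.mul_le_mul_left W h1
    simp only [Memory.setReg_lst, Exp.cost] at hk
    omega

end ReachPart

namespace ReachPart

/-! ## Runs of the algorithm compute the coarsest strongly preserving partition -/

namespace Kripke

variable {S AP : Type*} (K : Kripke S AP)

/-- Replaces the paths of `EU`, which are functions on `ℕ`, by `ReflTransGen`, the form in which the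
search delivers them. -/
theorem mem_EF {X : Set S} {s : S} :
    s ∈ K.EF X ↔ ∃ t ∈ X, Relation.ReflTransGen K.Trans s t := by
  constructor
  · rintro (h | ⟨-, n, p, rfl, hp, hn⟩)
    · exact ⟨s, h, .refl⟩
    · refine ⟨p n, hn, ?_⟩
      have : ∀ i ≤ n, Relation.ReflTransGen K.Trans (p 0) (p i) := by
        intro i
        induction i with
        | zero => intro; exact .refl
        | succ i ih => intro hi; exact (ih (by omega)).tail (hp i (by omega)).2
      exact this n le_rfl
  · rintro ⟨t, ht, hr⟩
    refine .inr ⟨trivial, ?_⟩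
    induction hr using Relation.ReflTransGen.head_induction_on with
    | refl => exact ⟨0, fun _ => t, rfl, by simp, ht⟩
    | @head a b hab _ ih =>
      obtain ⟨n, p, h0, hp, hn⟩ := ih
      refine ⟨n + 1, fun i => Nat.casesOn i a p, rfl, fun i hi => ?_, hn⟩
      cases i with
      | zero => exact ⟨trivial, by simpa [h0] using hab⟩
      | succ i => exact ⟨trivial, (hp i (by omega)).2⟩

/-- Reduces splitting a partition to intersecting equivalence relations. The nonemptiness required
in `meet` supplies the representative of the new class. -/
theorem meet_classes {r r' : Setoid S} {E : Set S}
    (h : ∀ s t, r' s t ↔ r s t ∧ (s ∈ E ↔ t ∈ E)) : meet r.classes {E, Eᶜ} = r'.classes := by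
  ext X
  constructor
  · rintro ⟨B, ⟨b, rfl⟩, C, hC, rfl, x, hx, hxC⟩
    refine ⟨x, ?_⟩
    ext y
    have hxb : r x b := hx
    simp only [Set.mem_inter_iff, Set.mem_ofPred_eq]
    rw [h]
    rcases hC with rfl | rfl
    · exact ⟨fun ⟨h1, h2⟩ => ⟨r.trans' h1 (r.symm' hxb), by simp [h2, hxC]⟩,
        fun ⟨h1, h2⟩ => ⟨r.trans' h1 hxb, h2.2 hxC⟩⟩
    · have hxC' : x ∉ E := hxC
      exact ⟨fun ⟨h1, h2⟩ => ⟨r.trans' h1 (r.symm' hxb), by simpa [hxC'] using h2⟩,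
        fun ⟨h1, h2⟩ => ⟨r.trans' h1 hxb, by simpa [hxC'] using h2⟩⟩
  · rintro ⟨x, rfl⟩
    by_cases hx : x ∈ E
    · refine ⟨_, ⟨x, rfl⟩, E, by simp, ?_, x, r'.refl' x⟩
      ext y
      simp only [Set.mem_inter_iff, Set.mem_ofPred_eq]
      rw [h]
      simp [hx]
    · refine ⟨_, ⟨x, rfl⟩, Eᶜ, by simp, ?_, x, r'.refl' x⟩
      ext y
      simp only [Set.mem_inter_iff, Set.mem_ofPred_eq, Set.mem_compl_iff]
      rw [h]
      simp [hx]

theorem refines_meet (P Q : Set (Set S)) : Refines (meet P Q) P := by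
  rintro X ⟨B, hB, C, -, rfl, -⟩
  exact ⟨B, hB, Set.inter_subset_left⟩

/-- One step of the algorithm, if it changes the partition. -/
theorem step_or_eq {P P' : Set (Set S)} {B : Set S} (hB : B ∈ P) (h : P' = K.refineEF P B) :
    Relation.ReflTransGen (fun X Y => ∃ B ∈ K.blockRefiners X, Y = K.refineEF X B) P P' := by
  -- The program also splits by blocks that are not refiners; such a round corresponds to no step of
  -- the run.
  by_cases e : K.refineEF P B = P
  · rw [h, e]
  · exact .single ⟨B, ⟨hB, refines_meet _ _, e⟩, h⟩

/-- On a finite set of states, a class of logical equivalence is defined by a formula, unless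
it is the only one. -/
theorem exists_formula [Finite S] (b : S) :
    (∀ s, K.logicSetoid s b) ∨ ∃ φ, ∀ s, s ∈ K.sem φ ↔ K.logicSetoid s b := by
  have := Fintype.ofFinite S
  classical
  -- The formula is a conjunction of formulae true at `b`, each excluding a state that is not
  -- equivalent to `b`. The first alternative is the empty conjunction: the language has no constant
  -- for truth, and without atoms no formula at all.
  suffices H : ∀ F : Finset S, (∀ s ∈ F, K.logicSetoid s b) ∨
      ∃ φ, b ∈ K.sem φ ∧ ∀ s ∈ F, s ∈ K.sem φ → K.logicSetoid s b by
    rcases H Finset.univ with h | ⟨φ, hb, h⟩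
    · exact .inl fun s => h s (Finset.mem_univ s)
    · exact .inr ⟨φ, fun s => ⟨h s (Finset.mem_univ s), fun hs => (hs φ).2 hb⟩⟩
  intro F
  induction F using Finset.induction_on with
  | empty => simp
  | insert a F _ ih =>
    by_cases ha : K.logicSetoid a b
    · rcases ih with h | ⟨φ, hb, h⟩
      · exact .inl fun s hs => by
          rcases Finset.mem_insert.1 hs with rfl | hs
          · exact ha
          · exact h s hs
      · refine .inr ⟨φ, hb, fun s hs hφ => ?_⟩
        rcases Finset.mem_insert.1 hs with rfl | hs
        · exact ha
        · exact h s hs hφ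
    · right
      obtain ⟨ψ, hbψ, haψ⟩ : ∃ ψ, b ∈ K.sem ψ ∧ a ∉ K.sem ψ := by
        have ha' : ¬ ∀ φ, a ∈ K.sem φ ↔ b ∈ K.sem φ := ha
        obtain ⟨ψ, hψ⟩ := not_forall.1 ha'
        by_cases hb : b ∈ K.sem ψ
        · exact ⟨ψ, hb, fun ha => hψ (by simp [ha, hb])⟩
        · refine ⟨.neg ψ, hb, fun ha => hψ ?_⟩
          have : a ∉ K.sem ψ := ha
          simp [this, hb]
      rcases ih with h | ⟨φ, hb, h⟩
      · refine ⟨ψ, hbψ, fun s hs hs' => ?_⟩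
        rcases Finset.mem_insert.1 hs with rfl | hs
        · exact absurd hs' haψ
        · exact h s hs
      · refine ⟨.and φ ψ, ⟨hb, hbψ⟩, fun s hs hs' => ?_⟩
        rcases Finset.mem_insert.1 hs with rfl | hs
        · exact absurd hs'.2 haψ
        · exact h s hs hs'.1

/-- `EF` preserves unions of classes of logical equivalence. -/
theorem mem_EF_of_logic [Finite S] {B : Set S}
    (hB : ∀ s t, K.logicSetoid s t → t ∈ B → s ∈ B) {s t : S} (h : K.logicSetoid s t)
    (ht : t ∈ K.EF B) : s ∈ K.EF B := by
  obtain ⟨b, hb, hr⟩ := K.mem_EF.1 ht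
  -- If there is only one class, then `B` is everything. Otherwise `EF φ`, with `φ` defining the
  -- class of `b`, is a formula on which `s` and `t` agree.
  rcases K.exists_formula b with H | ⟨φ, hφ⟩
  · exact K.mem_EF.2 ⟨s, hB s b (H s) hb, .refl⟩
  · have h1 : t ∈ K.sem (.ef φ) := K.mem_EF.2 ⟨b, (hφ b).2 (K.logicSetoid.refl' b), hr⟩
    obtain ⟨c, hc, hr'⟩ := K.mem_EF.1 ((h (.ef φ)).2 h1)
    exact K.mem_EF.2 ⟨c, hB c b ((hφ c).1 hc) hb, hr'⟩

/-- The result of a terminating run is the coarsest strongly preserving partition. -/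
theorem IGPTRun.isCoarsestStronglyPreserving [Finite S] {Q : Set (Set S)}
    (h : K.IGPTRun K.labelPartition Q) : K.IsCoarsestStronglyPreserving Q := by
  obtain ⟨hrun, hfinal⟩ := h
  have hmeet : ∀ (r : Setoid S) (B : Set S), K.refineEF r.classes B =
      (r ⊓ Setoid.ker (· ∈ K.EF B)).classes := fun r B => meet_classes fun s t =>
    and_congr Iff.rfl eq_iff_iff
  -- The condition `K.logicSetoid ≤ r` says that blocks are unions of logical classes, which is
  -- exactly what `mem_EF_of_logic` needs to preserve it.
  have hinv : ∃ r : Setoid S, Q = r.classes ∧ r ≤ Setoid.ker K.label ∧ K.logicSetoid ≤ r := by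
    clear hfinal
    induction hrun with
    | refl =>
      refine ⟨_, rfl, le_rfl, fun {s t} hst => ?_⟩
      ext p
      exact hst (.atom p)
    | @tail P P' _ hstep ih =>
      obtain ⟨B, hB, rfl⟩ := hstep
      obtain ⟨r, rfl, h1, h2⟩ := ih
      refine ⟨_, hmeet r B, inf_le_left.trans h1, le_inf h2 fun {s t} hst => ?_⟩
      obtain ⟨b, rfl⟩ := hB.1
      have hsat : ∀ s t, K.logicSetoid s t → t ∈ {x | r x b} → s ∈ {x | r x b} :=
        fun s t hst ht => r.trans' (h2 hst) ht
      exact propext ⟨K.mem_EF_of_logic hsat (K.logicSetoid.symm' hst), K.mem_EF_of_logic hsat hst⟩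
  obtain ⟨r, rfl, h1, h2⟩ := hinv
  -- If two states of one block disagreed on EF of the block of `b`, that block would be a refiner.
  have hstable : ∀ b s t, r s t → (s ∈ K.EF {x | r x b} ↔ t ∈ K.EF {x | r x b}) := by
    intro b s t hst
    by_contra hne
    have hB : {x | r x b} ∈ K.blockRefiners r.classes := by
      refine ⟨⟨b, rfl⟩, refines_meet _ _, fun e => hne ?_⟩
      rw [hmeet, ← Setoid.classes_inj] at e
      have : (r ⊓ Setoid.ker (· ∈ K.EF {x | r x b})) s t := by rw [e]; exact hst
      exact iff_of_eq this.2
    rw [hfinal] at hB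
    exact hB
  have h3 : r ≤ K.logicSetoid := by
    intro s t hst φ
    induction φ generalizing s t with
    | atom p =>
      have : K.label s = K.label t := h1 hst
      simp [sem, this]
    | and φ ψ ih₁ ih₂ => exact and_congr (ih₁ hst) (ih₂ hst)
    | neg φ ih => exact not_congr (ih hst)
    | ef φ ih =>
      -- The state `b` reached by `s` is replaced by its whole block. By stability `t` reaches some
      -- `c` in that block, and `φ` passes from `b` to `c` by induction.
      have key : ∀ {s t}, r s t → s ∈ K.EF (K.sem φ) → t ∈ K.EF (K.sem φ) := by
        intro s t hst hs
        obtain ⟨b, hb, hr⟩ := K.mem_EF.1 hs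
        obtain ⟨c, hc, hr'⟩ := K.mem_EF.1
          ((hstable b s t hst).1 (K.mem_EF.2 ⟨b, r.refl' b, hr⟩))
        exact K.mem_EF.2 ⟨c, (ih hc).2 hb, hr'⟩
      exact ⟨key hst, key (r.symm' hst)⟩
  have hr : r = K.logicSetoid := le_antisymm h3 h2
  subst hr
  exact ⟨⟨Setoid.isPartition_classes _, fun B hB => ⟨B, hB, subset_rfl⟩⟩, fun Q hQ => hQ.2⟩

end Kripke

end ReachPart

namespace ReachPart

/-! ## Correctness and complexity of the program -/

namespace Input

variable {S : Type*} [Fintype S] {AP : Type*} {K : Kripke S AP} (I : Input K)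

/-! ### The numbering of the states and the initial memory -/

@[simp]
theorem decode_code (s : S) : I.decode (I.code s) = some s := by
  simp [decode, code]

theorem code_injective : Function.Injective I.code := fun s t h => by
  have := I.decode_code s
  rwa [h, decode_code, Option.some_inj, eq_comm] at this

theorem eq_code_of_decode {x : ℕ} {s : S} (h : I.decode x = some s) : x = I.code s := by
  cases x with
  | zero => simp [decode] at h
  | succ x =>
    simp only [decode] at h
    split at h
    · simp only [Option.some_inj] at h
      simp [code, ← h]
    · simp at h

/-- The list of the numbers of all states. -/
abbrev states : List ℕ := List.range' 1 (Fintype.card S)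

theorem mem_states {x : ℕ} : x ∈ states (S := S) ↔ ∃ s, I.code s = x := by
  simp only [states, List.mem_range'_1]
  constructor
  · rintro ⟨h1, h2⟩
    refine ⟨I.num.symm ⟨x - 1, by omega⟩, ?_⟩
    simp only [code, Equiv.apply_symm_apply]
    omega
  · rintro ⟨s, rfl⟩
    have := (I.num s).2
    simp only [code]
    omega

theorem code_mem_states (s : S) : I.code s ∈ states (S := S) := I.mem_states.2 ⟨s, rfl⟩

theorem pre_code (s : S) : I.initial.lst .pre (I.code s) = (I.pre s).map I.code := by
  simp [initial]

theorem pre_eq (x : ℕ) : I.initial.lst .pre x = [] ∨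
    ∃ s, x = I.code s ∧ I.initial.lst .pre x = (I.pre s).map I.code := by
  cases h : I.decode x with
  | none => left; simp [initial, h]
  | some s => exact .inr ⟨s, I.eq_code_of_decode h, by simp [initial, h]⟩

theorem code_mem_pre {s t : S} : I.code s ∈ I.initial.lst .pre (I.code t) ↔ K.Trans s t := by
  rw [pre_code, List.mem_map_of_injective I.code_injective, I.mem_pre]

theorem isGraph : IsGraph (states (S := S)) (I.initial.lst .pre) where
  nodup := List.nodup_range'
  zero := by simp
  adj_nodup x := by
    obtain h | ⟨s, -, h⟩ := I.pre_eq x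
    · simp [h]
    · rw [h]; exact (I.pre_nodup s).map I.code_injective
  adj_mem x y hy := by
    obtain h | ⟨s, -, h⟩ := I.pre_eq x
    · simp [h] at hy
    · rw [h, List.mem_map] at hy
      obtain ⟨r, -, rfl⟩ := hy
      exact I.code_mem_states r

theorem wf_map_code {l : List S} (h : l.Nodup) :
    (l.map I.code).Nodup ∧ 0 ∉ l.map I.code :=
  ⟨h.map I.code_injective, by simp [code]⟩

theorem initial_wf : I.initial.WF := by
  intro L i
  cases L with
  | states => cases i <;> simp [initial, List.nodup_range']
  | blocks => cases i <;> simp [initial, List.nodup_range']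
  | pre =>
    obtain h | ⟨s, -, h⟩ := I.pre_eq i
    · simp [h]
    · rw [h]; exact I.wf_map_code (I.pre_nodup s)
  | members =>
    cases i with
    | zero => simp [initial]
    | succ i =>
      refine I.wf_map_code (l := I.blocks.getD i []) ?_
      by_cases hi : i < I.blocks.length
      · rw [List.getD_eq_getElem _ _ hi]
        exact I.members_nodup _ (List.getElem_mem hi)
      · rw [List.getD_eq_default _ _ (not_lt.1 hi)]
        exact List.nodup_nil
  | _ => simp [initial]

/-- The adjacency lists of the memory hold predecessors, so a path in them is a path of the
structure read backwards. -/
theorem reach_code {t : S} {x : ℕ} : Reach (I.initial.lst .pre) (I.code t) x ↔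
    ∃ s, I.code s = x ∧ Relation.ReflTransGen K.Trans s t := by
  constructor
  · intro h
    induction h with
    | refl => exact ⟨t, rfl, .refl⟩
    | tail _ h ih =>
      obtain ⟨s, rfl, hs⟩ := ih
      obtain ⟨r, rfl⟩ := I.mem_states.1 (I.isGraph.adj_mem _ _ h)
      exact ⟨r, rfl, .head (I.code_mem_pre.1 h) hs⟩
  · rintro ⟨s, rfl, h⟩
    induction h using Relation.ReflTransGen.head_induction_on with
    | refl => exact .refl
    | head h _ ih => exact ih.tail (I.code_mem_pre.2 h)

theorem leadsTo_code {M : List ℕ} (hM : ∀ x ∈ M, x ∈ states (S := S)) {s : S} :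
    LeadsTo (I.initial.lst .pre) M (I.code s) ↔ s ∈ K.EF {t | I.code t ∈ M} := by
  rw [K.mem_EF]
  constructor
  · rintro ⟨y, hy, hr⟩
    obtain ⟨t, rfl⟩ := I.mem_states.1 (hM y hy)
    obtain ⟨s', hs, h⟩ := I.reach_code.1 hr
    rw [I.code_injective hs] at h
    exact ⟨t, hy, h⟩
  · rintro ⟨t, ht, h⟩
    exact ⟨_, ht, I.reach_code.2 ⟨s, rfl, h⟩⟩

/-! ### The initial partition -/

theorem setOf_mem_block {B : List S} (hB : B ∈ I.blocks) : {s | s ∈ B} ∈ K.labelPartition := by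
  rw [← I.mem_blocks]
  exact List.mem_map_of_mem (f := fun B : List S => {s | s ∈ B}) hB

theorem mem_block_iff {B : List S} (hB : B ∈ I.blocks) {s : S} (hs : s ∈ B) (t : S) :
    t ∈ B ↔ K.label t = K.label s := by
  obtain ⟨a, ha⟩ := I.setOf_mem_block hB
  have key : ∀ x, x ∈ B ↔ K.label x = K.label a := fun x => by
    change x ∈ {x | x ∈ B} ↔ _
    rw [ha]
    rfl
  rw [key, ← (key s).1 hs]

theorem exists_block (s : S) : ∃ B ∈ I.blocks, s ∈ B := by
  have h : {t | K.label t = K.label s} ∈ K.labelPartition := ⟨s, rfl⟩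
  rw [← I.mem_blocks] at h
  obtain ⟨B, hB, h⟩ := List.mem_map.1 h
  refine ⟨B, hB, ?_⟩
  have : s ∈ {x | x ∈ B} := by rw [h]; rfl
  exact this

theorem block_ne_nil {B : List S} (hB : B ∈ I.blocks) : B ≠ [] := by
  obtain ⟨a, ha⟩ := I.setOf_mem_block hB
  have : a ∈ {x | x ∈ B} := by rw [ha]; rfl
  exact List.ne_nil_of_mem this

theorem block_code (s : S) : ∃ i, ∃ h : i < I.blocks.length,
    I.initial.arr .block (I.code s) = i + 1 ∧ s ∈ I.blocks[i] := by
  classical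
  have hlt : I.blocks.findIdx (fun B => decide (s ∈ B)) < I.blocks.length :=
    List.findIdx_lt_length_of_exists (by simpa using I.exists_block s)
  refine ⟨_, hlt, ?_, ?_⟩
  · simp only [initial, decode_code]
  · simpa using List.findIdx_getElem (w := hlt)

/-- The initial memory records the first block that contains `s`. It is the only one: blocks with a
common state are the same label class, and `blocks_nodup` forbids listing a set twice, even in
different orders. -/
theorem block_code_eq_iff {s : S} {i : ℕ} (hi : i < I.blocks.length) :
    I.initial.arr .block (I.code s) = i + 1 ↔ s ∈ I.blocks[i] := by
  obtain ⟨j, hj, h, hs⟩ := I.block_code s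
  rw [h, Nat.succ_inj]
  constructor
  · rintro rfl; exact hs
  · intro hs'
    refine (I.blocks_nodup.getElem_inj_iff (i := j) (j := i) (hi := by simpa) (hj := by simpa)).1 ?_
    simp only [List.getElem_map]
    ext t
    change t ∈ I.blocks[j] ↔ t ∈ I.blocks[i]
    rw [I.mem_block_iff (List.getElem_mem hj) hs, I.mem_block_iff (List.getElem_mem hi) hs']

theorem block_code_eq_block_code {s t : S} :
    I.initial.arr .block (I.code s) = I.initial.arr .block (I.code t) ↔
      K.label s = K.label t := by
  obtain ⟨i, hi, h, ht⟩ := I.block_code t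
  rw [h, I.block_code_eq_iff hi, I.mem_block_iff (List.getElem_mem hi) ht]

theorem members_succ {i : ℕ} (hi : i < I.blocks.length) :
    I.initial.lst .members (i + 1) = I.blocks[i].map I.code := by
  simp [initial, hi]

theorem exists_of_mem_blocks {B : ℕ} (hB : B ∈ I.initial.lst .blocks 0) :
    ∃ i < I.blocks.length, B = i + 1 := by
  have : B ∈ List.range' 1 I.blocks.length := hB
  rw [List.mem_range'_1] at this
  exact ⟨B - 1, by omega, by omega⟩

theorem initial_partInv : PartInv (states (S := S)) I.initial where
  mem_members B hB x := by
    obtain ⟨i, hi, rfl⟩ := I.exists_of_mem_blocks hB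
    rw [I.members_succ hi, I.mem_states, List.mem_map]
    constructor
    · rintro ⟨s, hs, rfl⟩
      exact ⟨⟨s, rfl⟩, (I.block_code_eq_iff hi).2 hs⟩
    · rintro ⟨⟨s, rfl⟩, h⟩
      exact ⟨s, (I.block_code_eq_iff hi).1 h, rfl⟩
  block_mem x hx := by
    obtain ⟨s, rfl⟩ := I.mem_states.1 hx
    obtain ⟨i, hi, h, -⟩ := I.block_code s
    rw [h]
    change _ ∈ List.range' 1 I.blocks.length
    rw [List.mem_range'_1]
    omega
  members_ne B hB := by
    obtain ⟨i, hi, rfl⟩ := I.exists_of_mem_blocks hB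
    rw [I.members_succ hi]
    simpa using I.block_ne_nil (List.getElem_mem hi)
  block_le B hB := by
    obtain ⟨i, hi, rfl⟩ := I.exists_of_mem_blocks hB
    exact hi
  fresh B hB := by
    have hB' : I.blocks.length < B := hB
    obtain ⟨i, rfl⟩ : ∃ i, B = i + 1 := ⟨B - 1, by omega⟩
    simp [initial, List.getElem?_eq_none (by omega : I.blocks.length ≤ i)]
  inter_eq _ := rfl
  split_eq _ := rfl

/-! ### The partition held by a memory -/

/-- The states `s` and `t` are in the same block when `f` maps numbers of states to blocks. -/
abbrev blockSetoid (f : ℕ → ℕ) : Setoid S := Setoid.ker fun s => f (I.code s)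

theorem mem_members_code {m : Memory} (h : PartInv (states (S := S)) m) {B : ℕ}
    (hB : B ∈ m.lst .blocks 0) (s : S) :
    I.code s ∈ m.lst .members B ↔ m.arr .block (I.code s) = B := by
  rw [h.mem_members B hB]
  exact and_iff_right (I.code_mem_states s)

theorem exists_block_code {m : Memory} (h : PartInv (states (S := S)) m) {B : ℕ}
    (hB : B ∈ m.lst .blocks 0) : ∃ s, m.arr .block (I.code s) = B := by
  obtain ⟨x, hx⟩ := List.exists_mem_of_ne_nil _ (h.members_ne B hB)
  obtain ⟨h1, h2⟩ := (h.mem_members B hB x).1 hx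
  obtain ⟨s, rfl⟩ := I.mem_states.1 h1
  exact ⟨s, h2⟩

theorem setOf_mem_output {m : Memory} (h : PartInv (states (S := S)) m) :
    {B | B ∈ I.output m} = (I.blockSetoid (m.arr .block)).classes := by
  ext X
  change X ∈ I.output m ↔ _
  simp only [output, List.mem_map]
  constructor
  · rintro ⟨B, hB, rfl⟩
    obtain ⟨s, rfl⟩ := I.exists_block_code h hB
    refine ⟨s, ?_⟩
    ext t
    exact I.mem_members_code h hB t
  · rintro ⟨s, rfl⟩
    refine ⟨_, h.block_mem _ (I.code_mem_states s), ?_⟩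
    ext t
    exact I.mem_members_code h (h.block_mem _ (I.code_mem_states s)) t

theorem nodup_output {m : Memory} (h : PartInv (states (S := S)) m) (hw : m.WF) :
    (I.output m).Nodup := by
  refine List.Nodup.map_on ?_ (hw .blocks 0).1
  intro B hB C hC hBC
  obtain ⟨s, hs⟩ := I.exists_block_code h hB
  have h1 : s ∈ {t | I.code t ∈ m.lst .members B} := (I.mem_members_code h hB s).2 hs
  rw [hBC] at h1
  exact hs.symm.trans ((I.mem_members_code h hC s).1 h1)

/-- Splitting the partition by the set of states that lead to the block `B`. -/
theorem refineEF_blockSetoid {m : Memory} (h : PartInv (states (S := S)) m) {B : ℕ}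
    (hB : B ∈ m.lst .blocks 0) {f : ℕ → ℕ}
    (hf : ∀ x ∈ states (S := S), ∀ y ∈ states (S := S), f x = f y ↔
      m.arr .block x = m.arr .block y ∧ (LeadsTo (I.initial.lst .pre) (m.lst .members B) x ↔
        LeadsTo (I.initial.lst .pre) (m.lst .members B) y)) :
    K.refineEF (I.blockSetoid (m.arr .block)).classes {s | I.code s ∈ m.lst .members B} =
      (I.blockSetoid f).classes := by
  refine Kripke.meet_classes fun s t => ?_
  have hM : ∀ x ∈ m.lst .members B, x ∈ states (S := S) :=
    fun x hx => ((h.mem_members B hB x).1 hx).1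
  rw [← I.leadsTo_code hM, ← I.leadsTo_code hM]
  exact hf _ (I.code_mem_states s) _ (I.code_mem_states t)

theorem setOf_members_mem {m : Memory} (h : PartInv (states (S := S)) m) {B : ℕ}
    (hB : B ∈ m.lst .blocks 0) :
    {s | I.code s ∈ m.lst .members B} ∈ (I.blockSetoid (m.arr .block)).classes := by
  rw [← I.setOf_mem_output h]
  exact List.mem_map_of_mem (f := fun B => {s | I.code s ∈ m.lst .members B}) hB

/-! ### The size of the input -/

/-- A transition from `r` to `s` is counted once, as the entry `r` in the list of `s`. -/
theorem sum_length_pre :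
    ∑ x ∈ (states (S := S)).toFinset, (I.initial.lst .pre x).length = K.numTrans := by
  classical
  have h1 : (states (S := S)).toFinset = Finset.univ.image I.code := by
    ext x
    simp only [List.mem_toFinset, I.mem_states, Finset.mem_image, Finset.mem_univ, true_and]
  have h2 : {p : S × S | K.Trans p.1 p.2} =
      ((Finset.univ.sigma fun s => (I.pre s).toFinset).image fun x => (x.2, x.1) :
        Finset (S × S)) := by
    ext ⟨r, s⟩
    simp [I.mem_pre]
  rw [Kripke.numTrans, h2, Set.ncard_coe_finset, Finset.card_image_of_injective, Finset.card_sigma,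
    h1, Finset.sum_image fun s _ t _ h => I.code_injective h]
  · refine Finset.sum_congr rfl fun s _ => ?_
    rw [pre_code, List.length_map, List.toFinset_card_of_nodup (I.pre_nodup s)]
  · rintro ⟨a, b⟩ ⟨c, d⟩ h
    simp only [Prod.mk.injEq] at h
    obtain ⟨rfl, rfl⟩ := h
    rfl

end Input

/-- A choice of successors `f` gives the injection `s ↦ (s, f s)` into the transitions. This absorbs
the quadratic term in the number of states. -/
theorem Kripke.card_le_numTrans {S AP : Type*} [Fintype S] (K : Kripke S AP) :
    Fintype.card S ≤ K.numTrans := by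
  choose f hf using K.total
  rw [← Nat.card_eq_fintype_card, ← Set.ncard_univ,
    ← Set.ncard_image_of_injective (f := fun s => (s, f s)) _ fun s t h => (Prod.mk.inj h).1]
  refine Set.ncard_le_ncard ?_ (Set.toFinite _)
  rintro _ ⟨s, -, rfl⟩
  exact hf s

/-- `G` becomes the statement that the partition given by the map is reached from `P_ℓ` by steps of
the algorithm. Final stability of a block says that splitting by its EF changes nothing, so no
refiner is left. -/
theorem Input.wp_igptEF {S : Type*} [Fintype S] {AP : Type*} {K : Kripke S AP} (I : Input K) :
    Wp Cmd.igptEF I.initial fun m k =>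
      k ≤ (500 * Fintype.card S + 50 * K.numTrans + 140) * (2 * Fintype.card S) +
        (350 * Fintype.card S + 150 * K.numTrans + 50) ∧
      (I.output m).Nodup ∧ K.IGPTRun K.labelPartition {B | B ∈ I.output m} := by
  have h := ReachPart.wp_igptEF (m := I.initial) (fun f => Relation.ReflTransGen
      (fun X Y => ∃ B ∈ K.blockRefiners X, Y = K.refineEF X B)
      K.labelPartition (I.blockSetoid f).classes)
    I.isGraph I.initial_wf rfl rfl (fun a ha x => by cases a <;> first | rfl | exact absurd rfl ha)
    (fun L h1 h2 h3 h4 i => by cases L <;> first | rfl | contradiction)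
    (fun r hr => by cases r <;> first | rfl | exact absurd rfl hr) I.initial_partInv ?_ ?_
  · rw [I.sum_length_pre, List.length_range'] at h
    obtain ⟨m, k, he, hk, hp, hG, hstable⟩ := h
    refine ⟨m, k, he, hk, I.nodup_output hp (he.frame.wf I.initial_wf), ?_⟩
    rw [I.setOf_mem_output hp]
    refine ⟨hG, ?_⟩
    rw [Set.eq_empty_iff_forall_notMem]
    rintro X ⟨hX, -, hne⟩
    rw [← I.setOf_mem_output hp] at hX
    obtain ⟨B, hB, rfl⟩ := List.mem_map.1 hX
    refine hne (I.refineEF_blockSetoid hp hB fun x hx y hy => ?_)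
    exact (and_iff_left_of_imp (hstable B hB x hx y hy)).symm
  · have : I.blockSetoid (I.initial.arr .block) = Setoid.ker K.label :=
      Setoid.ext fun s t => I.block_code_eq_block_code
    rw [this]
    exact .refl
  · intro m m' B hp hB hf hG
    exact hG.trans (K.step_or_eq (I.setOf_members_mem hp hB)
      (I.refineEF_blockSetoid hp hB hf).symm)

end ReachPart

theorem mainTheorem4 :
    ∃ c : ℕ, ∀ (S : Type*) [Fintype S] [Nonempty S] (AP : Type*)
      (K : ReachPart.Kripke S AP) (I : ReachPart.Input K),
      ∃ (m : ReachPart.Memory) (k : ℕ),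
        ReachPart.Exec ReachPart.Cmd.igptEF I.initial m k ∧
        (I.output m).Nodup ∧
        K.IGPTRun K.labelPartition {B | B ∈ I.output m} ∧
        K.IsCoarsestStronglyPreserving {B | B ∈ I.output m} ∧
        k ≤ c * (Fintype.card S * K.numTrans) := by
  -- With `n` states and `t` transitions, `1 ≤ n ≤ t` bounds each term of the running time by a
  -- multiple of `n t`; the coefficients 1000, 100, 280, 350, 150 and 50 add up to 1930.
  refine ⟨2000, fun S _ _ AP K I => ?_⟩
  obtain ⟨m, k, he, hk, hn, hr⟩ := I.wp_igptEF
  refine ⟨m, k, he, hn, hr, hr.isCoarsestStronglyPreserving, hk.trans ?_⟩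
  have h1 : 1 ≤ Fintype.card S := Fintype.card_pos
  have h2 := K.card_le_numTrans
  nlinarith [Nat.mul_le_mul_left (Fintype.card S) h2, Nat.mul_le_mul_left (Fintype.card S) h1,
    Nat.mul_le_mul h1 h2, Nat.mul_le_mul h1 (h1.trans h2), Nat.mul_le_mul_right K.numTrans h1]
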